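/- Let $U$ be a linearly ordered set of size $n$. For $A,B\subseteq U$ put $I_{A,B}=(-1)^{|\{(a,b)\in A\times B:\ a>b\}|}$, and for $f,g:2^U\times 2^U\to\mathbb Z$ define the two-set non-commutative subset convolution (NSC2) $$(f\diamond_2 g)(X,Y)=\sum_{\substack{X_1\uplus X_2=X\\ Y_1\uplus Y_2=Y}} f(X_1,Y_1)\,g(X_2,Y_2)\,I_{X_1,X_2}\,I_{Y_1,Y_2},$$ where $A\uplus B=C$ means $A\cup B=C$ and $A\cap B=\emptyset$. The functions are given by their tables of values, and running times are measured on a random access machine with logarithmic (bit) cost. Let $\omega$ be the matrix multiplication exponent, i.e. the infimum of all real $\tau$ for which some single algorithm multiplies any two $N\times N$ integer matrices ($N\ge 1$) with entries of absolute value less than $2^b$ in time $N^{\tau}\cdot\mathrm{poly}(\log N,b)$. **Theorem.** NSC2 on an $n$-element universe can be performed in time $O^*(2^{\omega n})$. Precisely: for every $\tau>\omega$, and also for $\tau=\omega$ if the infimum defining $\omega$ is attained, there are a single algorithm and a constant $C$ such that for all $n,b\ge 0$ and all $f,g$ with values of absolute value less than $2^b$ the algorithm computes the whole table of $f\diamond_2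 g$ in time at most $C\cdot 2^{\tau n}\cdot(n+b+1)^{C}$. -/

import Mathlib

namespace NSC

/-! ### The convolution -/

section Convolution

variable {U : Type*} [LinearOrder U]

/-- The sign `I_{A,B} = (-1)^{|{(a,b) ∈ A × B : a > b}|}`. -/
def invSign (A B : Finset U) : ℤ :=
  (-1) ^ ((A ×ˢ B).filter (fun p => p.1 > p.2)).card

/-- All ordered pairs `(A, B)` of disjoint sets with `A ∪ B = X`. -/
def splits [Fintype U] (X : Finset U) : Finset (Finset U × Finset U) :=
  Finset.univ.filter (fun p => Disjoint p.1 p.2 ∧ p.1 ∪ p.2 = X)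

/-- The two-set non-commutative subset convolution `f ◇₂ g`. -/
def nsc2 [Fintype U] (f g : Finset U → Finset U → ℤ) (X Y : Finset U) : ℤ :=
  ∑ p ∈ splits X, ∑ q ∈ splits Y,
    f p.1 q.1 * g p.2 q.2 * invSign p.1 p.2 * invSign q.1 q.2

end Convolution

/-! ### A random access machine with logarithmic cost

A program is a finite structured program.  The machine has integer registers and random access
memory banks, each an infinite array of integers; a given program mentions only finitely many
registers and banks, so they can be seen as the fixed hardware of the machine.  There is no bound on
the integers, but every elementary step is charged according to the bit lengths of all the
integers (operands, addresses, contents) that it handles. -/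

/-- Programs. `x, y, z` are names of registers and `k` is the name of a memory bank. -/
inductive Prog : Type
  /-- do nothing -/
  | skip : Prog
  /-- `x := c` -/
  | const (x : ℕ) (c : ℤ) : Prog
  /-- `x := y` -/
  | copy (x y : ℕ) : Prog
  /-- `x := y + z` -/
  | add (x y z : ℕ) : Prog
  /-- `x := y - z` -/
  | sub (x y z : ℕ) : Prog
  /-- `x := y * z` -/
  | mul (x y z : ℕ) : Prog
  /-- `x := y / z`, Euclidean division of integers (with result `0` if `z = 0`) -/
  | div (x y z : ℕ) : Prog
  /-- `x := bank k [y]` -/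
  | load (x k y : ℕ) : Prog
  /-- `bank k [x] := y` -/
  | store (k x y : ℕ) : Prog
  /-- first `p`, then `q` -/
  | seq (p q : Prog) : Prog
  /-- if `x > 0` then `p` else `q` -/
  | branch (x : ℕ) (p q : Prog) : Prog
  /-- while `x > 0` do `p` -/
  | loop (x : ℕ) (p : Prog) : Prog

/-- A configuration: the contents of the registers and of the memory banks. -/
structure State : Type where
  reg : ℕ → ℤ
  mem : ℕ → ℕ → ℤ

/-- Write `v` into register `x`. -/
def State.setReg (s : State) (x : ℕ) (v : ℤ) : State :=
  { s with reg := Function.update s.reg x v }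

/-- Write `v` into cell `a` of bank `k`. -/
def State.setMem (s : State) (k a : ℕ) (v : ℤ) : State :=
  { s with mem := Function.update s.mem k (Function.update (s.mem k) a v) }

/-- The memory address held in register `x` (a negative integer addresses cell `0`). -/
def State.addr (s : State) (x : ℕ) : ℕ := (s.reg x).toNat

/-- The length of an integer in bits, including one bit for the sign. -/
def bitLen (z : ℤ) : ℕ := Nat.size z.natAbs + 1

/-- `Exec p s s' t`: the program `p`, started in `s`, halts in `s'` after time `t`.
Additions, subtractions and memory accesses take time linear in the bit lengths involved;
multiplications and divisions take quadratic (schoolbook) time. -/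
inductive Exec : Prog → State → State → ℕ → Prop
  | skip (s) : Exec .skip s s 1
  | const (x c s) : Exec (.const x c) s (s.setReg x c) (bitLen c)
  | copy (x y s) : Exec (.copy x y) s (s.setReg x (s.reg y)) (bitLen (s.reg y))
  | add (x y z s) : Exec (.add x y z) s (s.setReg x (s.reg y + s.reg z))
      (bitLen (s.reg y) + bitLen (s.reg z))
  | sub (x y z s) : Exec (.sub x y z) s (s.setReg x (s.reg y - s.reg z))
      (bitLen (s.reg y) + bitLen (s.reg z))
  | mul (x y z s) : Exec (.mul x y z) s (s.setReg x (s.reg y * s.reg z))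
      (bitLen (s.reg y) * bitLen (s.reg z))
  | div (x y z s) : Exec (.div x y z) s (s.setReg x (s.reg y / s.reg z))
      (bitLen (s.reg y) * bitLen (s.reg z))
  | load (x k y s) : Exec (.load x k y) s (s.setReg x (s.mem k (s.addr y)))
      (bitLen (s.reg y) + bitLen (s.mem k (s.addr y)))
  | store (k x y s) : Exec (.store k x y) s (s.setMem k (s.addr x) (s.reg y))
      (bitLen (s.reg x) + bitLen (s.reg y))
  | seq {p q s s' s'' t t'} (hp : Exec p s s' t) (hq : Exec q s' s'' t') :
      Exec (.seq p q) s s'' (t + t')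
  | branch_pos {x p q s s' t} (h : 0 < s.reg x) (hp : Exec p s s' t) :
      Exec (.branch x p q) s s' (bitLen (s.reg x) + t)
  | branch_neg {x p q s s' t} (h : ¬ 0 < s.reg x) (hq : Exec q s s' t) :
      Exec (.branch x p q) s s' (bitLen (s.reg x) + t)
  | loop_pos {x p s s' s'' t t'} (h : 0 < s.reg x) (hp : Exec p s s' t)
      (hl : Exec (.loop x p) s' s'' t') :
      Exec (.loop x p) s s'' (bitLen (s.reg x) + t + t')
  | loop_neg {x p s} (h : ¬ 0 < s.reg x) : Exec (.loop x p) s s (bitLen (s.reg x))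

/-- The initial configuration: a size parameter in register `0`, two input tables in banks `0` and
`1`; everything else is `0`. -/
def inputState (size : ℕ) (tab₀ tab₁ : ℕ → ℤ) : State where
  reg := fun x => if x = 0 then (size : ℤ) else 0
  mem := fun k a => if k = 0 then tab₀ a else if k = 1 then tab₁ a else 0

/-! ### The matrix multiplication exponent -/

/-- The row-major table of an `N × N` matrix: entry `(i, j)` in cell `i * N + j`. -/
def matTable {N : ℕ} (A : Matrix (Fin N) (Fin N) ℤ) (a : ℕ) : ℤ :=
  if h : a / N < N ∧ a % N < N then A ⟨a / N, h.1⟩ ⟨a % N, h.2⟩ else 0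

/-- Two `N × N` integer matrices with entries of at most `b` bits can be multiplied, by one program
for all `N` and `b`, in time `N ^ τ`, up to a factor polynomial in `log N` and `b`.
The product is delivered in bank `2`. -/
def MatMulInTime (τ : ℝ) : Prop :=
  ∃ (P : Prog) (C : ℕ), ∀ (N b : ℕ) (A B : Matrix (Fin N) (Fin N) ℤ), 1 ≤ N →
    (∀ i j, |A i j| < 2 ^ b) → (∀ i j, |B i j| < 2 ^ b) →
    ∃ (s : State) (t : ℕ), Exec P (inputState N (matTable A) (matTable B)) s t ∧
      (t : ℝ) ≤ C * (N : ℝ) ^ τ * ((Nat.log 2 N + b + 1 : ℕ) : ℝ) ^ C ∧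
      ∀ i j : Fin N, s.mem 2 (i * N + j) = (A * B) i j

/-- The matrix multiplication exponent `ω`. -/
noncomputable def matMulExponent : ℝ := sInf {τ : ℝ | MatMulInTime τ}

/-! ### Computing the convolution -/

/-- A subset of `Fin n` as an `n`-bit number, its characteristic vector in binary. -/
def setCode {n : ℕ} (X : Finset (Fin n)) : ℕ := ∑ i ∈ X, 2 ^ (i : ℕ)

/-- The table of `f : 2^U × 2^U → ℤ` for `U = Fin n`: the value `f X Y` is stored in cell
`setCode X * 2 ^ n + setCode Y`. -/
def setTable {n : ℕ} (f : Finset (Fin n) → Finset (Fin n) → ℤ) (a : ℕ) : ℤ :=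
  if a < 2 ^ n * 2 ^ n then
    f (Finset.univ.filter (fun i : Fin n => (a / 2 ^ n).testBit i))
      (Finset.univ.filter (fun i : Fin n => (a % 2 ^ n).testBit i))
  else 0

/-- NSC2 of functions with values of at most `b` bits on an `n`-element universe can be computed, by
one program for all `n` and `b`, in time `2 ^ (τ n)`, up to a factor polynomial in `n` and `b`.
The table of `f ◇₂ g` is delivered in bank `2`. -/
def NSC2InTime (τ : ℝ) : Prop :=
  ∃ (P : Prog) (C : ℕ), ∀ (n b : ℕ) (f g : Finset (Fin n) → Finset (Fin n) → ℤ),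
    (∀ X Y, |f X Y| < 2 ^ b) → (∀ X Y, |g X Y| < 2 ^ b) →
    ∃ (s : State) (t : ℕ), Exec P (inputState n (setTable f) (setTable g)) s t ∧
      (t : ℝ) ≤ C * (2 : ℝ) ^ (τ * n) * ((n + b + 1 : ℕ) : ℝ) ^ C ∧
      ∀ X Y : Finset (Fin n), s.mem 2 (setCode X * 2 ^ n + setCode Y) = nsc2 f g X Y

end NSC

/-! Functions of pairs of subsets of an n-element set are coefficient tables of normally ordered
monomials in 2n generators x_i, y_i. If all generators anticommute and square to zero, the monomials
multiply as in an exterior algebra. Up to a cross sign between the X-part of the second factor and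
the whole first factor, this product is the convolution wanted; it is `gconv`. An exterior algebra
is not a matrix algebra, but it deforms into one: requiring x_i y_i + y_i x_i = z² gives a
Clifford-type algebra acting on a space of dimension 2^n, with one generator pair realised by the
blocks x = z E₂₁, y = z E₁₂. This action is `rep`, the deformed product on tables is `star (z * z)`,
and `rep_star` says that it becomes multiplication of 2^n × 2^n integer matrices. Modulo z² the
deformation disappears (`star_congr`, `star_zero_ofSets`).

The cross sign is removed by weights. It equals 1 if the X-part A' of the second factor has even
size, and otherwise s = (-1)^(|A|+|B|), where (A, B) belongs to the first factor. Weight the first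
factor by 1 + s w, and the second by w for even |A'| and by 1 for odd |A'|. The contributions are w
+ s w² and s + w, so the coefficient of w is the unsigned-cross product in both cases (`gconv_wt`).
With z = w the deformation disturbs only multiples of w². Hence every value of `star` has the form P
+ w h + w² Q, where h is the desired value; if w = 2H + 1 with |P|, |h| ≤ H, then h is a balanced
digit in base w (`digit_eq`). So a single matrix product suffices (`extract_eq_nsc2`).

`rep` is computed in place, one bit of row and column at a time, and inverted by exact divisions in
reverse order (`fiter_code`, `iiter_eq`). This takes O(n 4^n) operations on integers of O((n+b)²)
bits. The overhead is harmless because an admissible exponent is at least 2: the N² output cells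
must be written (`two_le_of_matMulInTime`).

The remaining work is a cost calculus for the machine (`Ex.evals_comp`, `runs_forLoop`), the
renaming that turns a given multiplication program into a subroutine (`runs_subroutine`), and the
schoolbook algorithm, which shows that the set defining the exponent is nonempty. -/

namespace NSC

/-! ### Bit lengths -/

lemma one_le_bitLen (z : ℤ) : 1 ≤ bitLen z := by simp [bitLen]

lemma bitLen_le_of_abs_lt {z : ℤ} {S : ℕ} (h : |z| < 2 ^ S) : bitLen z ≤ S + 1 := by
  have : z.natAbs < 2 ^ S := by
    have : ((z.natAbs : ℕ) : ℤ) < ((2 ^ S : ℕ) : ℤ) := by rw [Int.natCast_natAbs]; exact_mod_cast h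
    exact_mod_cast this
  have := Nat.size_le.2 this
  simp only [bitLen]; omega

lemma natAbs_lt_of_bitLen (z : ℤ) : z.natAbs < 2 ^ (bitLen z - 1) := by
  simpa [bitLen] using Nat.lt_size_self z.natAbs

lemma bitLen_le_of_natAbs_lt {z : ℤ} {S : ℕ} (h : z.natAbs < 2 ^ S) : bitLen z ≤ S + 1 := by
  have := Nat.size_le.2 h
  simp only [bitLen]; omega

lemma bitLen_mono {x y : ℤ} (h : x.natAbs ≤ y.natAbs) : bitLen x ≤ bitLen y := by
  simp only [bitLen]
  have := Nat.size_le_size h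
  omega

/-- The two sign bits leave one bit to absorb the carry. The bound is wasteful for sums, but it has
the same shape as the one for products, so one count `Ex.size` serves every operation. -/
lemma bitLen_of_natAbs_le_add {x y z : ℤ} (h : z.natAbs ≤ x.natAbs + y.natAbs) :
    bitLen z ≤ bitLen x + bitLen y := by
  have hx := natAbs_lt_of_bitLen x
  have hy := natAbs_lt_of_bitLen y
  have h1 := one_le_bitLen x
  have h2 := one_le_bitLen y
  obtain ⟨a, ha⟩ : ∃ a, bitLen x = a + 1 := ⟨bitLen x - 1, by omega⟩
  obtain ⟨b, hb⟩ : ∃ b, bitLen y = b + 1 := ⟨bitLen y - 1, by omega⟩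
  rw [ha] at hx ⊢
  rw [hb] at hy ⊢
  simp only [Nat.add_sub_cancel] at hx hy
  have : z.natAbs < 2 ^ (a + b + 1) := by
    have e1 : 2 ^ a ≤ 2 ^ (a + b) := Nat.pow_le_pow_right (by norm_num) (by omega)
    have e2 : 2 ^ b ≤ 2 ^ (a + b) := Nat.pow_le_pow_right (by norm_num) (by omega)
    rw [pow_succ]; omega
  have := bitLen_le_of_natAbs_lt this
  omega

lemma bitLen_add (x y : ℤ) : bitLen (x + y) ≤ bitLen x + bitLen y :=
  bitLen_of_natAbs_le_add (Int.natAbs_add_le x y)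

lemma bitLen_sub (x y : ℤ) : bitLen (x - y) ≤ bitLen x + bitLen y :=
  bitLen_of_natAbs_le_add (by omega)

lemma bitLen_mul (x y : ℤ) : bitLen (x * y) ≤ bitLen x + bitLen y := by
  have hx := natAbs_lt_of_bitLen x
  have hy := natAbs_lt_of_bitLen y
  have h1 := one_le_bitLen x
  have h2 := one_le_bitLen y
  have : (x * y).natAbs < 2 ^ ((bitLen x - 1) + (bitLen y - 1)) := by
    rw [Int.natAbs_mul, pow_add]
    exact Nat.mul_lt_mul'' hx hy
  have := bitLen_le_of_natAbs_lt this
  omega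

lemma bitLen_ediv (x y : ℤ) : bitLen (x / y) ≤ bitLen x :=
  bitLen_mono (Int.natAbs_ediv_le_natAbs x y)

/-! ### Expressions -/

/-- The part of a configuration seen by structured code: program variables, the registers reserved
for a subroutine, and the memory.  Variable `x` lives in register `3 x`, register `x` of the
subroutine in register `3 x + 2`; the registers `3 t + 1` are temporaries. -/
@[ext] structure View : Type where
  var : ℕ → ℤ
  aux : ℕ → ℤ
  mem : ℕ → ℕ → ℤ

/-- The view of a configuration. -/
def view (s : State) : View := ⟨fun x => s.reg (3 * x), fun x => s.reg (3 * x + 2), s.mem⟩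

/-- Arithmetic expressions with memory access. -/
inductive Ex : Type
  | v (x : ℕ) : Ex
  | c (z : ℤ) : Ex
  | add (a b : Ex) : Ex
  | sub (a b : Ex) : Ex
  | mul (a b : Ex) : Ex
  | div (a b : Ex) : Ex
  | ld (k : ℕ) (a : Ex) : Ex
  | ite (a b d : Ex) : Ex

namespace Ex

/-- The value of an expression. -/
def eval (h : View) : Ex → ℤ
  | v x => h.var x
  | c z => z
  | add a b => a.eval h + b.eval h
  | sub a b => a.eval h - b.eval h
  | mul a b => a.eval h * b.eval h
  | div a b => a.eval h / b.eval h
  | ld k a => h.mem k (a.eval h).toNat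
  | ite a b d => if 0 < a.eval h then b.eval h else d.eval h

/-- Code that puts the value of an expression into temporary `t`. -/
def comp (t : ℕ) : Ex → Prog
  | v x => .copy (3 * t + 1) (3 * x)
  | c z => .const (3 * t + 1) z
  | add a b => .seq (a.comp t) (.seq (b.comp (t + 1)) (.add (3 * t + 1) (3 * t + 1) (3 * (t + 1) + 1)))
  | sub a b => .seq (a.comp t) (.seq (b.comp (t + 1)) (.sub (3 * t + 1) (3 * t + 1) (3 * (t + 1) + 1)))
  | mul a b => .seq (a.comp t) (.seq (b.comp (t + 1)) (.mul (3 * t + 1) (3 * t + 1) (3 * (t + 1) + 1)))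
  | div a b => .seq (a.comp t) (.seq (b.comp (t + 1)) (.div (3 * t + 1) (3 * t + 1) (3 * (t + 1) + 1)))
  | ld k a => .seq (a.comp t) (.load (3 * t + 1) k (3 * t + 1))
  | ite a b d => .seq (a.comp t) (.branch (3 * t + 1) (b.comp t) (d.comp t))

/-- All data read by the expression have at most `L` bits. -/
def Reads (L : ℕ) (h : View) : Ex → Prop
  | v x => bitLen (h.var x) ≤ L
  | c _ => True
  | add a b => a.Reads L h ∧ b.Reads L h
  | sub a b => a.Reads L h ∧ b.Reads L h
  | mul a b => a.Reads L h ∧ b.Reads L h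
  | div a b => a.Reads L h ∧ b.Reads L h
  | ld k a => a.Reads L h ∧ bitLen (h.mem k (a.eval h).toNat) ≤ L
  | ite a b d => a.Reads L h ∧ (0 < a.eval h → b.Reads L h) ∧ (¬ 0 < a.eval h → d.Reads L h)

/-- The bit length of the value is at most `size * L`. -/
def size : Ex → ℕ
  | v _ => 1
  | c z => bitLen z
  | add a b => a.size + b.size
  | sub a b => a.size + b.size
  | mul a b => a.size + b.size
  | div a b => a.size + b.size
  | ld _ _ => 1
  | ite _ b d => b.size + d.size

/-- The evaluation takes time at most `cost * L ^ 2`. -/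
def cost : Ex → ℕ
  | v _ => 1
  | c z => bitLen z
  | add a b => a.cost + b.cost + (a.size + b.size)
  | sub a b => a.cost + b.cost + (a.size + b.size)
  | mul a b => a.cost + b.cost + a.size * b.size
  | div a b => a.cost + b.cost + a.size * b.size
  | ld _ a => a.cost + (a.size + 1)
  | ite a b d => a.cost + (a.size + (b.cost + d.cost))

/-- The memory banks read by an expression belong to the given set. -/
def Banks (K : ℕ → Prop) : Ex → Prop
  | v _ => True
  | c _ => True
  | add a b => a.Banks K ∧ b.Banks K
  | sub a b => a.Banks K ∧ b.Banks K
  | mul a b => a.Banks K ∧ b.Banks K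
  | div a b => a.Banks K ∧ b.Banks K
  | ld k a => a.Banks K ∧ K k
  | ite a b d => a.Banks K ∧ b.Banks K ∧ d.Banks K

/-- With bounds on whole banks, `Ex.Reads` follows without determining the addresses that are
actually read. -/
lemma reads_of_banks {L : ℕ} {h : View} {K : ℕ → Prop} (hv : ∀ x, bitLen (h.var x) ≤ L)
    (hm : ∀ k, K k → ∀ a, bitLen (h.mem k a) ≤ L) : ∀ e : Ex, e.Banks K → e.Reads L h
  | v x, _ => hv x
  | c _, _ => trivial
  | add a b, hb => ⟨reads_of_banks hv hm a hb.1, reads_of_banks hv hm b hb.2⟩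
  | sub a b, hb => ⟨reads_of_banks hv hm a hb.1, reads_of_banks hv hm b hb.2⟩
  | mul a b, hb => ⟨reads_of_banks hv hm a hb.1, reads_of_banks hv hm b hb.2⟩
  | div a b, hb => ⟨reads_of_banks hv hm a hb.1, reads_of_banks hv hm b hb.2⟩
  | ld k a, hb => ⟨reads_of_banks hv hm a hb.1, hm k hb.2 _⟩
  | ite a b d, hb => ⟨reads_of_banks hv hm a hb.1, fun _ => reads_of_banks hv hm b hb.2.1,
      fun _ => reads_of_banks hv hm d hb.2.2⟩

lemma bitLen_eval {L : ℕ} (hL : 1 ≤ L) {h : View} (e : Ex) (he : e.Reads L h) :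
    bitLen (e.eval h) ≤ e.size * L := by
  induction e with
  | v x => simpa [eval, size, Reads] using he
  | c z => simpa [eval, size] using Nat.le_mul_of_pos_right _ hL
  | add a b iha ihb =>
    have := bitLen_add (a.eval h) (b.eval h)
    have := iha he.1; have := ihb he.2
    simp only [eval, size, add_mul]; omega
  | sub a b iha ihb =>
    have := bitLen_sub (a.eval h) (b.eval h)
    have := iha he.1; have := ihb he.2
    simp only [eval, size, add_mul]; omega
  | mul a b iha ihb =>
    have := bitLen_mul (a.eval h) (b.eval h)
    have := iha he.1; have := ihb he.2
    simp only [eval, size, add_mul]; omega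
  | div a b iha ihb =>
    have := bitLen_ediv (a.eval h) (b.eval h)
    have := iha he.1; have := ihb he.2
    simp only [eval, size, add_mul]; omega
  | ld k a iha => simpa [eval, size] using he.2
  | ite a b c iha ihb ihc =>
    simp only [eval, size, add_mul]
    split_ifs with h0
    · have := ihb (he.2.1 h0); omega
    · have := ihc (he.2.2 h0); omega

end Ex

lemma view_setReg_temp (s : State) (t : ℕ) (z : ℤ) : view (s.setReg (3 * t + 1) z) = view s := by
  ext x
  · simp only [view, State.setReg]; rw [Function.update_of_ne (by omega)]
  · simp only [view, State.setReg]; rw [Function.update_of_ne (by omega)]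
  · rfl

/-- The effect of evaluating an expression into temporary `t`. -/
def Evals (p : Prog) (s : State) (t : ℕ) (z : ℤ) (T : ℕ) : Prop :=
  ∃ s' T', Exec p s s' T' ∧ T' ≤ T ∧ view s' = view s ∧ s'.reg (3 * t + 1) = z ∧
    ∀ u < t, s'.reg (3 * u + 1) = s.reg (3 * u + 1)

lemma evals_instr {p : Prog} {s : State} {t : ℕ} {z : ℤ} {T : ℕ}
    (h : ∃ T' ≤ T, Exec p s (s.setReg (3 * t + 1) z) T') : Evals p s t z T := by
  obtain ⟨T', hT, h⟩ := h
  refine ⟨_, T', h, hT, view_setReg_temp s t z, by simp [State.setReg], fun u hu => ?_⟩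
  simp only [State.setReg]; rw [Function.update_of_ne (by omega)]

/-- The right operand is evaluated into temporary `t + 1`; the last clause of `Evals` protects the
left operand waiting in temporary `t`. -/
lemma evals_binop {p q : Prog} {o : Prog} {s : State} {t : ℕ} {x y z : ℤ} {T₁ T₂ T₃ : ℕ}
    (hp : Evals p s t x T₁) (hq : ∀ s', view s' = view s → Evals q s' (t + 1) y T₂)
    (ho : ∀ s' : State, s'.reg (3 * t + 1) = x → s'.reg (3 * (t + 1) + 1) = y →
      ∃ T' ≤ T₃, Exec o s' (s'.setReg (3 * t + 1) z) T') :
    Evals (.seq p (.seq q o)) s t z (T₁ + T₂ + T₃) := by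
  obtain ⟨s₁, a₁, e₁, l₁, v₁, r₁, k₁⟩ := hp
  obtain ⟨s₂, a₂, e₂, l₂, v₂, r₂, k₂⟩ := hq s₁ v₁
  obtain ⟨s₃, a₃, e₃, l₃, v₃, r₃, k₃⟩ := evals_instr
    (ho s₂ (by rw [k₂ t (by omega), r₁]) r₂)
  refine ⟨s₃, _, .seq e₁ (.seq e₂ e₃), by omega, by rw [v₃, v₂, v₁], r₃, fun u hu => ?_⟩
  rw [k₃ u hu, k₂ u (by omega), k₁ u hu]

/-- All operands have O(L) bits, with a constant depending on the expression only. Products and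
quotients need the square of L; the instructions of linear cost fit under it because L ≤ L². -/
lemma Ex.evals_comp {L : ℕ} (hL : 1 ≤ L) (e : Ex) : ∀ (t : ℕ) (s : State), e.Reads L (view s) →
    Evals (e.comp t) s t (e.eval (view s)) (e.cost * L ^ 2) := by
  have hL2 : L ≤ L ^ 2 := Nat.le_self_pow (by norm_num) L
  induction e with
  | v x =>
    intro t s he
    refine evals_instr ⟨_, ?_, .copy _ _ _⟩
    simp only [Ex.Reads, view] at he
    simp only [Ex.cost, one_mul]; omega
  | c z =>
    intro t s he
    exact evals_instr ⟨_, Nat.le_mul_of_pos_right _ (by positivity), .const _ _ _⟩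
  | add a b iha ihb =>
    intro t s he
    have ea := bitLen_eval hL a he.1
    have eb := bitLen_eval hL b he.2
    have : (a.size + b.size) * L ≤ (a.size + b.size) * L ^ 2 := Nat.mul_le_mul_left _ hL2
    simp only [Ex.cost, add_mul] at this ⊢
    refine evals_binop (iha t s he.1) (y := b.eval (view s)) (fun s' hs => by
      have := ihb (t + 1) s' (by rw [hs]; exact he.2)
      rwa [hs] at this) ?_
    intro s' hx hy
    refine ⟨_, ?_, by rw [Ex.eval, ← hx, ← hy]; exact .add _ _ _ _⟩
    rw [hx, hy]; omega
  | sub a b iha ihb =>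
    intro t s he
    have ea := bitLen_eval hL a he.1
    have eb := bitLen_eval hL b he.2
    have : (a.size + b.size) * L ≤ (a.size + b.size) * L ^ 2 := Nat.mul_le_mul_left _ hL2
    simp only [Ex.cost, add_mul] at this ⊢
    refine evals_binop (iha t s he.1) (y := b.eval (view s)) (fun s' hs => by
      have := ihb (t + 1) s' (by rw [hs]; exact he.2)
      rwa [hs] at this) ?_
    intro s' hx hy
    refine ⟨_, ?_, by rw [Ex.eval, ← hx, ← hy]; exact .sub _ _ _ _⟩
    rw [hx, hy]; omega
  | mul a b iha ihb =>
    intro t s he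
    have ea := bitLen_eval hL a he.1
    have eb := bitLen_eval hL b he.2
    have e3 := Nat.mul_le_mul ea eb
    simp only [Ex.cost, add_mul]
    refine evals_binop (iha t s he.1) (y := b.eval (view s)) (fun s' hs => by
      have := ihb (t + 1) s' (by rw [hs]; exact he.2)
      rwa [hs] at this) ?_
    intro s' hx hy
    refine ⟨_, ?_, by rw [Ex.eval, ← hx, ← hy]; exact .mul _ _ _ _⟩
    rw [hx, hy]; refine e3.trans (le_of_eq (by ring))
  | div a b iha ihb =>
    intro t s he
    have ea := bitLen_eval hL a he.1
    have eb := bitLen_eval hL b he.2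
    have e3 := Nat.mul_le_mul ea eb
    simp only [Ex.cost, add_mul]
    refine evals_binop (iha t s he.1) (y := b.eval (view s)) (fun s' hs => by
      have := ihb (t + 1) s' (by rw [hs]; exact he.2)
      rwa [hs] at this) ?_
    intro s' hx hy
    refine ⟨_, ?_, by rw [Ex.eval, ← hx, ← hy]; exact .div _ _ _ _⟩
    rw [hx, hy]; refine e3.trans (le_of_eq (by ring))
  | ld k a iha =>
    intro t s he
    obtain ⟨s₁, a₁, e₁, l₁, v₁, r₁, k₁⟩ := iha t s he.1
    have ea := bitLen_eval hL a he.1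
    have hm : s₁.mem = s.mem := congrArg View.mem v₁
    have key : s₁.mem k (s₁.addr (3 * t + 1)) = (Ex.ld k a).eval (view s) := by
      simp only [State.addr, r₁, hm, Ex.eval]; rfl
    obtain ⟨s₂, a₂, e₂, l₂, v₂, r₂, k₂⟩ := evals_instr (t := t) ⟨_, le_rfl, Exec.load (3 * t + 1) k (3 * t + 1) s₁⟩
    refine ⟨s₂, _, .seq e₁ e₂, ?_, by rw [v₂, v₁], by rw [r₂, key],
      fun u hu => by rw [k₂ u hu, k₁ u hu]⟩
    rw [key, r₁] at l₂
    have h2 : bitLen ((Ex.ld k a).eval (view s)) ≤ L := he.2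
    have : (a.size + 1) * L ≤ (a.size + 1) * L ^ 2 := Nat.mul_le_mul_left _ hL2
    simp only [Ex.cost, add_mul, one_mul] at this ⊢
    omega
  | ite a b c iha ihb ihc =>
    intro t s he
    obtain ⟨s₁, a₁, e₁, l₁, v₁, r₁, k₁⟩ := iha t s he.1
    have ea := bitLen_eval hL a he.1
    have : a.size * L ≤ a.size * L ^ 2 := Nat.mul_le_mul_left _ hL2
    by_cases h0 : 0 < a.eval (view s)
    · obtain ⟨s₂, a₂, e₂, l₂, v₂, r₂, k₂⟩ := ihb t s₁ (by rw [v₁]; exact he.2.1 h0)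
      refine ⟨s₂, _, .seq e₁ (.branch_pos (by rw [r₁]; exact h0) e₂), ?_, by rw [v₂, v₁],
        by rw [r₂, v₁]; simp [Ex.eval, h0], fun u hu => by rw [k₂ u hu, k₁ u hu]⟩
      rw [r₁]
      simp only [Ex.cost, add_mul]; omega
    · obtain ⟨s₂, a₂, e₂, l₂, v₂, r₂, k₂⟩ := ihc t s₁ (by rw [v₁]; exact he.2.2 h0)
      refine ⟨s₂, _, .seq e₁ (.branch_neg (by rw [r₁]; exact h0) e₂), ?_, by rw [v₂, v₁],
        by rw [r₂, v₁]; simp [Ex.eval, h0], fun u hu => by rw [k₂ u hu, k₁ u hu]⟩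
      rw [r₁]
      simp only [Ex.cost, add_mul]; omega

/-! ### Structured code -/

/-- Started in view `h`, the program `p` halts in view `h'` within time `T`. -/
def Runs (p : Prog) (h : View) (T : ℕ) (h' : View) : Prop :=
  ∀ s, view s = h → ∃ s' t, Exec p s s' t ∧ t ≤ T ∧ view s' = h'

lemma Runs.seq {p q : Prog} {h h' h'' : View} {T T' : ℕ} (hp : Runs p h T h')
    (hq : Runs q h' T' h'') : Runs (.seq p q) h (T + T') h'' := by
  intro s hs
  obtain ⟨s₁, t₁, e₁, l₁, v₁⟩ := hp s hs
  obtain ⟨s₂, t₂, e₂, l₂, v₂⟩ := hq s₁ v₁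
  exact ⟨s₂, _, .seq e₁ e₂, by omega, v₂⟩

lemma Runs.mono {p : Prog} {h h' : View} {T T' : ℕ} (hp : Runs p h T h') (hT : T ≤ T') :
    Runs p h T' h' := fun s hs => by
  obtain ⟨s₁, t₁, e₁, l₁, v₁⟩ := hp s hs
  exact ⟨s₁, t₁, e₁, l₁.trans hT, v₁⟩

/-- `x := e` -/
def asg (x : ℕ) (e : Ex) : Prog := .seq (e.comp 0) (.copy (3 * x) 1)

lemma runs_asg {L : ℕ} (hL : 1 ≤ L) (x : ℕ) (e : Ex) {h : View} (he : e.Reads L h) :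
    Runs (asg x e) h ((e.cost + e.size) * L ^ 2) ⟨Function.update h.var x (e.eval h), h.aux, h.mem⟩ := by
  rintro s rfl
  obtain ⟨s₁, a₁, e₁, l₁, v₁, r₁, -⟩ := e.evals_comp hL 0 s he
  have hL2 : L ≤ L ^ 2 := Nat.le_self_pow (by norm_num) L
  have : e.size * L ≤ e.size * L ^ 2 := Nat.mul_le_mul_left _ hL2
  refine ⟨_, _, .seq e₁ (.copy _ _ _), ?_, ?_⟩
  · have := e.bitLen_eval hL he
    simp only [mul_zero, zero_add] at r₁
    rw [r₁, add_mul]; omega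
  · have h1 := congrArg View.var v₁
    have h2 := congrArg View.aux v₁
    have h3 := congrArg View.mem v₁
    simp only [mul_zero, zero_add] at r₁
    ext y
    · simp only [view, State.setReg, r₁]
      by_cases hy : y = x
      · subst hy; simp
      · rw [Function.update_of_ne (by omega), Function.update_of_ne hy]
        exact congrFun h1 y
    · simp only [view, State.setReg]
      rw [Function.update_of_ne (by omega)]
      exact congrFun h2 y
    · exact congrFun (congrFun h3 _) _

/-- `bank k [a] := e` -/
def sto (k : ℕ) (a e : Ex) : Prog := .seq (a.comp 0) (.seq (e.comp 1) (.store k 1 4))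

lemma runs_sto {L : ℕ} (hL : 1 ≤ L) (k : ℕ) (a e : Ex) {h : View} (ha : a.Reads L h)
    (he : e.Reads L h) :
    Runs (sto k a e) h ((a.cost + e.cost + (a.size + e.size)) * L ^ 2)
      ⟨h.var, h.aux, Function.update h.mem k
        (Function.update (h.mem k) (a.eval h).toNat (e.eval h))⟩ := by
  rintro s rfl
  obtain ⟨s₁, a₁, e₁, l₁, v₁, r₁, -⟩ := a.evals_comp hL 0 s ha
  obtain ⟨s₂, a₂, e₂, l₂, v₂, r₂, k₂⟩ := e.evals_comp hL 1 s₁ (by rw [v₁]; exact he)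
  have hL2 : L ≤ L ^ 2 := Nat.le_self_pow (by norm_num) L
  have : (a.size + e.size) * L ≤ (a.size + e.size) * L ^ 2 := Nat.mul_le_mul_left _ hL2
  have r₁' := k₂ 0 (by norm_num)
  rw [r₁] at r₁'
  simp only [mul_zero, zero_add, mul_one] at r₁' r₂
  rw [v₁] at r₂
  refine ⟨_, _, .seq e₁ (.seq e₂ (.store _ _ _ _)), ?_, ?_⟩
  · have := a.bitLen_eval hL ha
    have := e.bitLen_eval hL he
    rw [r₁', r₂]
    simp only [add_mul] at *; omega
  · rw [v₁] at v₂
    have h1 := congrArg View.var v₂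
    have h2 := congrArg View.aux v₂
    have h3 := congrArg View.mem v₂
    simp only [view] at h1 h2 h3
    simp only [view, State.setMem, State.addr, r₁', r₂, h3, h1, h2]

/-- `for x in [0, y) do body` -/
def forLoop (x y : ℕ) (body : Prog) : Prog :=
  .seq (asg x (.c 0)) (.seq ((Ex.sub (.v y) (.v x)).comp 0)
    (.loop 1 (.seq body (.seq (asg x (.add (.v x) (.c 1))) ((Ex.sub (.v y) (.v x)).comp 0)))))

/-- Write a variable of a view. -/
def View.set (h : View) (x : ℕ) (z : ℤ) : View := ⟨Function.update h.var x z, h.aux, h.mem⟩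

/-- `hs i` is the invariant before round i. Its value of the counter is irrelevant, since `View.set`
overwrites it everywhere. The term `20 * L ^ 2` pays for test, increment and initialisation. -/
lemma runs_forLoop {L : ℕ} (hL : 1 ≤ L) {x y : ℕ} (hxy : y ≠ x) {body : Prog} {T m : ℕ}
    (hs : ℕ → View) (hy : ∀ i ≤ m, (hs i).var y = m) (hm : bitLen m ≤ L)
    (hb : ∀ i < m, Runs body ((hs i).set x i) T ((hs (i + 1)).set x i)) {h : View}
    (h0 : h.set x 0 = (hs 0).set x 0) :
    Runs (forLoop x y body) h ((m + 1) * (T + 20 * L ^ 2)) ((hs m).set x m) := by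
  have hbl : ∀ i : ℕ, i ≤ m → bitLen i ≤ L := fun i hi => (bitLen_mono (by simpa using hi)).trans hm
  have hL2 : L ≤ L ^ 2 := Nat.le_self_pow (by norm_num) L
  have hL3 : 1 ≤ L ^ 2 := by omega
  have b0 : bitLen 0 = 1 := by simp [bitLen]
  have b1 : bitLen 1 = 2 := by simp [bitLen]
  have cond : ∀ i ≤ m, ∀ s, view s = (hs i).set x i →
      Evals ((Ex.sub (.v y) (.v x)).comp 0) s 0 ((m : ℤ) - i) (4 * L ^ 2) := by
    intro i hi s hv
    have := (Ex.sub (.v y) (.v x)).evals_comp hL 0 s (by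
      rw [hv]
      simp only [Ex.Reads, View.set, Function.update_self, Function.update_of_ne hxy, hy i hi]
      exact ⟨hm, hbl i hi⟩)
    rw [hv] at this
    simp only [Ex.eval, View.set, Function.update_self, Function.update_of_ne hxy, hy i hi, Ex.cost,
      Ex.size] at this
    exact this
  -- Register 1 is temporary 0, invisible in the view. It carries the number m - i of remaining
  -- rounds, so its positivity is the loop condition.
  have main : ∀ d i, i + d = m → ∀ s, view s = (hs i).set x i → s.reg 1 = (m : ℤ) - i →
      ∃ s' t, Exec (.loop 1 (.seq body (.seq (asg x (.add (.v x) (.c 1)))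
        ((Ex.sub (.v y) (.v x)).comp 0)))) s s' t ∧
        t ≤ d * (T + 15 * L ^ 2) + L ∧ view s' = (hs m).set x m := by
    intro d
    induction d with
    | zero =>
      intro i hi s hv hr
      obtain rfl : i = m := by omega
      refine ⟨s, _, .loop_neg (by rw [hr]; simp), ?_, hv⟩
      rw [hr, sub_self, b0]; omega
    | succ d ih =>
      intro i hi s hv hr
      have him : i < m := by omega
      obtain ⟨s₁, t₁, e₁, l₁, v₁⟩ := hb i him s hv
      have hasg := runs_asg (h := (hs (i + 1)).set x i) hL x (.add (.v x) (.c 1)) (by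
        simp only [Ex.Reads, View.set, Function.update_self]
        exact ⟨hbl i him.le, trivial⟩)
      obtain ⟨s₂, t₂, e₂, l₂, v₂⟩ := hasg s₁ v₁
      have v₂' : view s₂ = (hs (i + 1)).set x ((i + 1 : ℕ) : ℤ) := by
        rw [v₂]; simp [View.set, Ex.eval]
      obtain ⟨s₃, t₃, e₃, l₃, v₃, r₃, -⟩ := cond (i + 1) (by omega) s₂ v₂'
      obtain ⟨s₄, t₄, e₄, l₄, v₄⟩ := ih (i + 1) (by omega) s₃ (by rw [v₃, v₂']) r₃
      refine ⟨s₄, _, .loop_pos (by rw [hr]; omega) (.seq e₁ (.seq e₂ e₃)) e₄, ?_, v₄⟩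
      have : bitLen (s.reg 1) ≤ L := by
        rw [hr]; exact (bitLen_mono (by omega)).trans hm
      simp only [Ex.cost, Ex.size, b1] at l₂
      rw [add_mul d 1]
      omega
  intro s hv
  obtain ⟨s₁, t₁, e₁, l₁, v₁⟩ := runs_asg (h := h) hL x (.c 0) trivial s hv
  have v₁' : view s₁ = (hs 0).set x ((0 : ℕ) : ℤ) := by
    rw [v₁, Nat.cast_zero, ← h0]; rfl
  obtain ⟨s₂, t₂, e₂, l₂, v₂, r₂, -⟩ := cond 0 (by omega) s₁ v₁'
  obtain ⟨s₃, t₃, e₃, l₃, v₃⟩ := main m 0 (by omega) s₂ (by rw [v₂, v₁']) r₂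
  refine ⟨s₃, _, .seq e₁ (.seq e₂ e₃), ?_, v₃⟩
  simp only [Ex.cost, Ex.size, b0] at l₁
  have : m * (T + 15 * L ^ 2) ≤ m * (T + 20 * L ^ 2) := Nat.mul_le_mul_left _ (by omega)
  rw [add_mul]; omega

/-- A loop that fills the cells of a memory bank one after the other. -/
lemma runs_mapLoop {L : ℕ} (hL : 1 ≤ L) {x y k : ℕ} (hxy : y ≠ x) {e : Ex} {m : ℕ}
    {V A : ℕ → ℤ} {M : ℕ → ℕ → ℤ} (new : ℕ → ℤ) (hy : V y = m) (hm : bitLen m ≤ L)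
    (he : ∀ i < m, e.eval ⟨Function.update V x i, A,
      Function.update M k (fun a => if a < i then new a else M k a)⟩ = new i)
    (hr : ∀ i < m, e.Reads L ⟨Function.update V x i, A,
      Function.update M k (fun a => if a < i then new a else M k a)⟩) :
    Runs (forLoop x y (sto k (.v x) e)) ⟨V, A, M⟩ ((m + 1) * ((e.cost + e.size + 22) * L ^ 2))
      ⟨Function.update V x m, A, Function.update M k (fun a => if a < m then new a else M k a)⟩ := by
  have := runs_forLoop hL hxy (body := sto k (.v x) e) (m := m)
    (T := (e.cost + e.size + 2) * L ^ 2) (h := ⟨V, A, M⟩)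
    (fun i => ⟨V, A, Function.update M k (fun a => if a < i then new a else M k a)⟩)
    (fun i _ => hy) hm ?_ (by simp [View.set])
  · refine this.mono (Nat.mul_le_mul_left _ (le_of_eq (by ring)))
  · intro i hi
    have hbl : bitLen i ≤ L := (bitLen_mono (by simpa using hi.le)).trans hm
    have := runs_sto hL k (.v x) e (h := ⟨Function.update V x i, A,
      Function.update M k (fun a => if a < i then new a else M k a)⟩)
      (by simpa [Ex.Reads] using hbl) (hr i hi)
    rw [he i hi] at this
    simp only [View.set]
    convert this.mono (T' := (e.cost + e.size + 2) * L ^ 2)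
      (Nat.mul_le_mul_right _ (by simp only [Ex.cost, Ex.size]; omega)) using 2
    simp only [Function.update_idem, Ex.eval, Function.update_self, Int.toNat_natCast]
    congr 1
    ext a
    by_cases ha : a = i
    · subst ha; simp
    · rw [Function.update_of_ne ha]
      have : a < i + 1 ↔ a < i := by omega
      simp only [this]

/-- A loop that updates one variable. -/
lemma runs_foldLoop {L : ℕ} (hL : 1 ≤ L) {x y r : ℕ} (hxy : y ≠ x) (hry : y ≠ r) (hxr : r ≠ x)
    {e : Ex} {m : ℕ} {V A : ℕ → ℤ} {M : ℕ → ℕ → ℤ} (acc : ℕ → ℤ) (hy : V y = m)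
    (h0 : V r = acc 0) (hm : bitLen m ≤ L)
    (he : ∀ i < m, e.eval ⟨Function.update (Function.update V r (acc i)) x i, A, M⟩ = acc (i + 1))
    (hr : ∀ i < m, e.Reads L ⟨Function.update (Function.update V r (acc i)) x i, A, M⟩) :
    Runs (forLoop x y (asg r e)) ⟨V, A, M⟩ ((m + 1) * ((e.cost + e.size + 22) * L ^ 2))
      ⟨Function.update (Function.update V r (acc m)) x m, A, M⟩ := by
  have := runs_forLoop hL hxy (body := asg r e) (m := m)
    (T := (e.cost + e.size + 2) * L ^ 2) (h := ⟨V, A, M⟩)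
    (fun i => ⟨Function.update V r (acc i), A, M⟩)
    (fun i _ => by simp [Function.update_of_ne hry, hy]) hm ?_ (by simp [View.set, ← h0])
  · refine this.mono (Nat.mul_le_mul_left _ (le_of_eq (by ring)))
  · intro i hi
    have := runs_asg hL r e (hr i hi)
    rw [he i hi] at this
    simp only [View.set]
    convert this.mono (T' := (e.cost + e.size + 2) * L ^ 2)
      (Nat.mul_le_mul_right _ (by omega)) using 2
    simp only [Function.update_comm hxr, Function.update_idem]

end NSC

/-! ### Matrix multiplication on the machine: lower bound 2, admissible exponent 3, use as a
subroutine -/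

namespace NSC

/-! ### A lower bound for matrix multiplication -/

/-- A store touches one cell and costs at least one unit, so the running time bounds the number of
output cells that can change. -/
lemma exec_writes {p : Prog} {s s' : State} {t : ℕ} (h : Exec p s s' t) :
    ∃ F : Finset ℕ, F.card ≤ t ∧ ∀ a ∉ F, s'.mem 2 a = s.mem 2 a := by
  induction h with
  | store k x y s =>
    refine ⟨{s.addr x}, ?_, fun a ha => ?_⟩
    · have := one_le_bitLen (s.reg x)
      simp only [Finset.card_singleton]; omega
    · simp only [Finset.mem_singleton] at ha
      simp only [State.setMem]
      by_cases hk : 2 = k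
      · subst hk; rw [Function.update_self, Function.update_of_ne ha]
      · rw [Function.update_of_ne hk]
  | seq _ _ ih₁ ih₂ =>
    obtain ⟨F, hF, h₁⟩ := ih₁
    obtain ⟨G, hG, h₂⟩ := ih₂
    refine ⟨F ∪ G, (Finset.card_union_le _ _).trans (by omega), fun a ha => ?_⟩
    simp only [Finset.mem_union, not_or] at ha
    rw [h₂ a ha.2, h₁ a ha.1]
  | branch_pos _ _ ih =>
    obtain ⟨F, hF, h₁⟩ := ih
    exact ⟨F, by omega, h₁⟩
  | branch_neg _ _ ih =>
    obtain ⟨F, hF, h₁⟩ := ih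
    exact ⟨F, by omega, h₁⟩
  | loop_pos _ _ _ ih₁ ih₂ =>
    obtain ⟨F, hF, h₁⟩ := ih₁
    obtain ⟨G, hG, h₂⟩ := ih₂
    refine ⟨F ∪ G, (Finset.card_union_le _ _).trans (by omega), fun a ha => ?_⟩
    simp only [Finset.mem_union, not_or] at ha
    rw [h₂ a ha.2, h₁ a ha.1]
  | _ => exact ⟨∅, by simp, fun a _ => rfl⟩

/-- The square of the all-ones matrix has every entry N ≠ 0, while bank 2 starts with zeros; hence
N² cells must be written. This later absorbs the 4^n cost of the transformations. -/
lemma two_le_of_matMulInTime {τ : ℝ} (h : MatMulInTime τ) : 2 ≤ τ := by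
  obtain ⟨P, C, hP⟩ := h
  by_contra! hτ
  have key : ∀ m : ℕ, (2 : ℝ) ^ (2 * m) ≤ C * (2 : ℝ) ^ (τ * m) * ((m + 2 : ℕ) : ℝ) ^ C := by
    intro m
    set N := 2 ^ m with hN
    have hN1 : 1 ≤ N := Nat.one_le_two_pow
    obtain ⟨s, t, he, ht, hs⟩ := hP N 1 (Matrix.of fun _ _ => 1) (Matrix.of fun _ _ => 1) hN1
      (by simp) (by simp)
    obtain ⟨F, hF, hw⟩ := exec_writes he
    have hsub : Finset.range (N * N) ⊆ F := by
      intro a ha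
      by_contra haF
      rw [Finset.mem_range] at ha
      have h1 : a / N < N := Nat.div_lt_of_lt_mul ha
      have h2 : a % N < N := Nat.mod_lt _ hN1
      have h3 := hs ⟨a / N, h1⟩ ⟨a % N, h2⟩
      simp only [Nat.div_add_mod'] at h3
      rw [hw a haF] at h3
      simp [inputState, Matrix.mul_apply] at h3
      omega
    have hc := (Finset.card_le_card hsub).trans hF
    rw [Finset.card_range] at hc
    have hlog : Nat.log 2 N = m := by rw [hN]; exact Nat.log_pow (by norm_num) m
    rw [hlog] at ht
    have e1 : ((N : ℕ) : ℝ) ^ τ = (2 : ℝ) ^ (τ * m) := by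
      rw [hN, mul_comm, Real.rpow_mul (by norm_num), Real.rpow_natCast]; push_cast; rfl
    rw [e1] at ht
    have : (2 : ℝ) ^ (2 * m) = ((N * N : ℕ) : ℝ) := by rw [hN]; push_cast; ring
    rw [this]
    exact (Nat.cast_le.2 hc).trans ht
  set r : ℝ := (2 : ℝ) ^ (τ - 2) with hr
  have hr0 : 0 < r := by positivity
  have hr1 : r < 1 := Real.rpow_lt_one_of_one_lt_of_neg (by norm_num) (by linarith)
  -- The factor r² aligns both arguments at m + 2, so that the right side is a shifted sequence k^C
  -- r^k, which tends to 0 as r < 1.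
  have key2 : ∀ m : ℕ, r ^ 2 ≤ C * (((m + 2 : ℕ) : ℝ) ^ C * r ^ (m + 2)) := by
    intro m
    have h1 := key m
    have e2 : (2 : ℝ) ^ (τ * m) = r ^ m * 2 ^ (2 * m) := by
      rw [hr, ← Real.rpow_natCast, ← Real.rpow_natCast, ← Real.rpow_mul (by norm_num),
        ← Real.rpow_add (by norm_num)]
      congr 1; push_cast; ring
    rw [e2] at h1
    have h2 : (0 : ℝ) < 2 ^ (2 * m) := by positivity
    have h3 : (1 : ℝ) ≤ C * r ^ m * ((m + 2 : ℕ) : ℝ) ^ C := by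
      by_contra! h4
      have := mul_lt_mul_of_pos_right h4 h2
      nlinarith
    calc r ^ 2 = r ^ 2 * 1 := by ring
      _ ≤ r ^ 2 * (C * r ^ m * ((m + 2 : ℕ) : ℝ) ^ C) := by gcongr
      _ = _ := by ring
  have lim := ((tendsto_pow_const_mul_const_pow_of_abs_lt_one C
    (r := r) (by rw [abs_of_pos hr0]; exact hr1)).comp (Filter.tendsto_add_atTop_nat 2)).const_mul (C : ℝ)
  rw [mul_zero] at lim
  have := ge_of_tendsto' lim key2
  have : 0 < r ^ 2 := by positivity
  linarith

/-! ### Renaming -/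

/-- Rename the registers and memory banks of a program. -/
def Prog.map (ρ κ : ℕ → ℕ) : Prog → Prog
  | .skip => .skip
  | .const x c => .const (ρ x) c
  | .copy x y => .copy (ρ x) (ρ y)
  | .add x y z => .add (ρ x) (ρ y) (ρ z)
  | .sub x y z => .sub (ρ x) (ρ y) (ρ z)
  | .mul x y z => .mul (ρ x) (ρ y) (ρ z)
  | .div x y z => .div (ρ x) (ρ y) (ρ z)
  | .load x k y => .load (ρ x) (κ k) (ρ y)
  | .store k x y => .store (κ k) (ρ x) (ρ y)
  | .seq p q => .seq (p.map ρ κ) (q.map ρ κ)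
  | .branch x p q => .branch (ρ x) (p.map ρ κ) (q.map ρ κ)
  | .loop x p => .loop (ρ x) (p.map ρ κ)

/-- `S'` arises from `S` by changes in renamed registers and banks only, and looks like `s'` there. -/
def Extends (ρ κ : ℕ → ℕ) (S S' s' : State) : Prop :=
  (S'.reg ∘ ρ = s'.reg ∧ S'.mem ∘ κ = s'.mem) ∧ (∀ y, y ∉ Set.range ρ → S'.reg y = S.reg y) ∧
    ∀ k, k ∉ Set.range κ → S'.mem k = S.mem k

lemma extends_setReg {ρ κ : ℕ → ℕ} (hρ : ρ.Injective) {S s : State}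
    (hr : S.reg ∘ ρ = s.reg) (hm : S.mem ∘ κ = s.mem) (x : ℕ) (v : ℤ) :
    Extends ρ κ S (S.setReg (ρ x) v) (s.setReg x v) := by
  refine ⟨⟨?_, hm⟩, fun y hy => ?_, fun _ _ => rfl⟩
  · simp only [State.setReg, ← hr]
    exact Function.update_comp_eq_of_injective _ hρ _ _
  · exact Function.update_of_ne (fun h => hy ⟨x, h.symm⟩) _ _

lemma Extends.trans {ρ κ : ℕ → ℕ} {S S' S'' s' s'' : State} (h : Extends ρ κ S S' s')
    (h' : Extends ρ κ S' S'' s'') : Extends ρ κ S S'' s'' :=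
  ⟨h'.1, fun y hy => (h'.2.1 y hy).trans (h.2.1 y hy), fun y hy => (h'.2.2 y hy).trans (h.2.2 y hy)⟩

/-- Costs depend only on the values handled, so the renamed run takes exactly the same time.
Injectivity is what turns an update of a renamed location into an update of one original location.
-/
lemma exec_map {ρ κ : ℕ → ℕ} (hρ : ρ.Injective) (hκ : κ.Injective) {p : Prog} {s s' : State}
    {t : ℕ} (h : Exec p s s' t) : ∀ S : State, S.reg ∘ ρ = s.reg → S.mem ∘ κ = s.mem →
      ∃ S', Exec (p.map ρ κ) S S' t ∧ Extends ρ κ S S' s' := by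
  induction h with
  | skip s => exact fun S hr hm => ⟨S, .skip _, ⟨hr, hm⟩, fun _ _ => rfl, fun _ _ => rfl⟩
  | const x c s => exact fun S hr hm => ⟨_, .const _ _ _, extends_setReg hρ hr hm _ _⟩
  | copy x y s =>
    intro S hr hm
    have := Exec.copy (ρ x) (ρ y) S
    rw [show S.reg (ρ y) = s.reg y from congrFun hr y] at this
    exact ⟨_, this, extends_setReg hρ hr hm _ _⟩
  | add x y z s =>
    intro S hr hm
    have := Exec.add (ρ x) (ρ y) (ρ z) S
    rw [show S.reg (ρ y) = s.reg y from congrFun hr y,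
      show S.reg (ρ z) = s.reg z from congrFun hr z] at this
    exact ⟨_, this, extends_setReg hρ hr hm _ _⟩
  | sub x y z s =>
    intro S hr hm
    have := Exec.sub (ρ x) (ρ y) (ρ z) S
    rw [show S.reg (ρ y) = s.reg y from congrFun hr y,
      show S.reg (ρ z) = s.reg z from congrFun hr z] at this
    exact ⟨_, this, extends_setReg hρ hr hm _ _⟩
  | mul x y z s =>
    intro S hr hm
    have := Exec.mul (ρ x) (ρ y) (ρ z) S
    rw [show S.reg (ρ y) = s.reg y from congrFun hr y,
      show S.reg (ρ z) = s.reg z from congrFun hr z] at this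
    exact ⟨_, this, extends_setReg hρ hr hm _ _⟩
  | div x y z s =>
    intro S hr hm
    have := Exec.div (ρ x) (ρ y) (ρ z) S
    rw [show S.reg (ρ y) = s.reg y from congrFun hr y,
      show S.reg (ρ z) = s.reg z from congrFun hr z] at this
    exact ⟨_, this, extends_setReg hρ hr hm _ _⟩
  | load x k y s =>
    intro S hr hm
    have := Exec.load (ρ x) (κ k) (ρ y) S
    rw [State.addr, show S.reg (ρ y) = s.reg y from congrFun hr y,
      show S.mem (κ k) = s.mem k from congrFun hm k] at this
    exact ⟨_, this, extends_setReg hρ hr hm _ _⟩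
  | store k x y s =>
    intro S hr hm
    have := Exec.store (κ k) (ρ x) (ρ y) S
    rw [State.addr, show S.reg (ρ y) = s.reg y from congrFun hr y,
      show S.reg (ρ x) = s.reg x from congrFun hr x] at this
    refine ⟨_, this, ⟨hr, ?_⟩, fun _ _ => rfl, fun l hl => ?_⟩
    · simp only [State.setMem, ← hm]
      exact Function.update_comp_eq_of_injective _ hκ _ _
    · exact Function.update_of_ne (fun h => hl ⟨k, h.symm⟩) _ _
  | seq _ _ ih₁ ih₂ =>
    intro S hr hm
    obtain ⟨S₁, e₁, h₁⟩ := ih₁ S hr hm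
    obtain ⟨S₂, e₂, h₂⟩ := ih₂ S₁ h₁.1.1 h₁.1.2
    exact ⟨S₂, .seq e₁ e₂, h₁.trans h₂⟩
  | @branch_pos x p q s s' t h _ ih =>
    intro S hr hm
    obtain ⟨S₁, e₁, h₁⟩ := ih S hr hm
    have hx : S.reg (ρ x) = s.reg x := congrFun hr x
    refine ⟨S₁, ?_, h₁⟩
    rw [← hx]
    exact .branch_pos (by rw [hx]; exact h) e₁
  | @branch_neg x p q s s' t h _ ih =>
    intro S hr hm
    obtain ⟨S₁, e₁, h₁⟩ := ih S hr hm
    have hx : S.reg (ρ x) = s.reg x := congrFun hr x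
    refine ⟨S₁, ?_, h₁⟩
    rw [← hx]
    exact .branch_neg (by rw [hx]; exact h) e₁
  | @loop_pos x p s s' s'' t t' h _ _ ih₁ ih₂ =>
    intro S hr hm
    obtain ⟨S₁, e₁, h₁⟩ := ih₁ S hr hm
    obtain ⟨S₂, e₂, h₂⟩ := ih₂ S₁ h₁.1.1 h₁.1.2
    have hx : S.reg (ρ x) = s.reg x := congrFun hr x
    refine ⟨S₂, ?_, h₁.trans h₂⟩
    rw [← hx]
    exact .loop_pos (by rw [hx]; exact h) e₁ e₂
  | @loop_neg x p s h =>
    intro S hr hm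
    have hx : S.reg (ρ x) = s.reg x := congrFun hr x
    refine ⟨S, ?_, ⟨hr, hm⟩, fun _ _ => rfl, fun _ _ => rfl⟩
    rw [← hx]
    exact .loop_neg (by rw [hx]; exact h)

/-- A program as a subroutine, with registers `3 x + 2` and memory banks `k + 4`. -/
def subroutine (p : Prog) : Prog := p.map (fun x => 3 * x + 2) (fun k => k + 4)

/-- The registers `3 x + 2` and the banks from 4 on form a private machine for `p`; the caller's
variables and its banks 0 to 3 survive the call. -/
lemma runs_subroutine {p : Prog} {s s' : State} {t : ℕ} (h : Exec p s s' t) {V : ℕ → ℤ}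
    {M : ℕ → ℕ → ℤ} (hM : ∀ k, M (k + 4) = s.mem k) :
    Runs (subroutine p) ⟨V, s.reg, M⟩ t
      ⟨V, s'.reg, fun k => if k < 4 then M k else s'.mem (k - 4)⟩ := by
  intro S hS
  have h1 : (fun x => S.reg (3 * x)) = V := congrArg View.var hS
  have h2 : (fun x => S.reg (3 * x + 2)) = s.reg := congrArg View.aux hS
  have h3 : S.mem = M := congrArg View.mem hS
  obtain ⟨S', e, ⟨hr, hm⟩, hr', hm'⟩ := exec_map (ρ := fun x => 3 * x + 2) (κ := fun k => k + 4)
    (fun a b hab => by simpa using hab) (fun a b hab => by simpa using hab) h S h2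
    (by ext k : 1; simp [h3, hM])
  refine ⟨S', t, e, le_rfl, ?_⟩
  ext x
  · rw [← h1]
    exact hr' _ (by rintro ⟨y, hy⟩; simp only at hy; omega)
  · exact congrFun hr x
  · simp only [view]
    split_ifs with hx
    · rw [hm' x (by rintro ⟨y, hy⟩; simp only at hy; omega), h3]
    · obtain ⟨y, rfl⟩ : ∃ y, x = y + 4 := ⟨x - 4, by omega⟩
      rw [Nat.add_sub_cancel]
      exact congrFun (congrFun hm y) _

/-! ### The schoolbook method -/

/-- Remainder. -/
def Ex.mod (a b : Ex) : Ex := .sub a (.mul (.div a b) b)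

lemma Ex.eval_mod (h : View) (a b : Ex) : (a.mod b).eval h = a.eval h % b.eval h := by
  simp only [Ex.mod, Ex.eval]; rw [mul_comm, Int.emod_def]

/-- The entry `(i / N / N, i % N)` of the first and `(i % N, i / N % N)` of the second factor,
multiplied and added to the entry `i / N` of the product. -/
def schoolStep : Ex :=
  .add (.ld 2 (.div (.v 2) (.v 0)))
    (.mul (.ld 0 (.add (.mul (.div (.div (.v 2) (.v 0)) (.v 0)) (.v 0)) (.mod (.v 2) (.v 0))))
      (.ld 1 (.add (.mul (.mod (.v 2) (.v 0)) (.v 0)) (.mod (.div (.v 2) (.v 0)) (.v 0)))))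

/-- Schoolbook matrix multiplication. -/
def schoolProg : Prog :=
  .seq (asg 1 (.mul (.mul (.v 0) (.v 0)) (.v 0)))
    (forLoop 2 1 (sto 2 (.div (.v 2) (.v 0)) schoolStep))

lemma abs_matTable_lt {N b : ℕ} {A : Matrix (Fin N) (Fin N) ℤ} (hA : ∀ i j, |A i j| < 2 ^ b)
    (a : ℕ) : |matTable A a| < 2 ^ b := by
  unfold matTable
  split_ifs
  · exact hA _ _
  · simp

lemma view_inputState (m : ℕ) (t₀ t₁ : ℕ → ℤ) :
    view (inputState m t₀ t₁) = ⟨fun x => if x = 0 then (m : ℤ) else 0, fun _ => 0,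
      fun k a => if k = 0 then t₀ a else if k = 1 then t₁ a else 0⟩ := by
  ext x
  · simp [view, inputState]
  · simp [view, inputState]
  · simp [view, inputState]

/-- A single counter i < N³ replaces three nested loops: i / N is the cell of the product and i % N
the summation index. -/
lemma exists_schoolProg_time : ∃ K : ℕ, ∀ (N b : ℕ) (A B : Matrix (Fin N) (Fin N) ℤ), 1 ≤ N →
    (∀ i j, |A i j| < 2 ^ b) → (∀ i j, |B i j| < 2 ^ b) →
    ∃ (s : State) (t : ℕ), Exec schoolProg (inputState N (matTable A) (matTable B)) s t ∧
      t ≤ K * N ^ 3 * (5 * (Nat.log 2 N + b + 1)) ^ 2 ∧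
      ∀ i j : Fin N, s.mem 2 (i * N + j) = (A * B) i j := by
  obtain ⟨K₁, hK₁⟩ : ∃ K, K = (Ex.mul (.mul (.v 0) (.v 0)) (.v 0)).cost +
    (Ex.mul (.mul (.v 0) (.v 0)) (.v 0)).size := ⟨_, rfl⟩
  obtain ⟨K₂, hK₂⟩ : ∃ K, K = (Ex.div (.v 2) (.v 0)).cost + schoolStep.cost +
    ((Ex.div (.v 2) (.v 0)).size + schoolStep.size) := ⟨_, rfl⟩
  refine ⟨K₁ + 2 * (K₂ + 20), fun N b A B hN hA hB => ?_⟩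
  set l := Nat.log 2 N
  -- Room for the counter, which is at most N³ < 2^(3l+3), and for partial sums of at most N
  -- products, bounded by 2^(l+1+2b).
  set S := 3 * l + 2 * b + 4 with hS
  set L := S + 1 with hL
  have hNl : N < 2 ^ (l + 1) := Nat.lt_pow_succ_log_self (by norm_num) N
  have hN3 : N * N * N < 2 ^ S := by
    calc N * N * N < 2 ^ (l + 1) * 2 ^ (l + 1) * 2 ^ (l + 1) := by gcongr
      _ = 2 ^ (3 * l + 3) := by rw [← pow_add, ← pow_add]; congr 1; ring
      _ ≤ 2 ^ S := Nat.pow_le_pow_right (by norm_num) (by omega)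
  have hbN3 : bitLen ((N * N * N : ℕ) : ℤ) ≤ L :=
    bitLen_le_of_abs_lt (by rw [Nat.abs_cast]; exact_mod_cast hN3)
  have hb : ∀ m : ℕ, m ≤ N * N * N → bitLen (m : ℤ) ≤ L := fun m hm =>
    (bitLen_mono (by rw [Int.natAbs_natCast, Int.natAbs_natCast]; exact hm)).trans hbN3
  have hbN : bitLen (N : ℤ) ≤ L := hb N (by nlinarith [Nat.mul_le_mul hN hN])
  let term (a k : ℕ) : ℤ := matTable A ((a / N) * N + k) * matTable B (k * N + a % N)
  -- The content of cell `a` before round `i`: its k-th term is added in round `a * N + k`.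
  let acc (i a : ℕ) : ℤ := ∑ k ∈ Finset.range N, if a * N + k < i then term a k else 0
  have hterm : ∀ a k, |term a k| ≤ 2 ^ (2 * b) := by
    intro a k
    rw [abs_mul, two_mul, pow_add]
    exact mul_le_mul (abs_matTable_lt hA _).le (abs_matTable_lt hB _).le (abs_nonneg _) (by positivity)
  have hacc : ∀ i a, bitLen (acc i a) ≤ L := by
    intro i a
    apply bitLen_le_of_abs_lt
    have : |acc i a| ≤ N * 2 ^ (2 * b) := by
      refine (Finset.abs_sum_le_sum_abs _ _).trans ((Finset.sum_le_card_nsmul _ _ (2 ^ (2 * b)) ?_).trans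
        (by simp))
      intro k _
      split_ifs
      · exact hterm a k
      · simp
    refine this.trans_lt ?_
    have h1 : (N : ℤ) < 2 ^ (l + 1) := by exact_mod_cast hNl
    calc (N : ℤ) * 2 ^ (2 * b) < 2 ^ (l + 1) * 2 ^ (2 * b) := by gcongr
      _ = 2 ^ (l + 1 + 2 * b) := by rw [← pow_add]
      _ ≤ 2 ^ S := pow_le_pow_right₀ (by norm_num) (by omega)
  have hstep : ∀ i, acc (i + 1) = Function.update (acc i) (i / N) (acc i (i / N) + term (i / N) (i % N)) := by
    intro i
    ext a
    by_cases ha : a = i / N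
    · subst ha
      rw [Function.update_self]
      have hmod : i % N ∈ Finset.range N := Finset.mem_range.2 (Nat.mod_lt _ hN)
      have hdm := Nat.div_add_mod' i N
      have h1 : acc (i + 1) (i / N) - acc i (i / N) = ∑ k ∈ Finset.range N, if k = i % N then term (i / N) k else 0 := by
        rw [← Finset.sum_sub_distrib]
        refine Finset.sum_congr rfl fun k _ => ?_
        have : (k = i % N) ↔ (i / N * N + k = i) := by omega
        simp only [this]
        split_ifs <;> omega
      rw [Finset.sum_ite_eq' , if_pos hmod] at h1
      linarith
    · rw [Function.update_of_ne ha]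
      refine Finset.sum_congr rfl fun k hk => ?_
      rw [Finset.mem_range] at hk
      have : a * N + k ≠ i := by
        rintro rfl
        apply ha
        rw [mul_comm, Nat.mul_add_div hN, Nat.div_eq_of_lt hk, add_zero]
      have : (a * N + k < i + 1) ↔ a * N + k < i := by omega
      simp only [this]
  set h₀ := view (inputState N (matTable A) (matTable B)) with hh₀
  rw [view_inputState] at hh₀
  have r1 := runs_asg (L := L) (h := h₀) (by omega) 1 (.mul (.mul (.v 0) (.v 0)) (.v 0)) (by
    rw [hh₀]; simpa [Ex.Reads] using hbN)
  set V : ℕ → ℤ := Function.update h₀.var 1 ((Ex.mul (.mul (.v 0) (.v 0)) (.v 0)).eval h₀) with hV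
  have hV0 : V 0 = N := by simp [hV, hh₀]
  have hV1 : V 1 = (N * N * N : ℕ) := by simp [hV, hh₀, Ex.eval]
  let hs (i : ℕ) : View := ⟨V, h₀.aux, Function.update h₀.mem 2 (acc i)⟩
  have hm0 : h₀.mem 0 = matTable A := by rw [hh₀]; ext; simp
  have hm1 : h₀.mem 1 = matTable B := by rw [hh₀]; ext; simp
  have hm2 : h₀.mem 2 = acc 0 := by rw [hh₀]; ext; simp [acc]
  have r2 := runs_forLoop (L := L) (by omega) (x := 2) (y := 1) (by norm_num) hs
    (body := sto 2 (.div (.v 2) (.v 0)) schoolStep) (m := N * N * N) (h := hs 0)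
    (T := ((Ex.div (.v 2) (.v 0)).cost + schoolStep.cost + ((Ex.div (.v 2) (.v 0)).size + schoolStep.size)) * L ^ 2)
    (fun i _ => hV1) hbN3 (fun i hi => by
      have hvar : ((hs i).set 2 i).var 0 = N := by simp [hs, View.set, hV0]
      have hvar2 : ((hs i).set 2 i).var 2 = i := by simp [View.set]
      have hbi := hb i hi.le
      have hbA : ∀ a, bitLen (((hs i).set 2 i).mem 0 a) ≤ L := fun a =>
        (bitLen_le_of_abs_lt (S := S) (by
          simp only [hs, View.set, ne_eq, OfNat.zero_ne_ofNat, not_false_eq_true, Function.update_of_ne, hm0]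
          exact (abs_matTable_lt hA _).trans_le (pow_le_pow_right₀ (by norm_num) (by omega))))
      have hbB : ∀ a, bitLen (((hs i).set 2 i).mem 1 a) ≤ L := fun a =>
        (bitLen_le_of_abs_lt (S := S) (by
          simp only [hs, View.set, ne_eq, OfNat.one_ne_ofNat, not_false_eq_true, Function.update_of_ne, hm1]
          exact (abs_matTable_lt hB _).trans_le (pow_le_pow_right₀ (by norm_num) (by omega))))
      have hbC : ∀ a, bitLen (((hs i).set 2 i).mem 2 a) ≤ L := fun a => by
        simp only [hs, View.set, Function.update_self]; exact hacc i a
      have := runs_sto (L := L) (h := (hs i).set 2 i) (by omega) 2 (.div (.v 2) (.v 0)) schoolStep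
        (by simp only [Ex.Reads, hvar, hvar2]; exact ⟨hbi, hbN⟩)
        (by
          simp only [schoolStep, Ex.mod, Ex.Reads, hvar, hvar2, hbi, hbN, hbA, hbB, hbC, and_self])
      convert this using 1
      simp only [View.set, hs, Function.update_self, Function.update_idem, hstep i]
      have e1 : (Ex.div (.v 2) (.v 0)).eval ((hs i).set 2 i) = ((i / N : ℕ) : ℤ) := by
        simp only [Ex.eval, hvar, hvar2]; norm_cast
      have e2 : schoolStep.eval ((hs i).set 2 i) = acc i (i / N) + term (i / N) (i % N) := by
        simp only [schoolStep, Ex.eval, Ex.eval_mod, hvar, hvar2]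
        norm_cast
      simp only [hs, View.set] at e1 e2
      rw [e1, e2, Int.toNat_natCast]) rfl
  have hh1 : (⟨V, h₀.aux, h₀.mem⟩ : View) = hs 0 := by
    simp only [hs, ← hm2, Function.update_eq_self]
  rw [hh1] at r1
  obtain ⟨s, t, e, ht, hv⟩ := (r1.seq r2) _ rfl
  refine ⟨s, t, e, ?_, ?_⟩
  · refine ht.trans ?_
    have h1 : 1 ≤ N ^ 3 := Nat.one_le_pow _ _ hN
    have h2 : N * N * N = N ^ 3 := by ring
    have h3 : L ≤ 5 * (l + b + 1) := by omega
    rw [h2, ← hK₁, ← hK₂]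
    calc K₁ * L ^ 2 + (N ^ 3 + 1) * (K₂ * L ^ 2 + 20 * L ^ 2)
        = (K₁ * 1 + (N ^ 3 + 1) * (K₂ + 20)) * L ^ 2 := by ring
      _ ≤ (K₁ * N ^ 3 + (N ^ 3 + N ^ 3) * (K₂ + 20)) * (5 * (l + b + 1)) ^ 2 := by gcongr
      _ = (K₁ + 2 * (K₂ + 20)) * N ^ 3 * (5 * (l + b + 1)) ^ 2 := by ring
  · intro i j
    have : s.mem = Function.update h₀.mem 2 (acc (N * N * N)) := congrArg View.mem hv
    have hsum : acc (N * N * N) (i * N + j) = ∑ k : Fin N,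
        if ((i : ℕ) * N + j) * N + k < N * N * N then term (i * N + j) k else 0 :=
      (Fin.sum_univ_eq_sum_range
        (fun k => if ((i : ℕ) * N + j) * N + k < N * N * N then term (i * N + j) k else 0) N).symm
    rw [this, Function.update_self, Matrix.mul_apply, hsum]
    refine Finset.sum_congr rfl fun k _ => ?_
    have hij : (i : ℕ) * N + j < N * N := by
      have := i.2; have := j.2
      calc (i : ℕ) * N + j < (i + 1) * N := by rw [add_mul]; omega
        _ ≤ N * N := Nat.mul_le_mul_right _ i.2
    have hlt : ((i : ℕ) * N + j) * N + k < N * N * N := by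
      calc ((i : ℕ) * N + j) * N + k < (i * N + j + 1) * N := by rw [add_mul _ 1]; omega
        _ ≤ N * N * N := Nat.mul_le_mul_right _ hij
    rw [if_pos hlt]
    have d1 : ((i : ℕ) * N + j) / N = i := by
      rw [mul_comm, Nat.mul_add_div hN, Nat.div_eq_of_lt j.2, add_zero]
    have d2 : ((i : ℕ) * N + j) % N = j := by
      rw [mul_comm, Nat.mul_add_mod, Nat.mod_eq_of_lt j.2]
    have d3 : ((i : ℕ) * N + k) / N = i := by
      rw [mul_comm, Nat.mul_add_div hN, Nat.div_eq_of_lt k.2, add_zero]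
    have d4 : ((i : ℕ) * N + k) % N = k := by
      rw [mul_comm, Nat.mul_add_mod, Nat.mod_eq_of_lt k.2]
    have d5 : ((k : ℕ) * N + j) / N = k := by
      rw [mul_comm, Nat.mul_add_div hN, Nat.div_eq_of_lt j.2, add_zero]
    have d6 : ((k : ℕ) * N + j) % N = j := by
      rw [mul_comm, Nat.mul_add_mod, Nat.mod_eq_of_lt j.2]
    simp only [term, d1, d2, matTable, d3, d4, d5, d6, Fin.is_lt, and_self, dite_true, Fin.eta]

/-- Guarantees that the infimum defining the exponent is taken over a nonempty set and can be
approached from within it. -/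
lemma matMulInTime_three : MatMulInTime 3 := by
  obtain ⟨K, hK⟩ := exists_schoolProg_time
  refine ⟨schoolProg, 25 * K + 2, fun N b A B hN hA hB => ?_⟩
  obtain ⟨s, t, e, ht, h⟩ := hK N b A B hN hA hB
  refine ⟨s, t, e, ?_, h⟩
  set q := Nat.log 2 N + b + 1
  have hq : 1 ≤ q := by omega
  have : t ≤ (25 * K + 2) * N ^ 3 * q ^ (25 * K + 2) := by
    calc t ≤ K * N ^ 3 * (5 * q) ^ 2 := ht
      _ = (25 * K) * N ^ 3 * q ^ 2 := by ring
      _ ≤ _ := by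
        gcongr
        · omega
        · omega
  rw [show (3 : ℝ) = ((3 : ℕ) : ℝ) by norm_num, Real.rpow_natCast]
  exact_mod_cast this

end NSC

/-! ### The deformed algebra, its matrix representation, and the recovery of the convolution -/

namespace NSC

/-! ### The algebra: a deformation of the convolution inside a matrix algebra -/

/-- Characteristic vectors of subsets of `[0, n)`, with the top bit outermost. -/
def Ix : ℕ → Type
  | 0 => Unit
  | n + 1 => Ix n ⊕ Ix n

instance Ix.fintype : (n : ℕ) → Fintype (Ix n)
  | 0 => inferInstanceAs (Fintype Unit)
  | n + 1 => letI := Ix.fintype n; inferInstanceAs (Fintype (Ix n ⊕ Ix n))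

instance Ix.decEq : (n : ℕ) → DecidableEq (Ix n)
  | 0 => inferInstanceAs (DecidableEq Unit)
  | n + 1 => letI := Ix.decEq n; inferInstanceAs (DecidableEq (Ix n ⊕ Ix n))

/-- Square matrices indexed by subsets of `[0, n)`. -/
abbrev SqMat (n : ℕ) : Type := Matrix (Ix n) (Ix n) ℤ

/-- A matrix put together from four blocks. -/
def blk {n : ℕ} (a b c d : SqMat n) : SqMat (n + 1) := Matrix.fromBlocks a b c d

def SqMat.b₁₁ {n : ℕ} (f : SqMat (n + 1)) : SqMat n := Matrix.toBlocks₁₁ f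
def SqMat.b₁₂ {n : ℕ} (f : SqMat (n + 1)) : SqMat n := Matrix.toBlocks₁₂ f
def SqMat.b₂₁ {n : ℕ} (f : SqMat (n + 1)) : SqMat n := Matrix.toBlocks₂₁ f
def SqMat.b₂₂ {n : ℕ} (f : SqMat (n + 1)) : SqMat n := Matrix.toBlocks₂₂ f

lemma blk_eta {n : ℕ} (f : SqMat (n + 1)) : blk f.b₁₁ f.b₁₂ f.b₂₁ f.b₂₂ = f :=
  Matrix.fromBlocks_toBlocks f

section blocks
variable {n : ℕ} (a b c d a' b' c' d' : SqMat n)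

@[simp] lemma blk_b₁₁ : (blk a b c d).b₁₁ = a := rfl
@[simp] lemma blk_b₁₂ : (blk a b c d).b₁₂ = b := rfl
@[simp] lemma blk_b₂₁ : (blk a b c d).b₂₁ = c := rfl
@[simp] lemma blk_b₂₂ : (blk a b c d).b₂₂ = d := rfl

lemma blk_mul : blk a b c d * blk a' b' c' d' =
    blk (a * a' + b * c') (a * b' + b * d') (c * a' + d * c') (c * b' + d * d') :=
  Matrix.fromBlocks_multiply a b c d a' b' c' d'

lemma blk_add : blk a b c d + blk a' b' c' d' = blk (a + a') (b + b') (c + c') (d + d') :=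
  Matrix.fromBlocks_add a b c d a' b' c' d'

lemma blk_smul (z : ℤ) : z • blk a b c d = blk (z • a) (z • b) (z • c) (z • d) :=
  Matrix.fromBlocks_smul z a b c d

lemma blk_one : blk 1 0 0 1 = (1 : SqMat (n + 1)) := Matrix.fromBlocks_one

end blocks

/-- The parity operator. -/
def parZ : (n : ℕ) → SqMat n
  | 0 => 1
  | n + 1 => blk (parZ n) 0 0 (-parZ n)

lemma parZ_mul_self : ∀ n, parZ n * parZ n = 1
  | 0 => by simp [parZ]
  | n + 1 => by simp [parZ, blk_mul, parZ_mul_self n, blk_one]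

/-- The grading automorphism, for functions as well as for operators. -/
def hat {n : ℕ} (f : SqMat n) : SqMat n := parZ n * f * parZ n

lemma hat_mul {n : ℕ} (f g : SqMat n) : hat f * hat g = hat (f * g) := by
  calc hat f * hat g = parZ n * f * (parZ n * parZ n) * g * parZ n := by
        simp only [hat, Matrix.mul_assoc]
    _ = hat (f * g) := by rw [parZ_mul_self, Matrix.mul_one]; simp only [hat, Matrix.mul_assoc]

lemma hat_add {n : ℕ} (f g : SqMat n) : hat (f + g) = hat f + hat g := by
  simp [hat, mul_add, add_mul]

lemma hat_smul {n : ℕ} (z : ℤ) (f : SqMat n) : hat (z • f) = z • hat f := by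
  simp only [hat, Matrix.mul_smul, Matrix.smul_mul]

lemma hat_blk {n : ℕ} (a b c d : SqMat n) :
    hat (blk a b c d) = blk (hat a) (-hat b) (-hat c) (hat d) := by
  rw [hat, parZ, blk_mul, blk_mul]
  simp [hat]

/-- The representation of functions of pairs of sets by operators, scaled by `z` in every
degree. -/
def rep (z : ℤ) : (n : ℕ) → SqMat n → SqMat n
  | 0, f => f
  | n + 1, f => blk (rep z n f.b₁₁) (z • rep z n f.b₁₂) (z • rep z n f.b₂₁)
      (hat (rep z n f.b₁₁) + (z * z) • rep z n f.b₂₂)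

/-- The product of functions that corresponds to the product of operators; `q` is the parameter of
the deformation. -/
def star (q : ℤ) : (n : ℕ) → SqMat n → SqMat n → SqMat n
  | 0, f, g => f * g
  | n + 1, f, g => blk
      (star q n f.b₁₁ g.b₁₁ + q • star q n f.b₁₂ g.b₂₁)
      (star q n f.b₁₁ g.b₁₂ + star q n f.b₁₂ (hat g.b₁₁) + q • star q n f.b₁₂ g.b₂₂)
      (star q n f.b₂₁ g.b₁₁ + star q n (hat f.b₁₁) g.b₂₁ + q • star q n f.b₂₂ g.b₂₁)
      (star q n f.b₂₁ g.b₁₂ + star q n (hat f.b₁₁) g.b₂₂ + star q n f.b₂₂ (hat g.b₁₁)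
        - star q n (hat f.b₁₂) (hat g.b₂₁) + q • star q n f.b₂₂ g.b₂₂)

lemma rep_add (z : ℤ) : ∀ (n : ℕ) (f g : SqMat n), rep z n (f + g) = rep z n f + rep z n g
  | 0, f, g => rfl
  | n + 1, f, g => by
    have h₁₁ : (f + g).b₁₁ = f.b₁₁ + g.b₁₁ := rfl
    have h₁₂ : (f + g).b₁₂ = f.b₁₂ + g.b₁₂ := rfl
    have h₂₁ : (f + g).b₂₁ = f.b₂₁ + g.b₂₁ := rfl
    have h₂₂ : (f + g).b₂₂ = f.b₂₂ + g.b₂₂ := rfl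
    simp only [rep, blk_add, h₁₁, h₁₂, h₂₁, h₂₂, rep_add z n, hat_add, smul_add]
    congr 1
    abel

lemma rep_smul (z c : ℤ) : ∀ (n : ℕ) (f : SqMat n), rep z n (c • f) = c • rep z n f
  | 0, f => rfl
  | n + 1, f => by
    have h₁₁ : (c • f).b₁₁ = c • f.b₁₁ := rfl
    have h₁₂ : (c • f).b₁₂ = c • f.b₁₂ := rfl
    have h₂₁ : (c • f).b₂₁ = c • f.b₂₁ := rfl
    have h₂₂ : (c • f).b₂₂ = c • f.b₂₂ := rfl
    simp only [rep, blk_smul, h₁₁, h₁₂, h₂₁, h₂₂, rep_smul z c n, hat_smul, smul_add,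
      smul_comm c z, smul_comm c (z * z)]

lemma rep_neg (z : ℤ) (n : ℕ) (f : SqMat n) : rep z n (-f) = -rep z n f := by
  simpa using rep_smul z (-1) n f

lemma rep_sub (z : ℤ) (n : ℕ) (f g : SqMat n) : rep z n (f - g) = rep z n f - rep z n g := by
  rw [sub_eq_add_neg, rep_add, rep_neg, sub_eq_add_neg]

lemma rep_hat (z : ℤ) : ∀ (n : ℕ) (f : SqMat n), rep z n (hat f) = hat (rep z n f)
  | 0, f => rfl
  | n + 1, f => by
    conv_lhs => rw [← blk_eta f]
    simp only [hat_blk, rep, blk_b₁₁, blk_b₁₂, blk_b₂₁, blk_b₂₂, rep_hat z n, rep_neg, smul_neg,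
      hat_smul, hat_add]

/-- With x = z E₂₁, y = z E₁₂ and lower-level elements a acting as diag(a, hat a), a table acts as
f₁₁ + f₁₂ y + x f₂₁ + x f₂₂ y. The formulas for `star` come from y a = (hat a) y, a x = x (hat a),
x² = y² = 0 and y x = z² - x y. The last relation produces both the terms with `q` and the negative
term in the fourth block. -/
lemma rep_star (z : ℤ) : ∀ (n : ℕ) (f g : SqMat n),
    rep z n (star (z * z) n f g) = rep z n f * rep z n g
  | 0, f, g => rfl
  | n + 1, f, g => by
    simp only [rep, star, blk_mul, blk_b₁₁, blk_b₁₂, blk_b₂₁, blk_b₂₂, rep_add, rep_smul, rep_sub,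
      rep_star z n, rep_hat]
    congr 1
    · simp only [Matrix.smul_mul, Matrix.mul_smul, smul_smul]
    · simp only [smul_add, Matrix.mul_add, Matrix.smul_mul, Matrix.mul_smul, smul_smul]
      abel_nf
      simp [mul_assoc, mul_comm]
    · simp only [smul_add, Matrix.add_mul, Matrix.smul_mul, Matrix.mul_smul, smul_smul]
      abel_nf
    · simp only [smul_add, smul_sub, Matrix.add_mul, Matrix.mul_add, Matrix.smul_mul, Matrix.mul_smul,
        smul_smul, hat_mul, hat_add, hat_smul]
      abel

/-- The parameter enters only through contractions y x, each contributing a factor `q`; an integral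
remainder `r` is all that digit extraction needs. -/
lemma star_congr (q : ℤ) : ∀ (n : ℕ) (f g : SqMat n), ∃ r, star q n f g = star 0 n f g + q • r
  | 0, f, g => ⟨0, by simp [star]⟩
  | n + 1, f, g => by
    choose r hr using star_congr q n
    refine ⟨blk (r f.b₁₁ g.b₁₁ + star q n f.b₁₂ g.b₂₁)
      (r f.b₁₁ g.b₁₂ + r f.b₁₂ (hat g.b₁₁) + star q n f.b₁₂ g.b₂₂)
      (r f.b₂₁ g.b₁₁ + r (hat f.b₁₁) g.b₂₁ + star q n f.b₂₂ g.b₂₁)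
      (r f.b₂₁ g.b₁₂ + r (hat f.b₁₁) g.b₂₂ + r f.b₂₂ (hat g.b₁₁)
        - r (hat f.b₁₂) (hat g.b₂₁) + star q n f.b₂₂ g.b₂₂), ?_⟩
    simp only [star, blk_smul, blk_add, zero_smul, smul_add, smul_sub, hr]
    congr 1 <;> abel

/-! ### The undeformed product is a convolution over sets -/

/-- The set with a given characteristic vector. -/
def Ix.toSet : {n : ℕ} → Ix n → Finset ℕ
  | 0, _ => ∅
  | n + 1, Sum.inl i => Ix.toSet (n := n) i
  | n + 1, Sum.inr i => insert n (Ix.toSet (n := n) i)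

/-- The number with a given binary expansion. -/
def Ix.code : {n : ℕ} → Ix n → ℕ
  | 0, _ => 0
  | n + 1, Sum.inl i => Ix.code (n := n) i
  | n + 1, Sum.inr i => 2 ^ n + Ix.code (n := n) i

lemma Ix.lt_of_mem_toSet : ∀ {n : ℕ} (i : Ix n) {k : ℕ}, k ∈ i.toSet → k < n
  | 0, _, k, h => by simp [Ix.toSet] at h
  | n + 1, Sum.inl i, k, h => (Ix.lt_of_mem_toSet (n := n) i h).trans (Nat.lt_succ_self _)
  | n + 1, Sum.inr i, k, h => by
    rcases Finset.mem_insert.1 h with rfl | h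
    · exact Nat.lt_succ_self _
    · exact (Ix.lt_of_mem_toSet (n := n) i h).trans (Nat.lt_succ_self _)

lemma Ix.notMem_toSet {n : ℕ} (i : Ix n) : n ∉ i.toSet := fun h => (i.lt_of_mem_toSet h).false

lemma hat_apply : ∀ {n : ℕ} (f : SqMat n) (i j : Ix n),
    hat f i j = (-1) ^ (i.toSet.card + j.toSet.card) * f i j
  | 0, f, i, j => by simp [hat, parZ, Ix.toSet]
  | n + 1, f, i, j => by
    rw [← blk_eta f, hat_blk]
    rcases i with i | i <;> rcases j with j | j
    · exact hat_apply f.b₁₁ i j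
    · refine (congrArg Neg.neg (hat_apply f.b₁₂ i j)).trans ?_
      change _ = (-1) ^ (i.toSet.card + (insert n j.toSet).card) * f.b₁₂ i j
      rw [Finset.card_insert_of_notMem j.notMem_toSet]; ring
    · refine (congrArg Neg.neg (hat_apply f.b₂₁ i j)).trans ?_
      change _ = (-1) ^ ((insert n i.toSet).card + j.toSet.card) * f.b₂₁ i j
      rw [Finset.card_insert_of_notMem i.notMem_toSet]; ring
    · refine (hat_apply f.b₂₂ i j).trans ?_
      change _ = (-1) ^ ((insert n i.toSet).card + (insert n j.toSet).card) * f.b₂₂ i j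
      rw [Finset.card_insert_of_notMem i.notMem_toSet, Finset.card_insert_of_notMem j.notMem_toSet]
      ring

/-- The two-set convolution with the additional sign of a product of graded algebras. -/
def gconv (F G : Finset ℕ → Finset ℕ → ℤ) (X Y : Finset ℕ) : ℤ :=
  ∑ A ∈ X.powerset, ∑ B ∈ Y.powerset, F A B * G (X \ A) (Y \ B) *
    (invSign A (X \ A) * invSign B (Y \ B) * (-1) ^ ((X \ A).card * (A.card + B.card)))

/-- A function of sets as a matrix. -/
def ofSets (n : ℕ) (F : Finset ℕ → Finset ℕ → ℤ) : SqMat n := fun i j => F i.toSet j.toSet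

/-- The grading automorphism on functions of sets. -/
def shat (F : Finset ℕ → Finset ℕ → ℤ) : Finset ℕ → Finset ℕ → ℤ :=
  fun X Y => (-1) ^ (X.card + Y.card) * F X Y

lemma hat_ofSets (n : ℕ) (F : Finset ℕ → Finset ℕ → ℤ) : hat (ofSets n F) = ofSets n (shat F) := by
  ext i j
  exact hat_apply _ i j

lemma invSign_insert_right {A B : Finset ℕ} {n : ℕ} (hA : ∀ a ∈ A, a < n) :
    invSign A (insert n B) = invSign A B := by
  unfold invSign
  congr 2
  ext ⟨x, y⟩
  simp only [Finset.mem_filter, Finset.mem_product, Finset.mem_insert]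
  constructor
  · rintro ⟨⟨h1, rfl | h2⟩, h3⟩
    · have := hA x h1; omega
    · exact ⟨⟨h1, h2⟩, h3⟩
  · rintro ⟨⟨h1, h2⟩, h3⟩
    exact ⟨⟨h1, Or.inr h2⟩, h3⟩

lemma invSign_insert_left {A B : Finset ℕ} {n : ℕ} (hn : n ∉ A) (hB : ∀ b ∈ B, b < n) :
    invSign (insert n A) B = (-1) ^ B.card * invSign A B := by
  unfold invSign
  rw [← pow_add]
  congr 1
  have : ((insert n A) ×ˢ B).filter (fun p => p.1 > p.2) =
      ({n} ×ˢ B) ∪ (A ×ˢ B).filter (fun p => p.1 > p.2) := by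
    ext ⟨x, y⟩
    simp only [Finset.mem_filter, Finset.mem_product, Finset.mem_insert, Finset.mem_union,
      Finset.mem_singleton]
    constructor
    · rintro ⟨⟨rfl | h1, h2⟩, h3⟩
      · exact Or.inl ⟨rfl, h2⟩
      · exact Or.inr ⟨⟨h1, h2⟩, h3⟩
    · rintro (⟨rfl, h2⟩ | ⟨⟨h1, h2⟩, h3⟩)
      · exact ⟨⟨Or.inl rfl, h2⟩, hB y h2⟩
      · exact ⟨⟨Or.inr h1, h2⟩, h3⟩
  rw [this, Finset.card_union_of_disjoint]
  · simp
  · rw [Finset.disjoint_left]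
    rintro ⟨x, y⟩ h1 h2
    simp only [Finset.mem_filter, Finset.mem_product, Finset.mem_singleton] at h1 h2
    exact hn (h1.1 ▸ h2.1.1)

lemma neg_one_pow_mul_self (m : ℕ) : (-1 : ℤ) ^ m * (-1) ^ m = 1 := by
  rw [← mul_pow]; simp

section recursion
variable {n : ℕ} {X Y : Finset ℕ} (F G : Finset ℕ → Finset ℕ → ℤ)

lemma insert_sdiff_eq {A : Finset ℕ} (hX : n ∉ X) (hA : A ⊆ X) : insert n X \ A = insert n (X \ A) :=
  Finset.insert_sdiff_of_notMem _ fun h => hX (hA h)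

lemma insert_sdiff_insert_eq {A : Finset ℕ} (hX : n ∉ X) : insert n X \ insert n A = X \ A := by
  rw [Finset.insert_sdiff_insert, Finset.sdiff_insert_of_notMem hX]

/-- The largest element n causes no inversion in the second factor. In the first factor it causes |Y
\ B| inversions and changes the cross sign by (-1)^|X \ A|; together these are the signs of `shat
G`. -/
lemma gconv_insert_right (hY : ∀ y ∈ Y, y < n) :
    gconv F G X (insert n Y) = gconv F (fun A B => G A (insert n B)) X Y +
      gconv (fun A B => F A (insert n B)) (shat G) X Y := by
  have hn : n ∉ Y := fun h => (hY n h).false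
  unfold gconv
  rw [← Finset.sum_add_distrib]
  refine Finset.sum_congr rfl fun A _ => ?_
  rw [Finset.sum_powerset_insert hn]
  congr 1
  · refine Finset.sum_congr rfl fun B hB => ?_
    have hB' := Finset.mem_powerset.1 hB
    rw [insert_sdiff_eq hn hB', invSign_insert_right fun b hb => hY b (hB' hb)]
  · refine Finset.sum_congr rfl fun B hB => ?_
    have hB' := Finset.mem_powerset.1 hB
    have hnB : n ∉ B := fun h => hn (hB' h)
    rw [insert_sdiff_insert_eq hn, invSign_insert_left hnB fun b hb => hY b (Finset.mem_sdiff.1 hb).1,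
      Finset.card_insert_of_notMem hnB]
    simp only [shat]
    ring

/-- If n joins the second factor, the cross sign changes by (-1)^(|A|+|B|), which is `shat F`. If it
joins the first, its |X \ A| inversions cancel the change of the cross sign; the summand |A| in the
exponent is there for this cancellation. -/
lemma gconv_insert_left (hX : ∀ x ∈ X, x < n) :
    gconv F G (insert n X) Y = gconv (shat F) (fun A B => G (insert n A) B) X Y +
      gconv (fun A B => F (insert n A) B) G X Y := by
  have hn : n ∉ X := fun h => (hX n h).false
  unfold gconv
  rw [Finset.sum_powerset_insert hn]
  congr 1
  · refine Finset.sum_congr rfl fun A hA => Finset.sum_congr rfl fun B _ => ?_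
    have hA' := Finset.mem_powerset.1 hA
    rw [insert_sdiff_eq hn hA', invSign_insert_right fun b hb => hX b (hA' hb),
      Finset.card_insert_of_notMem fun h => hn (Finset.mem_sdiff.1 h).1]
    simp only [shat]
    ring
  · refine Finset.sum_congr rfl fun A hA => Finset.sum_congr rfl fun B _ => ?_
    have hA' := Finset.mem_powerset.1 hA
    have hnA : n ∉ A := fun h => hn (hA' h)
    rw [insert_sdiff_insert_eq hn, invSign_insert_left hnA fun b hb => hX b (Finset.mem_sdiff.1 hb).1,
      Finset.card_insert_of_notMem hnA]
    have := neg_one_pow_mul_self (X \ A).card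
    calc _ = F (insert n A) B * G (X \ A) (Y \ B) * (invSign A (X \ A) * invSign B (Y \ B) *
          (-1) ^ ((X \ A).card * (A.card + B.card))) * ((-1) ^ (X \ A).card * (-1) ^ (X \ A).card) := by
          ring
      _ = _ := by rw [this, mul_one]

end recursion

lemma gconv_neg_left (F G : Finset ℕ → Finset ℕ → ℤ) (X Y : Finset ℕ) :
    gconv (fun A B => -F A B) G X Y = -gconv F G X Y := by
  simp [gconv, Finset.sum_neg_distrib]

lemma shat_insert_right {F : Finset ℕ → Finset ℕ → ℤ} {X Y : Finset ℕ} {n : ℕ} (h : n ∉ Y) :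
    shat F X (insert n Y) = -shat (fun A B => F A (insert n B)) X Y := by
  simp only [shat, Finset.card_insert_of_notMem h]; ring

lemma gconv_congr {F F' G G' : Finset ℕ → Finset ℕ → ℤ} {X Y : Finset ℕ}
    (hF : ∀ A ⊆ X, ∀ B ⊆ Y, F A B = F' A B) (hG : ∀ A ⊆ X, ∀ B ⊆ Y, G A B = G' A B) :
    gconv F G X Y = gconv F' G' X Y := by
  refine Finset.sum_congr rfl fun A hA => Finset.sum_congr rfl fun B hB => ?_
  rw [hF A (Finset.mem_powerset.1 hA) B (Finset.mem_powerset.1 hB),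
    hG _ Finset.sdiff_subset _ Finset.sdiff_subset]

/-- Both sides satisfy the same recursion on the largest element, the four blocks recording whether
it lies in X and in Y. The minus sign of the fourth block arises because `shat` counts the inserted
element (`shat_insert_right`). -/
lemma star_zero_ofSets : ∀ (n : ℕ) (F G : Finset ℕ → Finset ℕ → ℤ),
    star 0 n (ofSets n F) (ofSets n G) = ofSets n (gconv F G)
  | 0, F, G => by
    ext i j
    change (∑ k : Unit, F ∅ ∅ * G ∅ ∅) = gconv F G ∅ ∅
    simp [gconv, invSign]
  | n + 1, F, G => by
    have e₁₁ (F : Finset ℕ → Finset ℕ → ℤ) : (ofSets (n + 1) F).b₁₁ = ofSets n F := rfl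
    have e₁₂ (F : Finset ℕ → Finset ℕ → ℤ) :
      (ofSets (n + 1) F).b₁₂ = ofSets n (fun A B => F A (insert n B)) := rfl
    have e₂₁ (F : Finset ℕ → Finset ℕ → ℤ) :
      (ofSets (n + 1) F).b₂₁ = ofSets n (fun A B => F (insert n A) B) := rfl
    have e₂₂ (F : Finset ℕ → Finset ℕ → ℤ) :
      (ofSets (n + 1) F).b₂₂ = ofSets n (fun A B => F (insert n A) (insert n B)) := rfl
    rw [← blk_eta (ofSets (n + 1) (gconv F G))]
    simp only [star, e₁₁, e₁₂, e₂₁, e₂₂, hat_ofSets, star_zero_ofSets n, zero_smul, add_zero]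
    congr 1
    · ext i j
      exact (gconv_insert_right F G fun y hy => j.lt_of_mem_toSet hy).symm
    · ext i j
      rw [add_comm]
      exact (gconv_insert_left F G fun y hy => i.lt_of_mem_toSet hy).symm
    · ext i j
      have hi : ∀ y ∈ i.toSet, y < n := fun y hy => i.lt_of_mem_toSet hy
      have hj : ∀ y ∈ j.toSet, y < n := fun y hy => j.lt_of_mem_toSet hy
      change _ = gconv F G (insert n i.toSet) (insert n j.toSet)
      rw [gconv_insert_left F G hi, gconv_insert_right _ _ hj, gconv_insert_right _ _ hj]
      have h1 : gconv (fun A B => shat F A (insert n B)) (shat fun A B => G (insert n A) B)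
          i.toSet j.toSet = -gconv (shat fun A B => F A (insert n B))
            (shat fun A B => G (insert n A) B) i.toSet j.toSet := by
        rw [← gconv_neg_left]
        exact gconv_congr (fun A _ B hB => shat_insert_right fun h => j.notMem_toSet (hB h))
          fun _ _ _ _ => rfl
      rw [h1]
      simp only [Matrix.add_apply, Matrix.sub_apply, ofSets]
      ring

/-! ### Removing the additional sign -/

/-- The weighted first factor. -/
def wtL (w : ℤ) (F : Finset ℕ → Finset ℕ → ℤ) : Finset ℕ → Finset ℕ → ℤ :=
  fun X Y => F X Y * (1 + (-1) ^ X.card * (-1) ^ Y.card * w)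

/-- The weighted second factor. -/
def wtR (w : ℤ) (G : Finset ℕ → Finset ℕ → ℤ) : Finset ℕ → Finset ℕ → ℤ :=
  fun X Y => G X Y * (if 0 < (-1 : ℤ) ^ X.card then w else 1)

/-- The two-set non-commutative subset convolution for finite sets of natural numbers. -/
def conv (F G : Finset ℕ → Finset ℕ → ℤ) (X Y : Finset ℕ) : ℤ :=
  ∑ A ∈ X.powerset, ∑ B ∈ Y.powerset, F A B * G (X \ A) (Y \ B) *
    (invSign A (X \ A) * invSign B (Y \ B))

lemma abs_invSign {U : Type*} [LinearOrder U] (A B : Finset U) : |invSign A B| = 1 := by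
  simp [invSign]

lemma abs_sum_sum_powerset_le {X Y : Finset ℕ} {n : ℕ} (hX : X.card ≤ n) (hY : Y.card ≤ n)
    {φ : Finset ℕ → Finset ℕ → ℤ} {c : ℤ} (hc : 0 ≤ c) (h : ∀ A B, |φ A B| ≤ c) :
    |∑ A ∈ X.powerset, ∑ B ∈ Y.powerset, φ A B| ≤ 2 ^ n * 2 ^ n * c := by
  calc |∑ A ∈ X.powerset, ∑ B ∈ Y.powerset, φ A B|
      ≤ ∑ A ∈ X.powerset, ∑ B ∈ Y.powerset, c :=
        (Finset.abs_sum_le_sum_abs _ _).trans (Finset.sum_le_sum fun A _ =>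
          (Finset.abs_sum_le_sum_abs _ _).trans (Finset.sum_le_sum fun B _ => h A B))
    _ = 2 ^ X.card * 2 ^ Y.card * c := by
        simp [Finset.card_powerset]; ring
    _ ≤ 2 ^ n * 2 ^ n * c := by gcongr <;> norm_num

lemma abs_conv_le {F G : Finset ℕ → Finset ℕ → ℤ} {X Y : Finset ℕ} {n : ℕ} (hX : X.card ≤ n)
    (hY : Y.card ≤ n) {W : ℤ} (hF : ∀ A B, |F A B| ≤ W) (hG : ∀ A B, |G A B| ≤ W) :
    |conv F G X Y| ≤ 2 ^ n * 2 ^ n * (W * W) := by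
  have hW : 0 ≤ W := (abs_nonneg _).trans (hF ∅ ∅)
  refine abs_sum_sum_powerset_le hX hY (mul_nonneg hW hW) fun A B => ?_
  rw [abs_mul, abs_mul, abs_mul, abs_invSign, abs_invSign, mul_one, mul_one]
  exact mul_le_mul (hF _ _) (hG _ _) (abs_nonneg _) hW

/-- Put s = (-1)^(|A|+|B|). For even |X \ A| the cross sign is 1 and the weights give w (1 + s w) =
w + s w². For odd |X \ A| it is s, and s (1 + s w) = s + w. So the coefficient of w is always free
of the cross sign. Only P needs a bound, since Q sits above the digit that is read. -/
lemma gconv_wt {F G : Finset ℕ → Finset ℕ → ℤ} {X Y : Finset ℕ} {n : ℕ} (hX : X.card ≤ n)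
    (hY : Y.card ≤ n) {W : ℤ} (hF : ∀ A B, |F A B| ≤ W) (hG : ∀ A B, |G A B| ≤ W) (w : ℤ) :
    ∃ P Q, |P| ≤ 2 ^ n * 2 ^ n * (W * W) ∧
      gconv (wtL w F) (wtR w G) X Y = P + w * conv F G X Y + w * w * Q := by
  have hW : 0 ≤ W := (abs_nonneg _).trans (hF ∅ ∅)
  refine ⟨∑ A ∈ X.powerset, ∑ B ∈ Y.powerset, F A B * G (X \ A) (Y \ B) *
      (invSign A (X \ A) * invSign B (Y \ B)) *
        (if 0 < (-1 : ℤ) ^ (X \ A).card then 0 else (-1) ^ A.card * (-1) ^ B.card),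
    ∑ A ∈ X.powerset, ∑ B ∈ Y.powerset, F A B * G (X \ A) (Y \ B) *
      (invSign A (X \ A) * invSign B (Y \ B)) *
        (if 0 < (-1 : ℤ) ^ (X \ A).card then (-1) ^ A.card * (-1) ^ B.card else 0), ?_, ?_⟩
  · refine abs_sum_sum_powerset_le hX hY (mul_nonneg hW hW) fun A B => ?_
    rw [abs_mul, abs_mul, abs_mul, abs_mul, abs_invSign, abs_invSign, mul_one, mul_one]
    have h1 := mul_le_mul (hF A B) (hG (X \ A) (Y \ B)) (abs_nonneg _) hW
    have h2 : |if 0 < (-1 : ℤ) ^ (X \ A).card then (0 : ℤ) else (-1) ^ A.card * (-1) ^ B.card| ≤ 1 := by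
      split_ifs <;> simp [abs_mul]
    exact (mul_le_mul h1 h2 (abs_nonneg _) (mul_nonneg hW hW)).trans (by rw [mul_one])
  · simp only [gconv, conv, Finset.mul_sum, ← Finset.sum_add_distrib]
    refine Finset.sum_congr rfl fun A _ => Finset.sum_congr rfl fun B _ => ?_
    simp only [wtL, wtR, pow_mul]
    have hAB := neg_one_pow_mul_self A.card
    have hAB' := neg_one_pow_mul_self B.card
    rcases neg_one_pow_eq_or ℤ (X \ A).card with h | h <;> rw [h]
    · simp; ring
    · simp only [Int.reduceNeg, Left.neg_pos_iff, Int.reduceLT, if_false, pow_add, mul_one]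
      linear_combination (F A B * G (X \ A) (Y \ B) *
      (invSign A (X \ A) * invSign B (Y \ B)) * w) * ((-1) ^ B.card * (-1) ^ B.card) * hAB + (F A B * G (X \ A) (Y \ B) *
      (invSign A (X \ A) * invSign B (Y \ B)) * w) * hAB'

end NSC

/-! ### Number codes of sets, transformations bit by bit, correctness of the algorithm -/

namespace NSC

/-! ### Sets as numbers -/

namespace Ix

lemma code_lt : ∀ {n : ℕ} (i : Ix n), i.code < 2 ^ n
  | 0, _ => by simp [code]
  | n + 1, Sum.inl i => (code_lt (n := n) i).trans (Nat.pow_lt_pow_succ (by norm_num))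
  | n + 1, Sum.inr i => by
    have := code_lt (n := n) i
    simp only [code]; rw [pow_succ]; omega

/-- The characteristic vector with a given code. -/
def dec : (n : ℕ) → ℕ → Ix n
  | 0, _ => ()
  | n + 1, r => if r < 2 ^ n then Sum.inl (dec n r) else Sum.inr (dec n (r - 2 ^ n))

lemma dec_of_lt {n r : ℕ} (h : r < 2 ^ n) : dec (n + 1) r = Sum.inl (dec n r) := if_pos h

lemma dec_of_not_lt {n r : ℕ} (h : ¬ r < 2 ^ n) : dec (n + 1) r = Sum.inr (dec n (r - 2 ^ n)) :=
  if_neg h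

lemma dec_code : ∀ {n : ℕ} (i : Ix n), dec n i.code = i
  | 0, _ => rfl
  | n + 1, Sum.inl i => by
    simp only [code]
    exact (dec_of_lt (code_lt (n := n) i)).trans (congrArg Sum.inl (dec_code (n := n) i))
  | n + 1, Sum.inr i => by
    simp only [code]
    rw [dec_of_not_lt (Nat.not_lt.2 (Nat.le_add_right _ _)), Nat.add_sub_cancel_left]
    exact congrArg Sum.inr (dec_code (n := n) i)

lemma code_dec : ∀ (n : ℕ) {r : ℕ}, r < 2 ^ n → (dec n r).code = r
  | 0, r, h => by simp at h; simp [code, h]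
  | n + 1, r, h => by
    by_cases h0 : r < 2 ^ n
    · rw [dec_of_lt h0]
      exact code_dec n h0
    · rw [dec_of_not_lt h0]
      change 2 ^ n + (dec n (r - 2 ^ n)).code = r
      rw [pow_succ] at h
      rw [code_dec n (by omega)]; omega

lemma sum_code : ∀ (n : ℕ) (φ : ℕ → ℤ), ∑ i : Ix n, φ i.code = ∑ k ∈ Finset.range (2 ^ n), φ k
  | 0, φ => by
    change ∑ i : Unit, φ 0 = _
    simp
  | n + 1, φ => by
    rw [pow_succ, mul_two, Finset.sum_range_add, ← sum_code n φ, ← sum_code n fun k => φ (2 ^ n + k)]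
    exact Fintype.sum_sum_type (fun i : Ix (n + 1) => φ i.code)

lemma code_eq_sum : ∀ {n : ℕ} (i : Ix n), i.code = ∑ k ∈ i.toSet, 2 ^ k
  | 0, _ => by simp [code, toSet]
  | n + 1, Sum.inl i => code_eq_sum (n := n) i
  | n + 1, Sum.inr i => by
    simp only [code, toSet]
    rw [Finset.sum_insert (notMem_toSet (n := n) i), code_eq_sum (n := n) i]

lemma testBit_code : ∀ {n : ℕ} (i : Ix n) (k : ℕ), i.code.testBit k = true ↔ k ∈ i.toSet
  | 0, _, k => by simp [code, toSet]
  | n + 1, Sum.inl i, k => testBit_code (n := n) i k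
  | n + 1, Sum.inr i, k => by
    have h := code_lt (n := n) i
    simp only [code, toSet, Finset.mem_insert]
    rcases lt_trichotomy k n with hk | rfl | hk
    · rw [Nat.testBit_two_pow_add_gt hk, testBit_code (n := n) i]
      simp [hk.ne]
    · rw [Nat.testBit_two_pow_add_eq, Nat.testBit_lt_two_pow h]; simp
    · rw [Nat.testBit_lt_two_pow ((Nat.add_lt_add_left h _).trans_le
        ((mul_two (2 ^ n)).symm.trans_le ((pow_succ 2 n).symm.trans_le
          (Nat.pow_le_pow_right (by norm_num) hk))))]
      simp only [Bool.false_eq_true, false_iff, not_or]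
      exact ⟨hk.ne', fun hc => absurd (lt_of_mem_toSet (n := n) i hc) (by omega)⟩

lemma exists_toSet : ∀ (n : ℕ) (X : Finset ℕ), (∀ x ∈ X, x < n) → ∃ i : Ix n, i.toSet = X
  | 0, X, h => ⟨(), (Finset.eq_empty_of_forall_notMem fun x hx => by simpa using h x hx).symm⟩
  | n + 1, X, h => by
    by_cases hn : n ∈ X
    · obtain ⟨i, hi⟩ := exists_toSet n (X.erase n) fun x hx => by
        have := h x (Finset.mem_of_mem_erase hx)
        have := Finset.ne_of_mem_erase hx
        omega
      exact ⟨Sum.inr i, by simp only [toSet]; rw [hi, Finset.insert_erase hn]⟩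
    · obtain ⟨i, hi⟩ := exists_toSet n X fun x hx => by
        have := h x hx
        have : x ≠ n := fun h => hn (h ▸ hx)
        omega
      exact ⟨Sum.inl i, hi⟩

end Ix

/-- The sign given by the parity of the number of binary digits `1`. -/
def par (c : ℕ) : ℤ := if h : c = 0 then 1 else par (c / 2) * (1 - 2 * ((c % 2 : ℕ) : ℤ))

lemma par_eq (c : ℕ) : par c = par (c / 2) * (1 - 2 * ((c % 2 : ℕ) : ℤ)) := by
  by_cases h : c = 0
  · subst h; simp [par]
  · rw [par, dif_neg h]

lemma abs_par (c : ℕ) : |par c| = 1 := by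
  induction c using Nat.strong_induction_on with
  | _ c ih =>
    by_cases h : c = 0
    · subst h; simp [par]
    · rw [par_eq, abs_mul, ih _ (by omega), one_mul]
      rcases Nat.mod_two_eq_zero_or_one c with h | h <;> rw [h] <;> simp

lemma par_two_pow_add : ∀ (n x : ℕ), x < 2 ^ n → par (2 ^ n + x) = -par x
  | 0, x, h => by
    simp only [pow_zero, Nat.lt_one_iff] at h
    subst h
    rw [par_eq]; simp [par]
  | n + 1, x, h => by
    rw [pow_succ] at h
    have h1 : (2 ^ (n + 1) + x) / 2 = 2 ^ n + x / 2 := by rw [pow_succ]; omega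
    have h2 : (2 ^ (n + 1) + x) % 2 = x % 2 := by rw [pow_succ]; omega
    rw [par_eq, h1, h2, par_two_pow_add n _ (by omega), par_eq x, neg_mul]

lemma par_code : ∀ {n : ℕ} (i : Ix n), par i.code = (-1) ^ i.toSet.card
  | 0, _ => by simp [Ix.code, Ix.toSet, par]
  | n + 1, Sum.inl i => par_code (n := n) i
  | n + 1, Sum.inr i => by
    simp only [Ix.code, Ix.toSet]
    rw [par_two_pow_add n _ (Ix.code_lt (n := n) i), par_code (n := n) i,
      Finset.card_insert_of_notMem (Ix.notMem_toSet (n := n) i), pow_succ]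
    ring

/-! ### The representation computed bit by bit -/

/-- One round of the transformation: the contribution of bit `j`. -/
def fstep (w : ℤ) (j : ℕ) (M : ℕ → ℕ → ℤ) (r c : ℕ) : ℤ :=
  if 0 < r / 2 ^ j % 2 then
    if 0 < c / 2 ^ j % 2 then
      par (r % 2 ^ j) * par (c % 2 ^ j) * M (r - 2 ^ j) (c - 2 ^ j) + w * w * M r c
    else w * M r c
  else if 0 < c / 2 ^ j % 2 then w * M r c else M r c

/-- The first `j` rounds. -/
def fiter (w : ℤ) (M : ℕ → ℕ → ℤ) : ℕ → ℕ → ℕ → ℤ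
  | 0 => M
  | j + 1 => fstep w j (fiter w M j)

/-- The first n rounds act separately on each aligned block of side 2^n; `p` and `q` are the higher
digits that name the block. They must vary in the induction, because round n combines the blocks
with digits 2p, 2p + 1 and 2q, 2q + 1. -/
lemma fiter_code (w : ℤ) (M : ℕ → ℕ → ℤ) : ∀ (n : ℕ) (p q : ℕ) (i j : Ix n),
    fiter w M n (i.code + 2 ^ n * p) (j.code + 2 ^ n * q) =
      rep w n (fun i j => M (i.code + 2 ^ n * p) (j.code + 2 ^ n * q)) i j
  | 0, p, q, i, j => rfl
  | n + 1, p, q, i, j => by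
    have low (k : Ix n) (p : ℕ) : k.code + 2 ^ (n + 1) * p = k.code + 2 ^ n * (2 * p) := by
      rw [pow_succ]; ring
    have high (k : Ix n) (p : ℕ) :
        2 ^ n + k.code + 2 ^ (n + 1) * p = k.code + 2 ^ n * (2 * p + 1) := by
      rw [pow_succ]; ring
    have div (k : Ix n) (p : ℕ) : (k.code + 2 ^ n * p) / 2 ^ n = p := by
      rw [Nat.add_mul_div_left _ _ (by positivity), Nat.div_eq_of_lt k.code_lt, zero_add]
    have mod (k : Ix n) (p : ℕ) : (k.code + 2 ^ n * p) % 2 ^ n = k.code := by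
      rw [Nat.add_mul_mod_self_left, Nat.mod_eq_of_lt k.code_lt]
    have sub (k : Ix n) (p : ℕ) :
        k.code + 2 ^ n * (2 * p + 1) - 2 ^ n = k.code + 2 ^ n * (2 * p) := by
      rw [mul_add, mul_one]; omega
    have even (p : ℕ) : 2 * p % 2 = 0 := by omega
    have odd (p : ℕ) : (2 * p + 1) % 2 = 1 := by omega
    have cl (k : Ix n) : Ix.code (n := n + 1) (Sum.inl k) = k.code := rfl
    have cr (k : Ix n) : Ix.code (n := n + 1) (Sum.inr k) = 2 ^ n + k.code := rfl
    rcases i with i | i <;> rcases j with j | j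
    · simp only [fiter, fstep, cl, low, div, even, lt_irrefl, if_false]
      rw [fiter_code w M n]
      change _ = rep w n (fun i j => M (i.code + 2 ^ (n + 1) * p) (j.code + 2 ^ (n + 1) * q)) i j
      simp only [low]
    · simp only [fiter, fstep, cl, cr, low, high, div, even, odd, lt_irrefl, if_false, zero_lt_one,
        if_true]
      rw [fiter_code w M n]
      change _ = w * rep w n
        (fun i j => M (i.code + 2 ^ (n + 1) * p) (2 ^ n + j.code + 2 ^ (n + 1) * q)) i j
      simp only [low, high]
    · simp only [fiter, fstep, cl, cr, low, high, div, even, odd, lt_irrefl, if_false, zero_lt_one,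
        if_true]
      rw [fiter_code w M n]
      change _ = w * rep w n
        (fun i j => M (2 ^ n + i.code + 2 ^ (n + 1) * p) (j.code + 2 ^ (n + 1) * q)) i j
      simp only [low, high]
    · simp only [fiter, fstep, cr, high, div, odd, zero_lt_one, if_true, mod, sub]
      rw [fiter_code w M n, fiter_code w M n, par_code, par_code, ← pow_add, ← hat_apply]
      change _ = hat (rep w n
        (fun i j => M (i.code + 2 ^ (n + 1) * p) (j.code + 2 ^ (n + 1) * q))) i j + w * w * rep w n
        (fun i j => M (2 ^ n + i.code + 2 ^ (n + 1) * p) (2 ^ n + j.code + 2 ^ (n + 1) * q)) i j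
      simp only [low, high]

lemma abs_fstep_le {w : ℤ} (hw : 1 ≤ w) {M : ℕ → ℕ → ℤ} {B : ℤ} (hM : ∀ r c, |M r c| ≤ B) (j r c : ℕ) :
    |fstep w j M r c| ≤ 2 * (w * w) * B := by
  have hB : 0 ≤ B := (abs_nonneg _).trans (hM 0 0)
  have h1 : 1 ≤ w * w := by nlinarith
  have h2 : w ≤ w * w := by nlinarith
  have hwM : |w * M r c| ≤ 2 * (w * w) * B := by
    rw [abs_mul, abs_of_pos (by omega)]
    exact mul_le_mul (by omega) (hM r c) (abs_nonneg _) (by omega)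
  unfold fstep
  split_ifs
  · refine (abs_add_le _ _).trans ?_
    rw [abs_mul, abs_mul, abs_par, abs_par, abs_mul, abs_of_pos (by omega : 0 < w * w)]
    have := mul_le_mul_of_nonneg_left (hM r c) (by omega : 0 ≤ w * w)
    have := hM (r - 2 ^ j) (c - 2 ^ j)
    nlinarith
  · exact hwM
  · exact hwM
  · exact (hM r c).trans (le_mul_of_one_le_left hB (by omega))

lemma abs_fiter_le {w : ℤ} (hw : 1 ≤ w) {M : ℕ → ℕ → ℤ} {B : ℤ} (hM : ∀ r c, |M r c| ≤ B) :
    ∀ j r c, |fiter w M j r c| ≤ (2 * (w * w)) ^ j * B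
  | 0, r, c => by simpa [fiter] using hM r c
  | j + 1, r, c => by
    have := abs_fstep_le hw (abs_fiter_le hw hM j) j r c
    rw [pow_succ']
    simpa [fiter, mul_assoc] using this

/-- One round of the inverse transformation. -/
def istep (w : ℤ) (j : ℕ) (M : ℕ → ℕ → ℤ) (r c : ℕ) : ℤ :=
  if 0 < r / 2 ^ j % 2 then
    if 0 < c / 2 ^ j % 2 then
      (M r c - par (r % 2 ^ j) * par (c % 2 ^ j) * M (r - 2 ^ j) (c - 2 ^ j)) / (w * w)
    else M r c / w
  else if 0 < c / 2 ^ j % 2 then M r c / w else M r c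

/-- The first `k` rounds of the inverse transformation, from bit `n - 1` downwards. -/
def iiter (w : ℤ) (n : ℕ) (M : ℕ → ℕ → ℤ) : ℕ → ℕ → ℕ → ℤ
  | 0 => M
  | k + 1 => istep w (n - 1 - k) (iiter w n M k)

lemma two_pow_le_of_bit {r j : ℕ} (h : 0 < r / 2 ^ j % 2) : 2 ^ j ≤ r := by
  by_contra! hlt
  rw [Nat.div_eq_of_lt hlt] at h
  simp at h

lemma bit_sub {r j : ℕ} (h : 0 < r / 2 ^ j % 2) : ¬ 0 < (r - 2 ^ j) / 2 ^ j % 2 := by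
  have : (r - 2 ^ j) / 2 ^ j = r / 2 ^ j - 1 := by
    simpa using Nat.sub_mul_div r (2 ^ j) 1
  rw [this]; omega

/-- The subtracted cell has bit j cleared in row and column, so the forward round left it unchanged.
After the subtraction the division is exact. -/
lemma istep_fstep {w : ℤ} (hw : w ≠ 0) (j : ℕ) (M : ℕ → ℕ → ℤ) (r c : ℕ) :
    istep w j (fstep w j M) r c = M r c := by
  unfold istep
  split_ifs with hr hc hc
  · have h1 : fstep w j M (r - 2 ^ j) (c - 2 ^ j) = M (r - 2 ^ j) (c - 2 ^ j) := by
      simp only [fstep, if_neg (bit_sub hr), if_neg (bit_sub hc)]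
    rw [h1, fstep, if_pos hr, if_pos hc, add_sub_cancel_left]
    exact Int.mul_ediv_cancel_left _ (mul_ne_zero hw hw)
  · rw [fstep, if_pos hr, if_neg hc]
    exact Int.mul_ediv_cancel_left _ hw
  · rw [fstep, if_neg hr, if_pos hc]
    exact Int.mul_ediv_cancel_left _ hw
  · rw [fstep, if_neg hr, if_neg hc]

/-- A round reads only cells whose row and column are no larger, so agreement on the m × m corner is
preserved. -/
lemma istep_congr {w : ℤ} {j m : ℕ} {M M' : ℕ → ℕ → ℤ} (h : ∀ r < m, ∀ c < m, M r c = M' r c)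
    {r c : ℕ} (hr : r < m) (hc : c < m) : istep w j M r c = istep w j M' r c := by
  have h2 : ∀ x, x - 2 ^ j ≤ x := fun x => Nat.sub_le _ _
  simp only [istep, h r hr c hc, h _ ((h2 r).trans_lt hr) _ ((h2 c).trans_lt hc)]

lemma iiter_eq {w : ℤ} (hw : w ≠ 0) {n m : ℕ} {M M' : ℕ → ℕ → ℤ}
    (h : ∀ r < m, ∀ c < m, M r c = fiter w M' n r c) :
    ∀ k ≤ n, ∀ r < m, ∀ c < m, iiter w n M k r c = fiter w M' (n - k) r c
  | 0, _, r, hr, c, hc => h r hr c hc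
  | k + 1, hk, r, hr, c, hc => by
    have e : n - k = n - 1 - k + 1 := by omega
    rw [iiter, istep_congr (iiter_eq hw h k (by omega)) hr hc, e, fiter, istep_fstep hw]
    congr 1; omega

/-- Integer division never enlarges absolute values, so no exactness is needed here. -/
lemma abs_istep_le {w : ℤ} {M : ℕ → ℕ → ℤ} {B : ℤ} (hM : ∀ r c, |M r c| ≤ B) (j r c : ℕ) :
    |istep w j M r c| ≤ 2 * B := by
  have hB : 0 ≤ B := (abs_nonneg _).trans (hM 0 0)
  have hdiv (x y : ℤ) (h : |x| ≤ 2 * B) : |x / y| ≤ 2 * B := (Int.abs_ediv_le_abs x y).trans h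
  have h1 : |M r c| ≤ 2 * B := (hM r c).trans (by linarith)
  unfold istep
  split_ifs
  · apply hdiv
    refine (abs_sub _ _).trans ?_
    rw [abs_mul, abs_mul, abs_par, abs_par]
    have := hM r c
    have := hM (r - 2 ^ j) (c - 2 ^ j)
    linarith
  · exact hdiv _ _ h1
  · exact hdiv _ _ h1
  · exact h1

lemma abs_iiter_le {w : ℤ} {n : ℕ} {M : ℕ → ℕ → ℤ} {B : ℤ} (hM : ∀ r c, |M r c| ≤ B) :
    ∀ k r c, |iiter w n M k r c| ≤ 2 ^ k * B
  | 0, r, c => by simpa [iiter] using hM r c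
  | k + 1, r, c => by
    have := abs_istep_le (w := w) (abs_iiter_le (w := w) (n := n) hM k) (n - 1 - k) r c
    rw [pow_succ']
    simpa [iiter, mul_assoc] using this

/-! ### Functions on subsets of `Fin n` -/

/-- The part of a set of numbers below `n`. -/
def res (n : ℕ) (X : Finset ℕ) : Finset (Fin n) := Finset.univ.filter fun i => (i : ℕ) ∈ X

/-- A function of subsets of `Fin n` as a function of sets of numbers. -/
def lft {n : ℕ} (f : Finset (Fin n) → Finset (Fin n) → ℤ) (X Y : Finset ℕ) : ℤ :=
  f (res n X) (res n Y)

lemma res_map {n : ℕ} (X : Finset (Fin n)) : res n (X.map Fin.valEmbedding) = X := by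
  ext i
  simp [res, Fin.val_inj]

lemma map_res {n : ℕ} {X : Finset ℕ} (h : ∀ x ∈ X, x < n) : (res n X).map Fin.valEmbedding = X := by
  ext x
  simp only [res, Finset.mem_map, Finset.mem_filter, Finset.mem_univ, true_and,
    Fin.valEmbedding_apply]
  constructor
  · rintro ⟨i, hi, rfl⟩; exact hi
  · intro hx; exact ⟨⟨x, h x hx⟩, hx, rfl⟩

lemma invSign_map {n : ℕ} (A B : Finset (Fin n)) :
    invSign (A.map Fin.valEmbedding) (B.map Fin.valEmbedding) = invSign A B := by
  unfold invSign
  congr 1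
  have : (A.map Fin.valEmbedding ×ˢ B.map Fin.valEmbedding).filter (fun p => p.1 > p.2) =
      ((A ×ˢ B).filter (fun p => p.1 > p.2)).map
        (Fin.valEmbedding.prodMap Fin.valEmbedding) := by
    ext ⟨x, y⟩
    simp only [Finset.mem_filter, Finset.mem_product, Finset.mem_map, Fin.valEmbedding_apply,
      Prod.exists, Function.Embedding.coe_prodMap, Prod.map, Prod.mk.injEq]
    constructor
    · rintro ⟨⟨⟨a, ha, rfl⟩, ⟨b, hb, rfl⟩⟩, h⟩
      exact ⟨a, b, ⟨⟨ha, hb⟩, h⟩, rfl, rfl⟩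
    · rintro ⟨a, b, ⟨⟨ha, hb⟩, h⟩, rfl, rfl⟩
      exact ⟨⟨⟨a, ha, rfl⟩, ⟨b, hb, rfl⟩⟩, h⟩
  rw [this, Finset.card_map]

lemma sum_splits {n : ℕ} (X : Finset (Fin n)) (φ : Finset ℕ → Finset ℕ → ℤ) :
    ∑ p ∈ splits X, φ (p.1.map Fin.valEmbedding) (p.2.map Fin.valEmbedding) =
      ∑ A ∈ (X.map Fin.valEmbedding).powerset, φ A (X.map Fin.valEmbedding \ A) := by
  have hlt : ∀ A ⊆ X.map Fin.valEmbedding, ∀ x ∈ A, x < n := by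
    intro A hA x hx
    obtain ⟨i, -, rfl⟩ := Finset.mem_map.1 (hA hx)
    exact i.2
  refine Finset.sum_nbij' (fun p => p.1.map Fin.valEmbedding) (fun A => (res n A, X \ res n A))
    ?_ ?_ ?_ ?_ ?_
  · rintro ⟨A, B⟩ h
    simp only [splits, Finset.mem_filter, Finset.mem_univ, true_and] at h
    rw [Finset.mem_powerset, Finset.map_subset_map, ← h.2]
    exact Finset.subset_union_left
  · intro A hA
    rw [Finset.mem_powerset] at hA
    have : res n A ⊆ X := by
      rw [← Finset.map_subset_map (f := Fin.valEmbedding), map_res (hlt A hA)]; exact hA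
    simp only [splits, Finset.mem_filter, Finset.mem_univ, true_and]
    exact ⟨Finset.disjoint_sdiff, Finset.union_sdiff_of_subset this⟩
  · rintro ⟨A, B⟩ h
    simp only [splits, Finset.mem_filter, Finset.mem_univ, true_and] at h
    simp only [res_map, Prod.mk.injEq, true_and]
    rw [← h.2, Finset.union_sdiff_cancel_left h.1]
  · intro A hA
    exact map_res (hlt A (Finset.mem_powerset.1 hA))
  · rintro ⟨A, B⟩ h
    simp only [splits, Finset.mem_filter, Finset.mem_univ, true_and] at h
    rw [← Finset.map_sdiff, ← h.2, Finset.union_sdiff_cancel_left h.1]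

lemma nsc2_eq_conv {n : ℕ} (f g : Finset (Fin n) → Finset (Fin n) → ℤ) (X Y : Finset (Fin n)) :
    nsc2 f g X Y = conv (lft f) (lft g) (X.map Fin.valEmbedding) (Y.map Fin.valEmbedding) := by
  unfold nsc2 conv
  rw [← sum_splits X fun A A' => ∑ B ∈ (Y.map Fin.valEmbedding).powerset,
    lft f A B * lft g A' (Y.map Fin.valEmbedding \ B) *
      (invSign A A' * invSign B (Y.map Fin.valEmbedding \ B))]
  refine Finset.sum_congr rfl fun p _ => ?_
  rw [← sum_splits Y fun B B' => lft f (p.1.map Fin.valEmbedding) B *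
    lft g (p.2.map Fin.valEmbedding) B' *
      (invSign (p.1.map Fin.valEmbedding) (p.2.map Fin.valEmbedding) * invSign B B')]
  refine Finset.sum_congr rfl fun q _ => ?_
  simp only [lft, res_map, invSign_map]
  ring

lemma setTable_code {n : ℕ} (f : Finset (Fin n) → Finset (Fin n) → ℤ) (i j : Ix n) :
    setTable f (i.code * 2 ^ n + j.code) = lft f i.toSet j.toSet := by
  have hi := i.code_lt
  have hj := j.code_lt
  have h1 : (i.code * 2 ^ n + j.code) / 2 ^ n = i.code := by
    rw [mul_comm, Nat.mul_add_div (by positivity), Nat.div_eq_of_lt hj, add_zero]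
  have h2 : (i.code * 2 ^ n + j.code) % 2 ^ n = j.code := by
    rw [mul_comm, Nat.mul_add_mod, Nat.mod_eq_of_lt hj]
  have h3 : i.code * 2 ^ n + j.code < 2 ^ n * 2 ^ n := by
    calc i.code * 2 ^ n + j.code < (i.code + 1) * 2 ^ n := by rw [add_mul]; omega
      _ ≤ 2 ^ n * 2 ^ n := Nat.mul_le_mul_right _ hi
  rw [setTable, if_pos h3, h1, h2]
  simp only [lft, res, Ix.testBit_code]

lemma exists_ix {n : ℕ} (X : Finset (Fin n)) :
    ∃ i : Ix n, i.toSet = X.map Fin.valEmbedding ∧ i.code = setCode X := by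
  obtain ⟨i, hi⟩ := Ix.exists_toSet n (X.map Fin.valEmbedding) (by simp)
  refine ⟨i, hi, ?_⟩
  rw [Ix.code_eq_sum, hi, Finset.sum_map]
  rfl

/-! ### Correctness of the algorithm -/

/-- Balanced base-w digits lie in [-H, H]. Adding H makes P + H an ordinary remainder, dropped by
the floor division; the same shift around the second reduction reads off h. -/
lemma digit_eq {H w U P h Q : ℤ} (hw : w = 2 * H + 1) (hP : |P| ≤ H) (hh : |h| ≤ H)
    (hU : U = P + w * h + w * w * Q) : ((U + H) / w + H) % w - H = h := by
  rw [abs_le] at hP hh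
  have h1 : (U + H) / w = h + w * Q := by
    rw [show U + H = (P + H) + w * (h + w * Q) by rw [hU]; ring,
      Int.add_mul_ediv_left _ _ (by omega), Int.ediv_eq_zero_of_lt (by omega) (by omega), zero_add]
  rw [h1, show h + w * Q + H = (h + H) + w * Q by ring, Int.add_mul_emod_self_left,
    Int.emod_eq_of_lt (by omega) (by omega)]
  ring

/-- The first table with weights. -/
def preL (n : ℕ) (w : ℤ) (tab : ℕ → ℤ) (r c : ℕ) : ℤ :=
  tab (r * 2 ^ n + c) * (1 + par r * par c * w)

/-- The second table with weights. -/
def preR (n : ℕ) (w : ℤ) (tab : ℕ → ℤ) (r c : ℕ) : ℤ :=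
  tab (r * 2 ^ n + c) * (if 0 < par r then w else 1)

/-- The product of two transformed tables. -/
def prodTab (m : ℕ) (A B : ℕ → ℕ → ℤ) (r c : ℕ) : ℤ :=
  if r < m ∧ c < m then ∑ k ∈ Finset.range m, A r k * B k c else 0

/-- Extraction of the result. -/
def extract (H w U : ℤ) : ℤ := ((U + H) / w + H) % w - H

/-- The same w is the scale of `rep` and the base of the weights, so the deformation error, a
multiple of w², joins the part above the digit h. -/
theorem extract_eq_nsc2 {n : ℕ} {f g : Finset (Fin n) → Finset (Fin n) → ℤ} {W H w : ℤ}
    (hf : ∀ X Y, |f X Y| ≤ W) (hg : ∀ X Y, |g X Y| ≤ W) (hH : H = 2 ^ n * 2 ^ n * (W * W))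
    (hw : w = 2 * H + 1) (X Y : Finset (Fin n)) :
    extract H w (iiter w n (prodTab (2 ^ n) (fiter w (preL n w (setTable f)) n)
      (fiter w (preR n w (setTable g)) n)) n (setCode X) (setCode Y)) = nsc2 f g X Y := by
  obtain ⟨i, hiX, hi⟩ := exists_ix X
  obtain ⟨j, hjY, hj⟩ := exists_ix Y
  have hF : ∀ A B, |lft f A B| ≤ W := fun _ _ => hf _ _
  have hG : ∀ A B, |lft g A B| ≤ W := fun _ _ => hg _ _
  have hW : 0 ≤ W := (abs_nonneg _).trans (hf ∅ ∅)
  have hH0 : 0 ≤ H := by rw [hH]; positivity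
  have hw0 : w ≠ 0 := by omega
  have repL : ∀ i j : Ix n, fiter w (preL n w (setTable f)) n i.code j.code =
      rep w n (ofSets n (wtL w (lft f))) i j := by
    intro i j
    have := fiter_code w (preL n w (setTable f)) n 0 0 i j
    simp only [mul_zero, add_zero] at this
    rw [this]
    congr 1
    ext i j
    simp only [preL, setTable_code, par_code, ofSets, wtL]
  have repR : ∀ i j : Ix n, fiter w (preR n w (setTable g)) n i.code j.code =
      rep w n (ofSets n (wtR w (lft g))) i j := by
    intro i j
    have := fiter_code w (preR n w (setTable g)) n 0 0 i j
    simp only [mul_zero, add_zero] at this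
    rw [this]
    congr 1
    ext i j
    simp only [preR, setTable_code, par_code, ofSets, wtR]
  set U := star (w * w) n (ofSets n (wtL w (lft f))) (ofSets n (wtR w (lft g))) with hU
  have inv : iiter w n (prodTab (2 ^ n) (fiter w (preL n w (setTable f)) n)
      (fiter w (preR n w (setTable g)) n)) n i.code j.code = U i j := by
    -- By `rep_star` the product table is the forward transform of the table of U; this is the
    -- preimage that makes every inverse division exact.
    rw [iiter_eq hw0 (m := 2 ^ n) (M' := fun r c => U (Ix.dec n r) (Ix.dec n c)) _ n le_rfl _
      i.code_lt _ j.code_lt]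
    · simp only [Nat.sub_self, fiter, Ix.dec_code]
    · intro r hr c hc
      obtain ⟨i, rfl⟩ : ∃ i : Ix n, i.code = r := ⟨_, Ix.code_dec n hr⟩
      obtain ⟨j, rfl⟩ : ∃ j : Ix n, j.code = c := ⟨_, Ix.code_dec n hc⟩
      have := fiter_code w (fun r c => U (Ix.dec n r) (Ix.dec n c)) n 0 0 i j
      simp only [mul_zero, add_zero, Ix.dec_code] at this
      rw [this, prodTab, if_pos ⟨hr, hc⟩, ← Ix.sum_code n fun k =>
        fiter w (preL n w (setTable f)) n i.code k * fiter w (preR n w (setTable g)) n k j.code]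
      simp only [repL, repR]
      rw [← Matrix.mul_apply, ← rep_star]
  obtain ⟨r, hr⟩ := star_congr (w * w) n (ofSets n (wtL w (lft f))) (ofSets n (wtR w (lft g)))
  have hXc : (X.map Fin.valEmbedding).card ≤ n := by
    rw [Finset.card_map]; simpa using Finset.card_le_univ X
  have hYc : (Y.map Fin.valEmbedding).card ≤ n := by
    rw [Finset.card_map]; simpa using Finset.card_le_univ Y
  obtain ⟨P, Q, hP, hPQ⟩ := gconv_wt hXc hYc hF hG w
  rw [← hi, ← hj, inv, nsc2_eq_conv, extract]
  refine digit_eq (P := P) (Q := Q + r i j) hw (by rw [hH]; exact hP)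
    (by rw [hH]; exact abs_conv_le hXc hYc hF hG) ?_
  rw [hU, hr, star_zero_ofSets, Matrix.add_apply, Matrix.smul_apply, ofSets, hiX, hjY, hPQ, smul_eq_mul]
  ring

end NSC

/-! ### The concrete program: variables, table filling, and single rounds in place -/

namespace NSC

/-! ### The program -/

/-- The program variables: the size `n`, its powers `N = 2 ^ n` and `N ^ 2`, three numbers that
depend on the size of the input, a cell index, a power of two and a round index. -/
def vars (n N NN W w H a pw j : ℤ) : ℕ → ℤ
  | 0 => n
  | 1 => N
  | 2 => NN
  | 3 => W
  | 4 => w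
  | 5 => H
  | 6 => a
  | 7 => pw
  | 8 => j
  | _ => 0

section vars
variable (n N NN W w H a pw j z : ℤ)

lemma vars_update_1 : Function.update (vars n N NN W w H a pw j) 1 z = vars n z NN W w H a pw j := by
  ext x; rcases x with _ | _ | _ | _ | _ | _ | _ | _ | _ | x <;> rfl
lemma vars_update_2 : Function.update (vars n N NN W w H a pw j) 2 z = vars n N z W w H a pw j := by
  ext x; rcases x with _ | _ | _ | _ | _ | _ | _ | _ | _ | x <;> rfl
lemma vars_update_3 : Function.update (vars n N NN W w H a pw j) 3 z = vars n N NN z w H a pw j := by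
  ext x; rcases x with _ | _ | _ | _ | _ | _ | _ | _ | _ | x <;> rfl
lemma vars_update_4 : Function.update (vars n N NN W w H a pw j) 4 z = vars n N NN W z H a pw j := by
  ext x; rcases x with _ | _ | _ | _ | _ | _ | _ | _ | _ | x <;> rfl
lemma vars_update_5 : Function.update (vars n N NN W w H a pw j) 5 z = vars n N NN W w z a pw j := by
  ext x; rcases x with _ | _ | _ | _ | _ | _ | _ | _ | _ | x <;> rfl
lemma vars_update_6 : Function.update (vars n N NN W w H a pw j) 6 z = vars n N NN W w H z pw j := by
  ext x; rcases x with _ | _ | _ | _ | _ | _ | _ | _ | _ | x <;> rfl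
lemma vars_update_7 : Function.update (vars n N NN W w H a pw j) 7 z = vars n N NN W w H a z j := by
  ext x; rcases x with _ | _ | _ | _ | _ | _ | _ | _ | _ | x <;> rfl
lemma vars_update_8 : Function.update (vars n N NN W w H a pw j) 8 z = vars n N NN W w H a pw z := by
  ext x; rcases x with _ | _ | _ | _ | _ | _ | _ | _ | _ | x <;> rfl

variable {n N NN W w H a pw j}

lemma bitLen_vars {L : ℕ} (h : ∀ z ∈ [n, N, NN, W, w, H, a, pw, j], bitLen z ≤ L) (x : ℕ) :
    bitLen (vars n N NN W w H a pw j x) ≤ L := by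
  have h0 : bitLen 0 ≤ L := (le_trans (by simp [bitLen]) (one_le_bitLen n)).trans (h n (by simp))
  simp only [List.forall_mem_cons] at h
  obtain ⟨h1, h2, h3, h4, h5, h6, h7, h8, h9, -⟩ := h
  rcases x with _ | _ | _ | _ | _ | _ | _ | _ | _ | x
  all_goals simp only [vars]; assumption

end vars

/-- All numbers that the program computes with besides the table entries have at most `L` bits. -/
structure Fits (n : ℕ) (W w H : ℤ) (L : ℕ) : Prop where
  NN : bitLen ((2 ^ n * 2 ^ n : ℕ) : ℤ) ≤ L
  W : bitLen W ≤ L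
  w : bitLen w ≤ L
  H : bitLen H ≤ L

/-- The program variables after the initialisation. -/
abbrev varsAt (n : ℕ) (W w H : ℤ) (a pw j : ℕ) : ℕ → ℤ :=
  vars n (2 ^ n : ℕ) (2 ^ n * 2 ^ n : ℕ) W w H a pw j

lemma bitLen_nat_le {m k L : ℕ} (h : m ≤ k) (hk : bitLen (k : ℤ) ≤ L) : bitLen (m : ℤ) ≤ L :=
  (bitLen_mono (by rw [Int.natAbs_natCast, Int.natAbs_natCast]; exact h)).trans hk

lemma le_two_pow_mul_self (n : ℕ) : 2 ^ n ≤ 2 ^ n * 2 ^ n :=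
  Nat.le_mul_of_pos_left _ (by positivity)

namespace Fits
variable {n : ℕ} {W w H : ℤ} {L : ℕ}

lemma one_le (F : Fits n W w H L) : 1 ≤ L := (one_le_bitLen _).trans F.NN

lemma nat (F : Fits n W w H L) {m : ℕ} (h : m ≤ 2 ^ n * 2 ^ n) : bitLen (m : ℤ) ≤ L := bitLen_nat_le h F.NN

lemma vars (F : Fits n W w H L) {a pw j : ℕ} (ha : a ≤ 2 ^ n * 2 ^ n) (hpw : pw ≤ 2 ^ n * 2 ^ n) (hj : j ≤ 2 ^ n * 2 ^ n)
    (x : ℕ) : bitLen (varsAt n W w H a pw j x) ≤ L := by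
  apply bitLen_vars
  simp only [List.forall_mem_cons, List.not_mem_nil, false_implies, implies_true, and_true]
  exact ⟨F.nat (Nat.lt_two_pow_self.le.trans (le_two_pow_mul_self n)), F.nat (le_two_pow_mul_self n),
    F.NN, F.W, F.w, F.H, F.nat ha, F.nat hpw, F.nat hj⟩

end Fits

/-- Memory with a partly overwritten bank. -/
def partFill (M : ℕ → ℕ → ℤ) (k i : ℕ) (new : ℕ → ℤ) : ℕ → ℕ → ℤ :=
  Function.update M k (fun a => if a < i then new a else M k a)

lemma partFill_self (M : ℕ → ℕ → ℤ) (k i : ℕ) (new : ℕ → ℤ) (a : ℕ) :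
    partFill M k i new k a = if a < i then new a else M k a := by
  rw [partFill, Function.update_self]

lemma partFill_of_ne (M : ℕ → ℕ → ℤ) {k l : ℕ} (i : ℕ) (new : ℕ → ℤ) (h : l ≠ k) :
    partFill M k i new l = M l := Function.update_of_ne h _ _

/-- The time for filling a table, in units of `2 ^ n * 2 ^ n * L ^ 2`. -/
def fillCost (e : Ex) : ℕ := 2 * (e.cost + e.size + 22)

/-- Fill bank `k` with the values of an expression in the cell index. -/
def fill (k : ℕ) (e : Ex) : Prog := forLoop 6 2 (sto k (.v 6) e)

lemma fill_time (n c L : ℕ) :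
    (2 ^ n * 2 ^ n + 1) * (c * L ^ 2) ≤ 2 * c * (2 ^ n * 2 ^ n * L ^ 2) := by
  have : 1 ≤ 2 ^ n * 2 ^ n := Nat.mul_pos (by positivity) (by positivity)
  calc (2 ^ n * 2 ^ n + 1) * (c * L ^ 2) ≤ (2 ^ n * 2 ^ n + 2 ^ n * 2 ^ n) * (c * L ^ 2) := by gcongr
    _ = _ := by ring

lemma asg_time (n c L : ℕ) : c * L ^ 2 ≤ c * (2 ^ n * 2 ^ n * L ^ 2) := by
  have : 1 ≤ 2 ^ n * 2 ^ n := Nat.mul_pos (by positivity) (by positivity)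
  exact Nat.mul_le_mul_left _ (Nat.le_mul_of_pos_left _ this)

section phases
variable {n : ℕ} {W w H : ℤ} {L : ℕ}

/-- The hypotheses evaluate `e` in the partly overwritten memory, because the expression may read
the very bank that is being filled. -/
lemma runs_fill (F : Fits n W w H L) {k : ℕ} {e : Ex} {a pw j : ℕ} {A : ℕ → ℤ} {M : ℕ → ℕ → ℤ} (new : ℕ → ℤ)
    (he : ∀ i < 2 ^ n * 2 ^ n, e.eval ⟨varsAt n W w H i pw j, A, partFill M k i new⟩ = new i)
    (hr : ∀ i < 2 ^ n * 2 ^ n, e.Reads L ⟨varsAt n W w H i pw j, A, partFill M k i new⟩) :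
    Runs (fill k e) ⟨varsAt n W w H a pw j, A, M⟩ (fillCost e * (2 ^ n * 2 ^ n * L ^ 2))
      ⟨varsAt n W w H (2 ^ n * 2 ^ n : ℕ) pw j, A, partFill M k (2 ^ n * 2 ^ n) new⟩ := by
  have := runs_mapLoop (L := L) F.one_le (x := 6) (y := 2) (k := k) (by norm_num) (e := e)
    (m := 2 ^ n * 2 ^ n) (V := varsAt n W w H a pw j) (A := A) (M := M) new rfl F.NN
    (by simp only [vars_update_6]; exact he) (by simp only [vars_update_6]; exact hr)
  rw [vars_update_6] at this
  exact this.mono (fill_time n _ L)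

lemma runs_fill_of_banks (F : Fits n W w H L) {k : ℕ} {e : Ex} {a pw j : ℕ}
    (hpw : pw ≤ 2 ^ n * 2 ^ n) (hj : j ≤ 2 ^ n * 2 ^ n) {A : ℕ → ℤ} {M : ℕ → ℕ → ℤ} (new : ℕ → ℤ)
    (he : ∀ i < 2 ^ n * 2 ^ n, e.eval ⟨varsAt n W w H i pw j, A, partFill M k i new⟩ = new i)
    (K : ℕ → Prop) (hK : e.Banks K) (hM : ∀ l, K l → ∀ a, bitLen (M l a) ≤ L)
    (hnew : ∀ i < 2 ^ n * 2 ^ n, bitLen (new i) ≤ L) :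
    Runs (fill k e) ⟨varsAt n W w H a pw j, A, M⟩ (fillCost e * (2 ^ n * 2 ^ n * L ^ 2))
      ⟨varsAt n W w H (2 ^ n * 2 ^ n : ℕ) pw j, A, partFill M k (2 ^ n * 2 ^ n) new⟩ := by
  refine runs_fill F new he fun i hi => Ex.reads_of_banks (F.vars hi.le hpw hj) ?_ e hK
  intro l hl a
  by_cases hlk : l = k
  · subst hlk
    simp only [partFill_self]
    split_ifs with h
    · exact hnew a (h.trans hi)
    · exact hM l hl a
  · simp only [partFill_of_ne _ _ _ hlk]
    exact hM l hl a

end phases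

/-- A square table in row-major order. -/
def flat (m : ℕ) (M : ℕ → ℕ → ℤ) (a : ℕ) : ℤ := if a < m * m then M (a / m) (a % m) else 0

/-! Expressions for the row and the column of the current cell and for their binary digits. -/

def rowE : Ex := .div (.v 6) (.v 1)
def colE : Ex := .mod (.v 6) (.v 1)
/-- The binary digit with the place value in variable `7`. -/
def bitE (e : Ex) : Ex := .mod (.div e (.v 7)) (.c 2)
/-- The lower binary digits. -/
def lowE (e : Ex) : Ex := .mod e (.v 7)

section eval
variable {n : ℕ} {W w H : ℤ} {i pw j : ℕ} {A : ℕ → ℤ} {M : ℕ → ℕ → ℤ}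

lemma eval_rowE : rowE.eval ⟨varsAt n W w H i pw j, A, M⟩ = ((i / 2 ^ n : ℕ) : ℤ) := by
  simp only [rowE, Ex.eval, vars]; norm_cast

lemma eval_colE : colE.eval ⟨varsAt n W w H i pw j, A, M⟩ = ((i % 2 ^ n : ℕ) : ℤ) := by
  simp only [colE, Ex.eval_mod, Ex.eval, vars]; norm_cast

lemma eval_bitE {e : Ex} {r : ℕ} (h : e.eval ⟨varsAt n W w H i pw j, A, M⟩ = r) :
    (bitE e).eval ⟨varsAt n W w H i pw j, A, M⟩ = ((r / pw % 2 : ℕ) : ℤ) := by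
  simp only [bitE, Ex.eval_mod, Ex.eval, vars, h]; norm_cast

lemma eval_lowE {e : Ex} {r : ℕ} (h : e.eval ⟨varsAt n W w H i pw j, A, M⟩ = r) :
    (lowE e).eval ⟨varsAt n W w H i pw j, A, M⟩ = ((r % pw : ℕ) : ℤ) := by
  simp only [lowE, Ex.eval_mod, Ex.eval, vars, h]; norm_cast

end eval

/-- The cell with bit `j` removed from row and column. -/
def prevE : Ex := .sub (.v 6) (.mul (.v 7) (.add (.v 1) (.c 1)))

/-- The sign in one round of the transformations. -/
def signE : Ex := .mul (.ld 3 (lowE rowE)) (.ld 3 (lowE colE))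

def fstepE (k : ℕ) : Ex :=
  .ite (bitE rowE)
    (.ite (bitE colE)
      (.add (.mul signE (.ld k prevE)) (.mul (.mul (.v 4) (.v 4)) (.ld k (.v 6))))
      (.mul (.v 4) (.ld k (.v 6))))
    (.ite (bitE colE) (.mul (.v 4) (.ld k (.v 6))) (.ld k (.v 6)))

def istepE (k : ℕ) : Ex :=
  .ite (bitE rowE)
    (.ite (bitE colE)
      (.div (.sub (.ld k (.v 6)) (.mul signE (.ld k prevE))) (.mul (.v 4) (.v 4)))
      (.div (.ld k (.v 6)) (.v 4)))
    (.ite (bitE colE) (.div (.ld k (.v 6)) (.v 4)) (.ld k (.v 6)))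

/-- The address of the cell with bit `j` removed from row and column. -/
lemma prev_cell {m i j : ℕ} (hm : 0 < m) (hr : 0 < i / m / 2 ^ j % 2) (hc : 0 < i % m / 2 ^ j % 2) :
    (i - 2 ^ j * (m + 1)) / m = i / m - 2 ^ j ∧ (i - 2 ^ j * (m + 1)) % m = i % m - 2 ^ j ∧
      i - 2 ^ j * (m + 1) < i := by
  have h1 := two_pow_le_of_bit hr
  have h2 := two_pow_le_of_bit hc
  have h3 := Nat.div_add_mod i m
  have h4 : i % m < m := Nat.mod_lt _ hm
  have h5 : 0 < 2 ^ j := by positivity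
  -- Clearing bit j in row and column lowers the row-major address by 2^j m + 2^j, without a borrow
  -- since both bits are set.
  have key : i - 2 ^ j * (m + 1) = m * (i / m - 2 ^ j) + (i % m - 2 ^ j) := by
    obtain ⟨p, hp⟩ := Nat.exists_eq_add_of_le h1
    obtain ⟨q, hq⟩ := Nat.exists_eq_add_of_le h2
    rw [hp, hq] at h3
    rw [hp, hq, Nat.add_sub_cancel_left, Nat.add_sub_cancel_left]
    have : i = 2 ^ j * (m + 1) + (m * p + q) := by rw [← h3]; ring
    rw [this, Nat.add_sub_cancel_left]
  have h6 : i % m - 2 ^ j < m := by omega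
  refine ⟨?_, ?_, ?_⟩
  · rw [key, Nat.mul_add_div hm, Nat.div_eq_of_lt h6, add_zero]
  · rw [key, Nat.mul_add_mod, Nat.mod_eq_of_lt h6]
  · have : 0 < 2 ^ j * (m + 1) := by positivity
    have : 0 < i := by
      rcases Nat.eq_zero_or_pos i with rfl | h
      · simp at hr
      · exact h
    omega

section rounds
variable {n : ℕ} {W w H : ℤ} {L : ℕ} {A : ℕ → ℤ} {M : ℕ → ℕ → ℤ}

lemma partFill_flat {k m : ℕ} {T T' : ℕ → ℕ → ℤ} (hk : M k = flat m T) :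
    partFill M k (m * m) (flat m T') = Function.update M k (flat m T') := by
  unfold partFill
  congr 1
  ext a
  simp only [hk, flat]
  split_ifs <;> rfl

lemma partFill_current {k m i : ℕ} {T T' : ℕ → ℕ → ℤ} (hk : M k = flat m T) (hi : i < m * m) :
    partFill M k i (flat m T') k i = T (i / m) (i % m) := by
  rw [partFill_self, if_neg (lt_irrefl i), hk, flat, if_pos hi]

/-- Why a round may work in place: the other cell it reads has a smaller address and is already
overwritten, but with bit j cleared in row and column its new value equals the old one (`hT'`). -/
lemma eval_step_aux {k i j : ℕ} (hi : i < 2 ^ n * 2 ^ n) {T T' : ℕ → ℕ → ℤ}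
    (hk : M k = flat (2 ^ n) T) (h3 : M 3 = fun c => if c < 2 ^ n then par c else 0) (hk3 : k ≠ 3) {j' : ℕ}
    (hT' : ∀ r c, ¬ 0 < r / 2 ^ j % 2 → ¬ 0 < c / 2 ^ j % 2 → T' r c = T r c) :
    let h : View := ⟨varsAt n W w H i (2 ^ j : ℕ) j', A, partFill M k i (flat (2 ^ n) T')⟩
    (Ex.ld k (.v 6)).eval h = T (i / 2 ^ n) (i % 2 ^ n) ∧
    signE.eval h = par (i / 2 ^ n % 2 ^ j) * par (i % 2 ^ n % 2 ^ j) ∧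
    (0 < i / 2 ^ n / 2 ^ j % 2 → 0 < i % 2 ^ n / 2 ^ j % 2 →
      (Ex.ld k prevE).eval h = T (i / 2 ^ n - 2 ^ j) (i % 2 ^ n - 2 ^ j)) := by
  intro h
  have hm : 0 < 2 ^ n := by positivity
  have hr : i / 2 ^ n < 2 ^ n := Nat.div_lt_of_lt_mul hi
  have hc : i % 2 ^ n < 2 ^ n := Nat.mod_lt _ hm
  refine ⟨?_, ?_, ?_⟩
  · simp only [h, Ex.eval, vars, Int.toNat_natCast]
    exact partFill_current hk hi
  · simp only [h, signE, Ex.eval, eval_lowE eval_rowE, eval_lowE eval_colE, Int.toNat_natCast,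
      partFill_of_ne _ _ _ hk3.symm, h3, (Nat.mod_le _ _).trans_lt hr, (Nat.mod_le _ _).trans_lt hc,
      if_true]
  · intro b₁ b₂
    obtain ⟨e₁, e₂, e₃⟩ := prev_cell hm b₁ b₂
    have e : prevE.eval h = (i : ℤ) - ((2 ^ j * (2 ^ n + 1) : ℕ) : ℤ) := by
      simp only [h, prevE, Ex.eval, vars]; push_cast; ring
    rw [Ex.eval, e, Int.toNat_sub]
    simp only [h]
    rw [partFill_self, if_pos e₃, flat, if_pos (e₃.trans hi), e₁, e₂]
    exact hT' _ _ (bit_sub b₁) (bit_sub b₂)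

lemma eval_fstepE {k i j : ℕ} (hi : i < 2 ^ n * 2 ^ n) {T : ℕ → ℕ → ℤ}
    (hk : M k = flat (2 ^ n) T) (h3 : M 3 = fun c => if c < 2 ^ n then par c else 0) (hk3 : k ≠ 3) (j' : ℕ) :
    (fstepE k).eval ⟨varsAt n W w H i (2 ^ j : ℕ) j', A,
      partFill M k i (flat (2 ^ n) (fstep w j T))⟩ = flat (2 ^ n) (fstep w j T) i := by
  obtain ⟨e₁, e₂, e₃⟩ := eval_step_aux (W := W) (w := w) (H := H) (A := A) (j := j) hi hk h3 hk3 (j' := j')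
    (T' := fstep w j T) (fun r c hr hc => by simp only [fstep, if_neg hr, if_neg hc])
  rw [flat, if_pos hi]
  simp only [fstepE, Ex.eval, eval_bitE eval_rowE, eval_bitE eval_colE, Nat.cast_pos, vars] at e₁ e₂ e₃ ⊢
  rw [fstep]
  split_ifs with hr hc hc
  · rw [e₃ hr hc, e₂, e₁]
  · rw [e₁]
  · rw [e₁]
  · exact e₁

lemma eval_istepE {k i j : ℕ} (hi : i < 2 ^ n * 2 ^ n) {T : ℕ → ℕ → ℤ}
    (hk : M k = flat (2 ^ n) T) (h3 : M 3 = fun c => if c < 2 ^ n then par c else 0) (hk3 : k ≠ 3) (j' : ℕ) :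
    (istepE k).eval ⟨varsAt n W w H i (2 ^ j : ℕ) j', A,
      partFill M k i (flat (2 ^ n) (istep w j T))⟩ = flat (2 ^ n) (istep w j T) i := by
  obtain ⟨e₁, e₂, e₃⟩ := eval_step_aux (W := W) (w := w) (H := H) (A := A) (j := j) hi hk h3 hk3 (j' := j')
    (T' := istep w j T) (fun r c hr hc => by simp only [istep, if_neg hr, if_neg hc])
  rw [flat, if_pos hi]
  simp only [istepE, Ex.eval, eval_bitE eval_rowE, eval_bitE eval_colE, Nat.cast_pos, vars] at e₁ e₂ e₃ ⊢
  rw [istep]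
  split_ifs with hr hc hc
  · rw [e₃ hr hc, e₂, e₁]
  · rw [e₁]
  · rw [e₁]
  · exact e₁

end rounds

end NSC

/-! ### The loops for the two transformations, and the initialisation -/

namespace NSC

section transform
variable {n : ℕ} {W w H : ℤ} {L : ℕ} {A : ℕ → ℤ} {M : ℕ → ℕ → ℤ}

lemma Fits.two_le (F : Fits n W w H L) : 2 ≤ L := by
  have h : 1 ≤ 2 ^ n * 2 ^ n := Nat.mul_pos (by positivity) (by positivity)
  have := F.nat h
  have b1 : bitLen 1 = 2 := by simp [bitLen]
  rwa [Nat.cast_one, b1] at this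

lemma bitLen_par (c : ℕ) : bitLen (par c) = 2 := by
  have h := abs_par c
  rw [Int.abs_eq_natAbs] at h
  have h' : (par c).natAbs = 1 := by exact_mod_cast h
  simp [bitLen, h']

lemma Fits.parTab (F : Fits n W w H L) (a : ℕ) : bitLen (if a < 2 ^ n then par a else 0) ≤ L := by
  have := F.two_le
  split_ifs
  · rw [bitLen_par]; exact this
  · exact le_trans (by simp [bitLen]) F.one_le

/-- The transformation of the table in bank `k`. -/
def roundsProg (k : ℕ) : Prog :=
  .seq (asg 7 (.c 1)) (forLoop 8 0 (.seq (fill k (fstepE k)) (asg 7 (.add (.v 7) (.v 7)))))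

/-- The inverse transformation of the table in bank `k`. -/
def invRoundsProg (k : ℕ) : Prog :=
  .seq (asg 7 (.v 1)) (forLoop 8 0 (.seq (asg 7 (.div (.v 7) (.c 2))) (fill k (istepE k))))

def roundsCost (k : ℕ) : ℕ :=
  (Ex.c 1).cost + (Ex.c 1).size + (fillCost (fstepE k) +
    ((Ex.add (.v 7) (.v 7)).cost + (Ex.add (.v 7) (.v 7)).size) + 20)

def invRoundsCost (k : ℕ) : ℕ :=
  (Ex.v 1).cost + (Ex.v 1).size + (fillCost (istepE k) +
    ((Ex.div (.v 7) (.c 2)).cost + (Ex.div (.v 7) (.c 2)).size) + 20)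

lemma rounds_time (n L c₁ c₂ c₃ : ℕ) : c₁ * L ^ 2 +
    (n + 1) * (c₂ * (2 ^ n * 2 ^ n * L ^ 2) + c₃ * L ^ 2 + 20 * L ^ 2) ≤
      (c₁ + (c₂ + c₃ + 20)) * ((n + 1) * (2 ^ n * 2 ^ n * L ^ 2)) := by
  have h1 := asg_time n c₁ L
  have h2 := asg_time n c₃ L
  have h3 := asg_time n 20 L
  have h4 : 2 ^ n * 2 ^ n * L ^ 2 ≤ (n + 1) * (2 ^ n * 2 ^ n * L ^ 2) :=
    Nat.le_mul_of_pos_left _ (by omega)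
  set U := 2 ^ n * 2 ^ n * L ^ 2
  calc c₁ * L ^ 2 + (n + 1) * (c₂ * U + c₃ * L ^ 2 + 20 * L ^ 2)
      ≤ c₁ * ((n + 1) * U) + (n + 1) * (c₂ * U + c₃ * U + 20 * U) := by
        exact add_le_add (h1.trans (Nat.mul_le_mul_left _ h4))
          (Nat.mul_le_mul_left _ (add_le_add (add_le_add le_rfl h2) h3))
    _ = _ := by ring

/-- Variable 7 holds the place value 2^i in round i. The size bound `hB` is required for all
intermediate tables, as each round reads the one before. -/
lemma runs_rounds (F : Fits n W w H L) {k : ℕ} (hk3 : k ≠ 3) {T : ℕ → ℕ → ℤ}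
    (hk : M k = flat (2 ^ n) T) (h3 : M 3 = fun c => if c < 2 ^ n then par c else 0)
    (hB : ∀ i ≤ n, ∀ a, bitLen (flat (2 ^ n) (fiter w T i) a) ≤ L) {pw j : ℕ} :
    Runs (roundsProg k) ⟨varsAt n W w H (2 ^ n * 2 ^ n) pw j, A, M⟩
      (roundsCost k * ((n + 1) * (2 ^ n * 2 ^ n * L ^ 2)))
      ⟨varsAt n W w H (2 ^ n * 2 ^ n) (2 ^ n) n, A,
        Function.update M k (flat (2 ^ n) (fiter w T n))⟩ := by
  have hn : n ≤ 2 ^ n * 2 ^ n := Nat.lt_two_pow_self.le.trans (le_two_pow_mul_self n)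
  have hpw : ∀ i ≤ n, 2 ^ i ≤ 2 ^ n * 2 ^ n := fun i hi =>
    (Nat.pow_le_pow_right (by norm_num) hi).trans (le_two_pow_mul_self n)
  have r1 := runs_asg F.one_le 7 (.c 1) (h := ⟨varsAt n W w H (2 ^ n * 2 ^ n : ℕ) pw j, A, M⟩) trivial
  simp only [vars_update_7, Ex.eval] at r1
  let hs (i : ℕ) : View := ⟨varsAt n W w H (2 ^ n * 2 ^ n : ℕ) (2 ^ i : ℕ) 0, A,
    Function.update M k (flat (2 ^ n) (fiter w T i))⟩
  have hset : ∀ i j : ℕ, (hs i).set 8 j = ⟨varsAt n W w H (2 ^ n * 2 ^ n : ℕ) (2 ^ i : ℕ) j, A,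
    Function.update M k (flat (2 ^ n) (fiter w T i))⟩ := by
    intro i j
    simp only [hs, View.set, vars_update_8]
  have r2 := runs_forLoop (L := L) F.one_le (x := 8) (y := 0) (by norm_num) (m := n) hs
    (body := .seq (fill k (fstepE k)) (asg 7 (.add (.v 7) (.v 7))))
    (h := ⟨vars n (2 ^ n : ℕ) (2 ^ n * 2 ^ n : ℕ) W w H (2 ^ n * 2 ^ n : ℕ) 1 j, A, M⟩)
    (T := fillCost (fstepE k) * (2 ^ n * 2 ^ n * L ^ 2) +
      ((Ex.add (.v 7) (.v 7)).cost + (Ex.add (.v 7) (.v 7)).size) * L ^ 2)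
    (fun i _ => rfl) (F.nat hn) ?_ ?_
  · have := r1.seq r2
    rw [hset] at this
    exact this.mono (rounds_time n L _ _ _)
  · intro i hi
    rw [hset, hset]
    have hMk : Function.update M k (flat (2 ^ n) (fiter w T i)) k = flat (2 ^ n) (fiter w T i) :=
      Function.update_self _ _ _
    have hM3 : Function.update M k (flat (2 ^ n) (fiter w T i)) 3 =
      fun c => if c < 2 ^ n then par c else 0 := by rw [Function.update_of_ne hk3.symm, h3]
    have f := runs_fill_of_banks F (k := k) (e := fstepE k) (a := 2 ^ n * 2 ^ n) (pw := 2 ^ i) (j := i)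
      (hpw i hi.le) (hi.le.trans hn) (A := A) (M := Function.update M k (flat (2 ^ n) (fiter w T i)))
      (flat (2 ^ n) (fiter w T (i + 1)))
      (fun a ha => eval_fstepE ha hMk hM3 hk3 i)
      (fun l => l = k ∨ l = 3)
      (by simp [fstepE, signE, prevE, bitE, lowE, rowE, colE, Ex.mod, Ex.Banks])
      (by
        rintro l (rfl | rfl) a
        · rw [hMk]; exact hB i hi.le a
        · rw [hM3]; exact F.parTab a)
      (fun a _ => hB (i + 1) hi a)
    rw [partFill_flat hMk, Function.update_idem] at f
    refine f.seq ?_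
    have g := runs_asg F.one_le 7 (.add (.v 7) (.v 7)) (h := ⟨varsAt n W w H (2 ^ n * 2 ^ n : ℕ) (2 ^ i : ℕ) i, A,
      Function.update M k (flat (2 ^ n) (fiter w T (i + 1)))⟩) ⟨F.nat (hpw i hi.le), F.nat (hpw i hi.le)⟩
    simp only [vars_update_7, Ex.eval] at g
    convert g using 3
    simp only [vars]; push_cast; ring
  · simp only [hs, View.set, vars_update_8, fiter, ← hk, Function.update_eq_self, pow_zero, Nat.cast_one]

/-- The place value starts at 2^n and is halved before the filling, because round i treats bit n - 1
- i. -/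
lemma runs_invRounds (F : Fits n W w H L) {k : ℕ} (hk3 : k ≠ 3) {T : ℕ → ℕ → ℤ}
    (hk : M k = flat (2 ^ n) T) (h3 : M 3 = fun c => if c < 2 ^ n then par c else 0)
    (hB : ∀ i ≤ n, ∀ a, bitLen (flat (2 ^ n) (iiter w n T i) a) ≤ L) {pw j : ℕ} :
    Runs (invRoundsProg k) ⟨varsAt n W w H (2 ^ n * 2 ^ n) pw j, A, M⟩
      (invRoundsCost k * ((n + 1) * (2 ^ n * 2 ^ n * L ^ 2)))
      ⟨varsAt n W w H (2 ^ n * 2 ^ n) 1 n, A,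
        Function.update M k (flat (2 ^ n) (iiter w n T n))⟩ := by
  have hn : n ≤ 2 ^ n * 2 ^ n := Nat.lt_two_pow_self.le.trans (le_two_pow_mul_self n)
  have hpw : ∀ i, 2 ^ (n - i) ≤ 2 ^ n * 2 ^ n := fun i =>
    (Nat.pow_le_pow_right (by norm_num) (Nat.sub_le n i)).trans (le_two_pow_mul_self n)
  have r1 := runs_asg F.one_le 7 (.v 1) (h := ⟨varsAt n W w H (2 ^ n * 2 ^ n : ℕ) pw j, A, M⟩)
    (F.nat (hpw 0))
  simp only [vars_update_7, Ex.eval] at r1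
  let hs (i : ℕ) : View := ⟨varsAt n W w H (2 ^ n * 2 ^ n : ℕ) (2 ^ (n - i) : ℕ) 0, A,
    Function.update M k (flat (2 ^ n) (iiter w n T i))⟩
  have hset : ∀ i j : ℕ, (hs i).set 8 j = ⟨varsAt n W w H (2 ^ n * 2 ^ n : ℕ) (2 ^ (n - i) : ℕ) j, A,
    Function.update M k (flat (2 ^ n) (iiter w n T i))⟩ := by
    intro i j
    simp only [hs, View.set, vars_update_8]
  have r2 := runs_forLoop (L := L) F.one_le (x := 8) (y := 0) (by norm_num) (m := n) hs
    (body := .seq (asg 7 (.div (.v 7) (.c 2))) (fill k (istepE k)))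
    (h := ⟨vars n (2 ^ n : ℕ) (2 ^ n * 2 ^ n : ℕ) W w H (2 ^ n * 2 ^ n : ℕ) (2 ^ n : ℕ) j, A, M⟩)
    (T := fillCost (istepE k) * (2 ^ n * 2 ^ n * L ^ 2) +
      ((Ex.div (.v 7) (.c 2)).cost + (Ex.div (.v 7) (.c 2)).size) * L ^ 2)
    (fun i _ => rfl) (F.nat hn) ?_ ?_
  · have := r1.seq r2
    rw [hset] at this
    simp only [Nat.sub_self, pow_zero] at this
    exact this.mono (rounds_time n L _ _ _)
  · intro i hi
    rw [hset, hset]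
    have hMk : Function.update M k (flat (2 ^ n) (iiter w n T i)) k = flat (2 ^ n) (iiter w n T i) :=
      Function.update_self _ _ _
    have hM3 : Function.update M k (flat (2 ^ n) (iiter w n T i)) 3 =
      fun c => if c < 2 ^ n then par c else 0 := by rw [Function.update_of_ne hk3.symm, h3]
    have hsub : n - (i + 1) = n - 1 - i := by omega
    have f := runs_fill_of_banks F (k := k) (e := istepE k) (a := 2 ^ n * 2 ^ n)
      (pw := 2 ^ (n - 1 - i)) (j := i)
      (hsub ▸ hpw (i + 1)) (hi.le.trans hn) (A := A)
      (M := Function.update M k (flat (2 ^ n) (iiter w n T i)))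
      (flat (2 ^ n) (iiter w n T (i + 1)))
      (fun a ha => eval_istepE ha hMk hM3 hk3 i)
      (fun l => l = k ∨ l = 3)
      (by simp [istepE, signE, prevE, bitE, lowE, rowE, colE, Ex.mod, Ex.Banks])
      (by
        rintro l (rfl | rfl) a
        · rw [hMk]; exact hB i hi.le a
        · rw [hM3]; exact F.parTab a)
      (fun a _ => hB (i + 1) hi a)
    rw [partFill_flat hMk, Function.update_idem] at f
    have g := runs_asg F.one_le 7 (.div (.v 7) (.c 2)) (h := ⟨varsAt n W w H (2 ^ n * 2 ^ n : ℕ)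
      (2 ^ (n - i) : ℕ) i, A,
      Function.update M k (flat (2 ^ n) (iiter w n T i))⟩) ⟨F.nat (hpw i), trivial⟩
    have hdiv : ((2 ^ (n - i) : ℕ) : ℤ) / 2 = ((2 ^ (n - 1 - i) : ℕ) : ℤ) := by
      have : n - i = n - 1 - i + 1 := by omega
      rw [this, pow_succ]; push_cast; simp
    simp only [vars_update_7, Ex.eval] at g
    rw [show varsAt n W w H (2 ^ n * 2 ^ n) (2 ^ (n - i)) i 7 =
      ((2 ^ (n - i) : ℕ) : ℤ) from rfl, hdiv] at g
    rw [hsub]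
    exact (g.seq f).mono (by rw [add_comm])
  · simp only [hs, View.set, vars_update_8, iiter, ← hk, Function.update_eq_self, Nat.sub_zero]

end transform

/-! ### The initialisation -/

/-- The sum of the squares of table entries, plus one. -/
def sumSq (t₀ t₁ : ℕ → ℤ) (m : ℕ) : ℤ := 1 + ∑ a ∈ Finset.range m, (t₀ a * t₀ a + t₁ a * t₁ a)

lemma one_le_sumSq (t₀ t₁ : ℕ → ℤ) (m : ℕ) : 1 ≤ sumSq t₀ t₁ m := by
  have : 0 ≤ ∑ a ∈ Finset.range m, (t₀ a * t₀ a + t₁ a * t₁ a) :=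
    Finset.sum_nonneg fun a _ => add_nonneg (mul_self_nonneg _) (mul_self_nonneg _)
  unfold sumSq; omega

lemma sumSq_mono (t₀ t₁ : ℕ → ℤ) {m m' : ℕ} (h : m ≤ m') : sumSq t₀ t₁ m ≤ sumSq t₀ t₁ m' := by
  unfold sumSq
  have := Finset.sum_le_sum_of_subset_of_nonneg (Finset.range_mono h)
    (f := fun a => t₀ a * t₀ a + t₁ a * t₁ a)
    fun a _ _ => add_nonneg (mul_self_nonneg _) (mul_self_nonneg _)
  omega

/-- Compute the powers of two. -/
def initPow : Prog :=
  .seq (asg 1 (.c 1)) (.seq (forLoop 6 0 (asg 1 (.add (.v 1) (.v 1)))) (asg 2 (.mul (.v 1) (.v 1))))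

def sqE : Ex :=
  .add (.v 3) (.add (.mul (.ld 0 (.v 6)) (.ld 0 (.v 6))) (.mul (.ld 1 (.v 6)) (.ld 1 (.v 6))))

/-- Compute the parameters that depend on the size of the table entries. -/
def initSize : Prog :=
  .seq (asg 3 (.c 1)) (.seq (forLoop 6 2 (asg 3 sqE))
    (.seq (asg 5 (.mul (.v 2) (.mul (.v 3) (.v 3)))) (asg 4 (.add (.add (.v 5) (.v 5)) (.c 1)))))

def parE : Ex :=
  .ite (.v 6) (.mul (.ld 3 (.div (.v 6) (.c 2)))
    (.sub (.c 1) (.mul (.c 2) (.mod (.v 6) (.c 2))))) (.c 1)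

/-- Compute the table of signs. -/
def initPar : Prog := forLoop 6 1 (sto 3 (.v 6) parE)

section init
variable {n : ℕ} {W w H : ℤ} {L : ℕ} {A : ℕ → ℤ} {M : ℕ → ℕ → ℤ}

lemma bitLen_zero_le (hL : 1 ≤ L) : bitLen 0 ≤ L := le_trans (by simp [bitLen]) hL

def initPowCost : ℕ := (Ex.c 1).cost + (Ex.c 1).size +
  (((Ex.add (.v 1) (.v 1)).cost + (Ex.add (.v 1) (.v 1)).size + 22) +
    ((Ex.mul (.v 1) (.v 1)).cost + (Ex.mul (.v 1) (.v 1)).size))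

lemma runs_initPow (hL : bitLen ((2 ^ n * 2 ^ n : ℕ) : ℤ) ≤ L) :
    Runs initPow ⟨vars n 0 0 0 0 0 0 0 0, A, M⟩ (initPowCost * (2 ^ n * 2 ^ n * L ^ 2))
      ⟨vars n (2 ^ n : ℕ) (2 ^ n * 2 ^ n : ℕ) 0 0 0 n 0 0, A, M⟩ := by
  have hL1 : 1 ≤ L := (one_le_bitLen _).trans hL
  have hz := bitLen_zero_le hL1
  have hN : ∀ i ≤ n, bitLen ((2 ^ i : ℕ) : ℤ) ≤ L := fun i hi =>
    bitLen_nat_le ((Nat.pow_le_pow_right (by norm_num) hi).trans (le_two_pow_mul_self n)) hL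
  have hnN : n + 1 ≤ 2 ^ n := Nat.lt_two_pow_self
  have hi : ∀ i ≤ n, bitLen (i : ℤ) ≤ L := fun i hi => bitLen_nat_le (by omega) (hN n le_rfl)
  have r1 := runs_asg hL1 1 (.c 1) (h := ⟨vars n 0 0 0 0 0 0 0 0, A, M⟩) trivial
  simp only [vars_update_1, Ex.eval] at r1
  have r2 := runs_foldLoop hL1 (x := 6) (y := 0) (r := 1) (by norm_num) (by norm_num) (by norm_num)
    (e := .add (.v 1) (.v 1)) (m := n) (V := vars n 1 0 0 0 0 0 0 0) (A := A) (M := M)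
    (fun i => ((2 ^ i : ℕ) : ℤ)) rfl (by simp [vars]) (hi n le_rfl)
    (by
      intro i _
      simp only [vars_update_1, vars_update_6, Ex.eval, vars]; push_cast; ring)
    (by
      intro i hin
      simp only [vars_update_1, vars_update_6]
      exact ⟨hN i hin.le, hN i hin.le⟩)
  simp only [vars_update_1, vars_update_6] at r2
  have r3 := runs_asg hL1 2 (.mul (.v 1) (.v 1)) (h := ⟨vars n (2 ^ n : ℕ) 0 0 0 0 n 0 0, A, M⟩)
    ⟨hN n le_rfl, hN n le_rfl⟩
  simp only [vars_update_2, Ex.eval] at r3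
  have e : vars n (2 ^ n : ℕ) 0 0 0 0 n 0 0 1 * vars n (2 ^ n : ℕ) 0 0 0 0 n 0 0 1 =
      ((2 ^ n * 2 ^ n : ℕ) : ℤ) := by simp only [vars]; push_cast; ring
  rw [e] at r3
  refine (r1.seq (r2.seq r3)).mono ?_
  have h1 := asg_time n ((Ex.c 1).cost + (Ex.c 1).size) L
  have h3 := asg_time n ((Ex.mul (.v 1) (.v 1)).cost + (Ex.mul (.v 1) (.v 1)).size) L
  have h2 : (n + 1) * (((Ex.add (.v 1) (.v 1)).cost + (Ex.add (.v 1) (.v 1)).size + 22) * L ^ 2) ≤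
      ((Ex.add (.v 1) (.v 1)).cost + (Ex.add (.v 1) (.v 1)).size + 22) * (2 ^ n * 2 ^ n * L ^ 2) := by
    rw [mul_left_comm]
    gcongr
    exact hnN.trans (le_two_pow_mul_self n)
  unfold initPowCost
  rw [add_mul _ _ (2 ^ n * 2 ^ n * L ^ 2), add_mul (_ + 22) _ (2 ^ n * 2 ^ n * L ^ 2)]
  exact add_le_add h1 (add_le_add h2 h3)

def initSizeCost : ℕ := (Ex.c 1).cost + (Ex.c 1).size + (2 * (sqE.cost + sqE.size + 22) +
  (((Ex.mul (.v 2) (.mul (.v 3) (.v 3))).cost + (Ex.mul (.v 2) (.mul (.v 3) (.v 3))).size) +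
  ((Ex.add (.add (.v 5) (.v 5)) (.c 1)).cost + (Ex.add (.add (.v 5) (.v 5)) (.c 1)).size)))

/-- The bit bound b is not part of the input, so the program derives a bound W from the tables.
Squares dispense with absolute values and cost only a constant factor in length. -/
lemma runs_initSize (hW : W = sumSq (M 0) (M 1) (2 ^ n * 2 ^ n))
    (hH : H = (2 ^ n * 2 ^ n : ℕ) * (W * W)) (hw : w = H + H + 1) (F : Fits n W w H L)
    (h0 : ∀ a, bitLen (M 0 a) ≤ L) (h1 : ∀ a, bitLen (M 1 a) ≤ L) :
    Runs initSize ⟨vars n (2 ^ n : ℕ) (2 ^ n * 2 ^ n : ℕ) 0 0 0 n 0 0, A, M⟩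
      (initSizeCost * (2 ^ n * 2 ^ n * L ^ 2))
      ⟨varsAt n W w H (2 ^ n * 2 ^ n) 0 0, A, M⟩ := by
  have hL1 := F.one_le
  have r1 := runs_asg hL1 3 (.c 1)
    (h := ⟨vars n (2 ^ n : ℕ) (2 ^ n * 2 ^ n : ℕ) 0 0 0 n 0 0, A, M⟩) trivial
  simp only [vars_update_3, Ex.eval] at r1
  have hacc : ∀ i ≤ 2 ^ n * 2 ^ n, bitLen (sumSq (M 0) (M 1) i) ≤ L := fun i hi => by
    refine (bitLen_mono ?_).trans F.W
    have := one_le_sumSq (M 0) (M 1) i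
    have := sumSq_mono (M 0) (M 1) hi
    rw [← hW] at this
    omega
  have r2 := runs_foldLoop hL1 (x := 6) (y := 2) (r := 3) (by norm_num) (by norm_num) (by norm_num)
    (e := sqE) (m := 2 ^ n * 2 ^ n) (V := vars n (2 ^ n : ℕ) (2 ^ n * 2 ^ n : ℕ) 1 0 0 n 0 0)
    (A := A) (M := M) (sumSq (M 0) (M 1)) rfl (by simp [vars, sumSq]) F.NN
    (by
      intro i _
      simp only [vars_update_3, vars_update_6, sqE, Ex.eval, vars, Int.toNat_natCast, sumSq,
        Finset.sum_range_succ]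
      ring)
    (by
      intro i hi
      simp only [vars_update_3, vars_update_6, sqE, Ex.Reads, vars, h0, h1, F.nat hi.le, hacc i hi.le,
        and_self])
  simp only [vars_update_3, vars_update_6, ← hW] at r2
  have r3 := runs_asg hL1 5 (.mul (.v 2) (.mul (.v 3) (.v 3)))
    (h := ⟨vars n (2 ^ n : ℕ) (2 ^ n * 2 ^ n : ℕ) W 0 0 (2 ^ n * 2 ^ n : ℕ) 0 0, A, M⟩)
    ⟨F.NN, F.W, F.W⟩
  simp only [vars_update_5, Ex.eval] at r3
  simp only [vars, ← hH] at r3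
  have r4 := runs_asg hL1 4 (.add (.add (.v 5) (.v 5)) (.c 1))
    (h := ⟨vars n (2 ^ n : ℕ) (2 ^ n * 2 ^ n : ℕ) W 0 H (2 ^ n * 2 ^ n : ℕ) 0 0, A, M⟩)
    ⟨⟨F.H, F.H⟩, trivial⟩
  simp only [vars_update_4, Ex.eval] at r4
  simp only [vars, ← hw] at r4
  refine (r1.seq (r2.seq (r3.seq r4))).mono ?_
  unfold initSizeCost
  simp only [add_mul _ _ (2 ^ n * 2 ^ n * L ^ 2)]
  have t1 := asg_time n ((Ex.c 1).cost + (Ex.c 1).size) L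
  have t2 := fill_time n (sqE.cost + sqE.size + 22) L
  have t3 := asg_time n ((Ex.mul (.v 2) (.mul (.v 3) (.v 3))).cost + (Ex.mul (.v 2) (.mul (.v 3) (.v 3))).size) L
  have t4 := asg_time n ((Ex.add (.add (.v 5) (.v 5)) (.c 1)).cost + (Ex.add (.add (.v 5) (.v 5)) (.c 1)).size) L
  have := add_le_add t1 (add_le_add t2 (add_le_add t3 t4))
  simpa only [add_mul _ _ (2 ^ n * 2 ^ n * L ^ 2)] using this

/-- Filling in increasing order makes the sign of i / 2 available when cell i > 0 is computed; cell
0 is the base case of the recursion. -/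
lemma runs_initPar (F : Fits n W w H L) (h3 : M 3 = fun _ => 0) :
    Runs initPar ⟨varsAt n W w H (2 ^ n * 2 ^ n) 0 0, A, M⟩
      (fillCost parE * (2 ^ n * 2 ^ n * L ^ 2))
      ⟨varsAt n W w H (2 ^ n) 0 0, A, Function.update M 3 fun c => if c < 2 ^ n then par c else 0⟩ := by
  have hN := le_two_pow_mul_self n
  have := runs_mapLoop (L := L) F.one_le (x := 6) (y := 1) (k := 3) (by norm_num) (e := parE)
    (m := 2 ^ n) (V := varsAt n W w H (2 ^ n * 2 ^ n) 0 0) (A := A) (M := M) par rfl (F.nat hN)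
    (by
      intro i hi
      have key : (Ex.ld 3 (.div (.v 6) (.c 2))).eval ⟨varsAt n W w H i 0 0, A,
          partFill M 3 i par⟩ = if i / 2 < i then par (i / 2) else 0 := by
        have : (Ex.div (.v 6) (.c 2)).eval ⟨varsAt n W w H i 0 0, A, partFill M 3 i par⟩ =
            ((i / 2 : ℕ) : ℤ) := by simp only [Ex.eval, vars]; norm_cast
        rw [Ex.eval, this, Int.toNat_natCast]
        simp only [partFill_self, h3]
      have mod : (Ex.mod (.v 6) (.c 2)).eval ⟨varsAt n W w H i 0 0, A, partFill M 3 i par⟩ =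
            ((i % 2 : ℕ) : ℤ) := by simp only [Ex.eval_mod, Ex.eval, vars]; norm_cast
      change parE.eval ⟨Function.update (varsAt n W w H (2 ^ n * 2 ^ n) 0 0) 6 i, A, partFill M 3 i par⟩ = _
      simp only [vars_update_6]
      rw [parE, Ex.eval]
      change (if 0 < (i : ℤ) then
        (Ex.ld 3 (.div (.v 6) (.c 2))).eval ⟨varsAt n W w H i 0 0, A, partFill M 3 i par⟩ *
          (1 - 2 * (Ex.mod (.v 6) (.c 2)).eval ⟨varsAt n W w H i 0 0, A, partFill M 3 i par⟩)
        else 1) = _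
      rw [key, mod]
      split_ifs with hpos hlt
      · exact (par_eq i).symm
      · omega
      · obtain rfl : i = 0 := by omega
        simp [par])
    (by
      intro i hi
      simp only [vars_update_6]
      refine Ex.reads_of_banks (K := fun l => l = 3)
        (F.vars (hi.le.trans hN) (Nat.zero_le _) (Nat.zero_le _)) ?_ _ (by simp [parE, Ex.mod, Ex.Banks])
      rintro l rfl a
      change bitLen (partFill M 3 i par 3 a) ≤ L
      rw [partFill_self, h3]
      split_ifs
      · rw [bitLen_par]; exact F.two_le
      · exact bitLen_zero_le F.one_le)
  simp only [vars_update_6] at this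
  rw [h3] at this
  refine this.mono ((Nat.mul_le_mul_right _ ?_).trans (fill_time n _ L))
  omega

/-- The weighted tables. -/
def preLE : Ex := .mul (.ld 0 (.v 6)) (.add (.c 1) (.mul (.mul (.ld 3 rowE) (.ld 3 colE)) (.v 4)))
def preRE : Ex := .mul (.ld 1 (.v 6)) (.ite (.ld 3 rowE) (.v 4) (.c 1))

lemma eval_preLE {i k : ℕ} (hi : i < 2 ^ n * 2 ^ n) {new : ℕ → ℤ}
    (h3 : M 3 = fun c => if c < 2 ^ n then par c else 0) (hk3 : k ≠ 3) (hk0 : k ≠ 0) :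
    preLE.eval ⟨varsAt n W w H i 0 0, A, partFill M k i new⟩ = flat (2 ^ n) (preL n w (M 0)) i := by
  have hm : 0 < 2 ^ n := by positivity
  have hr : i / 2 ^ n < 2 ^ n := Nat.div_lt_of_lt_mul hi
  have hc : i % 2 ^ n < 2 ^ n := Nat.mod_lt _ hm
  simp only [preLE, Ex.eval, eval_rowE, eval_colE, Int.toNat_natCast, partFill_of_ne _ _ _ hk3.symm,
    partFill_of_ne _ _ _ hk0.symm, h3, hr, hc, if_true, vars, flat, if_pos hi, preL, Nat.div_add_mod']

lemma eval_preRE {i k : ℕ} (hi : i < 2 ^ n * 2 ^ n) {new : ℕ → ℤ}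
    (h3 : M 3 = fun c => if c < 2 ^ n then par c else 0) (hk3 : k ≠ 3) (hk1 : k ≠ 1) :
    preRE.eval ⟨varsAt n W w H i 0 0, A, partFill M k i new⟩ = flat (2 ^ n) (preR n w (M 1)) i := by
  have hr : i / 2 ^ n < 2 ^ n := Nat.div_lt_of_lt_mul hi
  simp only [preRE, Ex.eval, eval_rowE, Int.toNat_natCast, partFill_of_ne _ _ _ hk3.symm,
    partFill_of_ne _ _ _ hk1.symm, h3, hr, if_true, vars, flat, if_pos hi, preR, Nat.div_add_mod']

end init

end NSC

/-! ### Assembling the program around the matrix multiplication -/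

namespace NSC

/-- Centred remainder of the rounded quotient, the expression form of `extract`. -/
def extractE : Ex := .sub (.mod (.add (.div (.add (.ld 2 (.v 6)) (.v 5)) (.v 4)) (.v 5)) (.v 4)) (.v 5)

/-- The first part of the program: the input of the matrix multiplication. -/
def prepProg : Prog :=
  .seq initPow (.seq initSize (.seq initPar (.seq (fill 4 preLE) (.seq (fill 5 preRE)
    (.seq (roundsProg 4) (roundsProg 5))))))

/-- The last part of the program: from the matrix product to the result. -/
def postProg : Prog := .seq (fill 2 (.ld 6 (.v 6))) (.seq (invRoundsProg 2) (fill 2 extractE))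

/-- The two-set non-commutative subset convolution, by means of a program for matrix
multiplication. -/
def nscProg (P : Prog) : Prog := .seq prepProg (.seq (.copy 2 3) (.seq (subroutine P) postProg))

def prepCost : ℕ := initPowCost + (initSizeCost + (fillCost parE + (fillCost preLE + (fillCost preRE +
  (roundsCost 4 + roundsCost 5)))))

def postCost : ℕ := fillCost (.ld 6 (.v 6)) + (invRoundsCost 2 + fillCost extractE)

section prog
variable {n : ℕ} {W w H : ℤ} {L : ℕ} {A : ℕ → ℤ} {M : ℕ → ℕ → ℤ}

lemma partFill_full {k m : ℕ} {T : ℕ → ℕ → ℤ} (hk : M k = fun _ => 0) :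
    partFill M k (m * m) (flat m T) = Function.update M k (flat m T) := by
  apply partFill_flat (T := fun _ _ => 0)
  rw [hk]; ext a; simp [flat]

/-- Banks 4 and 5 are banks 0 and 1 of the subroutine, so the transformed tables are produced where
it expects its input. -/
lemma runs_prep (hW : W = sumSq (M 0) (M 1) (2 ^ n * 2 ^ n))
    (hH : H = (2 ^ n * 2 ^ n : ℕ) * (W * W)) (hw : w = H + H + 1) (F : Fits n W w H L)
    (h0 : ∀ a, bitLen (M 0 a) ≤ L) (h1 : ∀ a, bitLen (M 1 a) ≤ L) (h3 : M 3 = fun _ => 0)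
    (h4 : M 4 = fun _ => 0) (h5 : M 5 = fun _ => 0)
    (hL : ∀ i ≤ n, ∀ a, bitLen (flat (2 ^ n) (fiter w (preL n w (M 0)) i) a) ≤ L)
    (hR : ∀ i ≤ n, ∀ a, bitLen (flat (2 ^ n) (fiter w (preR n w (M 1)) i) a) ≤ L) :
    Runs prepProg ⟨vars n 0 0 0 0 0 0 0 0, A, M⟩ (prepCost * ((n + 1) * (2 ^ n * 2 ^ n * L ^ 2)))
      ⟨varsAt n W w H (2 ^ n * 2 ^ n) (2 ^ n) n, A,
        Function.update (Function.update (Function.update M 3 fun c => if c < 2 ^ n then par c else 0)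
          4 (flat (2 ^ n) (fiter w (preL n w (M 0)) n)))
          5 (flat (2 ^ n) (fiter w (preR n w (M 1)) n))⟩ := by
  set U := (n + 1) * (2 ^ n * 2 ^ n * L ^ 2) with hU
  have hle : ∀ c, c * (2 ^ n * 2 ^ n * L ^ 2) ≤ c * U := fun c =>
    Nat.mul_le_mul_left _ (Nat.le_mul_of_pos_left _ (by omega))
  have r1 := (runs_initPow (A := A) (M := M) F.NN).mono (hle _)
  have r2 := (runs_initSize (A := A) (M := M) hW hH hw F h0 h1).mono (hle _)
  have r3 := (runs_initPar (A := A) (M := M) F h3).mono (hle _)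
  set M₃ := Function.update M 3 fun c => if c < 2 ^ n then par c else 0 with hM₃
  have p3 : M₃ 3 = fun c => if c < 2 ^ n then par c else 0 := Function.update_self _ _ _
  have q3 : ∀ k, k ≠ 3 → M₃ k = M k := fun k hk => Function.update_of_ne hk _ _
  have r4 := (runs_fill_of_banks (k := 4) (e := preLE) (a := 2 ^ n) (pw := 0) (j := 0) (A := A)
    (M := M₃) F (Nat.zero_le _) (Nat.zero_le _) (flat (2 ^ n) (preL n w (M 0)))
    (fun i hi => by
      rw [eval_preLE hi p3 (by norm_num) (by norm_num), q3 0 (by norm_num)])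
    (fun l => l = 0 ∨ l = 3) (by simp [preLE, rowE, colE, Ex.mod, Ex.Banks])
    (by
      rintro l (rfl | rfl) a
      · rw [q3 0 (by norm_num)]; exact h0 a
      · rw [p3]; exact F.parTab a)
    (fun i _ => hL 0 (Nat.zero_le _) i)).mono (hle _)
  rw [partFill_full (by rw [q3 4 (by norm_num), h4])] at r4
  set M₄ := Function.update M₃ 4 (flat (2 ^ n) (preL n w (M 0))) with hM₄
  have p4 : M₄ 4 = flat (2 ^ n) (preL n w (M 0)) := Function.update_self _ _ _
  have q4 : ∀ k, k ≠ 4 → M₄ k = M₃ k := fun k hk => Function.update_of_ne hk _ _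
  have r5 := (runs_fill_of_banks (k := 5) (e := preRE) (a := 2 ^ n * 2 ^ n) (pw := 0) (j := 0) (A := A)
    (M := M₄) F (Nat.zero_le _) (Nat.zero_le _) (flat (2 ^ n) (preR n w (M 1)))
    (fun i hi => by
      rw [eval_preRE hi (by rw [q4 3 (by norm_num), p3]) (by norm_num) (by norm_num),
        q4 1 (by norm_num), q3 1 (by norm_num)])
    (fun l => l = 1 ∨ l = 3) (by simp [preRE, rowE, Ex.Banks])
    (by
      rintro l (rfl | rfl) a
      · rw [q4 1 (by norm_num), q3 1 (by norm_num)]; exact h1 a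
      · rw [q4 3 (by norm_num), p3]; exact F.parTab a)
    (fun i _ => hR 0 (Nat.zero_le _) i)).mono (hle _)
  rw [partFill_full (by rw [q4 5 (by norm_num), q3 5 (by norm_num), h5])] at r5
  set M₅ := Function.update M₄ 5 (flat (2 ^ n) (preR n w (M 1))) with hM₅
  have p5 : M₅ 5 = flat (2 ^ n) (preR n w (M 1)) := Function.update_self _ _ _
  have q5 : ∀ k, k ≠ 5 → M₅ k = M₄ k := fun k hk => Function.update_of_ne hk _ _
  have r6 := runs_rounds F (k := 4) (M := M₅) (A := A) (T := preL n w (M 0)) (by norm_num)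
    (by rw [q5 4 (by norm_num), p4]) (by rw [q5 3 (by norm_num), q4 3 (by norm_num), p3]) hL
    (pw := 0) (j := 0)
  set M₆ := Function.update M₅ 4 (flat (2 ^ n) (fiter w (preL n w (M 0)) n)) with hM₆
  have q6 : ∀ k, k ≠ 4 → M₆ k = M₅ k := fun k hk => Function.update_of_ne hk _ _
  have r7 := runs_rounds F (k := 5) (M := M₆) (A := A) (T := preR n w (M 1)) (by norm_num)
    (by rw [q6 5 (by norm_num), p5])
    (by rw [q6 3 (by norm_num), q5 3 (by norm_num), q4 3 (by norm_num), p3]) hR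
    (pw := 2 ^ n) (j := n)
  have hM : Function.update M₆ 5 (flat (2 ^ n) (fiter w (preR n w (M 1)) n)) =
      Function.update (Function.update M₃ 4 (flat (2 ^ n) (fiter w (preL n w (M 0)) n)))
        5 (flat (2 ^ n) (fiter w (preR n w (M 1)) n)) := by
    ext k : 1
    by_cases hk5 : k = 5
    · subst hk5; rw [Function.update_self, Function.update_self]
    · by_cases hk4 : k = 4
      · subst hk4
        rw [Function.update_of_ne hk5, Function.update_of_ne hk5, hM₆, Function.update_self,
          Function.update_self]
      · rw [Function.update_of_ne hk5, Function.update_of_ne hk5, q6 k hk4, q5 k hk5, q4 k hk4,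
          Function.update_of_ne hk4]
  rw [hM] at r7
  refine (r1.seq (r2.seq (r3.seq (r4.seq (r5.seq (r6.seq r7)))))).mono (le_of_eq ?_)
  rw [← hU]
  unfold prepCost
  simp only [add_mul _ _ U]

/-- Bank 6 is the output bank of the subroutine. Nothing is known about its cells beyond the
product, so `h6` is restricted and the product is copied into the clean bank 2, where bounds on the
whole bank hold. -/
lemma runs_post (F : Fits n W w H L) {T : ℕ → ℕ → ℤ} (h2 : M 2 = fun _ => 0)
    (h3 : M 3 = fun c => if c < 2 ^ n then par c else 0)
    (h6 : ∀ i < 2 ^ n * 2 ^ n, M 6 i = flat (2 ^ n) T i)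
    (hB : ∀ i ≤ n, ∀ a, bitLen (flat (2 ^ n) (iiter w n T i) a) ≤ L)
    (hE : ∀ a, bitLen (flat (2 ^ n) (fun r c => extract H w (iiter w n T n r c)) a) ≤ L)
    {pw j : ℕ} (hpw : pw ≤ 2 ^ n * 2 ^ n) (hj : j ≤ 2 ^ n * 2 ^ n) :
    ∃ h', Runs postProg ⟨varsAt n W w H (2 ^ n * 2 ^ n) pw j, A, M⟩
      (postCost * ((n + 1) * (2 ^ n * 2 ^ n * L ^ 2))) h' ∧
      h'.mem 2 = flat (2 ^ n) (fun r c => extract H w (iiter w n T n r c)) := by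
  set U := (n + 1) * (2 ^ n * 2 ^ n * L ^ 2) with hU
  have hle : ∀ c, c * (2 ^ n * 2 ^ n * L ^ 2) ≤ c * U := fun c =>
    Nat.mul_le_mul_left _ (Nat.le_mul_of_pos_left _ (by omega))
  have hn : n ≤ 2 ^ n * 2 ^ n := Nat.lt_two_pow_self.le.trans (le_two_pow_mul_self n)
  have hev : ∀ i < 2 ^ n * 2 ^ n, (Ex.ld 6 (.v 6)).eval ⟨varsAt n W w H i pw j, A,
      partFill M 2 i (flat (2 ^ n) T)⟩ = flat (2 ^ n) T i := fun i hi => by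
    simp only [Ex.eval, vars, Int.toNat_natCast]
    rw [partFill_of_ne _ _ _ (by norm_num), h6 i hi]
  have r1 := (runs_fill (k := 2) (e := .ld 6 (.v 6)) (a := 2 ^ n * 2 ^ n) (pw := pw) (j := j) (A := A)
    (M := M) F (flat (2 ^ n) T) hev
    (fun i hi => ⟨F.vars hi.le hpw hj 6, by
      rw [← Ex.eval, hev i hi]; exact hB 0 (Nat.zero_le _) i⟩)).mono (hle _)
  rw [partFill_full h2] at r1
  set M₁ := Function.update M 2 (flat (2 ^ n) T) with hM₁
  have p1 : M₁ 2 = flat (2 ^ n) T := Function.update_self _ _ _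
  have q1 : M₁ 3 = fun c => if c < 2 ^ n then par c else 0 := by
    rw [hM₁, Function.update_of_ne (by norm_num), h3]
  have r2 := runs_invRounds F (k := 2) (A := A) (T := T) (by norm_num) p1 q1 hB (pw := pw) (j := j)
  set M₂ := Function.update M₁ 2 (flat (2 ^ n) (iiter w n T n)) with hM₂
  have p2 : M₂ 2 = flat (2 ^ n) (iiter w n T n) := Function.update_self _ _ _
  have r3 := (runs_fill_of_banks (k := 2) (e := extractE) (a := 2 ^ n * 2 ^ n) (pw := 1) (j := n)
    (A := A) (M := M₂) F (Nat.mul_pos (by positivity) (by positivity)) hn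
    (flat (2 ^ n) (fun r c => extract H w (iiter w n T n r c)))
    (fun i hi => by
      simp only [extractE, Ex.eval, Ex.eval_mod, vars, Int.toNat_natCast]
      rw [partFill_current p2 hi, flat, if_pos hi]
      rfl)
    (fun l => l = 2) (by simp [extractE, Ex.mod, Ex.Banks])
    (by rintro l rfl a; rw [p2]; exact hB n le_rfl a)
    (fun i _ => hE i)).mono (hle _)
  rw [partFill_flat p2] at r3
  refine ⟨_, (r1.seq (r2.seq r3)).mono (le_of_eq ?_), by simp only [Function.update_self]⟩
  rw [← hU]
  unfold postCost
  simp only [add_mul _ _ U]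

/-- Register 3 is program variable 1, holding 2^n; register 2 is register 0 of the subroutine, its
size parameter. -/
lemma runs_copy_size {v : ℕ → ℤ} (hv : bitLen (v 1) ≤ L) :
    Runs (.copy 2 3) ⟨v, A, M⟩ L ⟨v, Function.update A 0 (v 1), M⟩ := by
  intro s hs
  have h1 : (fun x => s.reg (3 * x)) = v := congrArg View.var hs
  have h2 : (fun x => s.reg (3 * x + 2)) = A := congrArg View.aux hs
  have h3 : s.mem = M := congrArg View.mem hs
  have h4 : s.reg 3 = v 1 := congrFun h1 1
  refine ⟨_, _, .copy 2 3 s, by rw [h4]; exact hv, ?_⟩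
  ext x
  · simp only [view, State.setReg]
    rw [Function.update_of_ne (by omega)]
    exact congrFun h1 x
  · simp only [view, State.setReg, h4]
    rcases x with _ | x
    · simp
    · rw [Function.update_of_ne (by omega), Function.update_of_ne (by omega)]
      exact congrFun h2 _
  · simp only [view, State.setReg, h3]

end prog

end NSC

/-! ### Bit-length bounds and the final time estimate -/

namespace NSC

/-! ### Size estimates -/

lemma abs_flat_le {m : ℕ} {T : ℕ → ℕ → ℤ} {B : ℤ} (h : ∀ r c, |T r c| ≤ B) (a : ℕ) :
    |flat m T a| ≤ B := by
  unfold flat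
  split_ifs
  · exact h _ _
  · rw [abs_zero]; exact (abs_nonneg _).trans (h 0 0)

lemma bitLen_le_of_abs_le {z : ℤ} {e S : ℕ} (h : |z| ≤ 2 ^ e) (he : e < S) : bitLen z ≤ S + 1 :=
  bitLen_le_of_abs_lt (h.trans_lt (pow_lt_pow_right₀ (by norm_num) he))

lemma abs_setTable_lt {n b : ℕ} {f : Finset (Fin n) → Finset (Fin n) → ℤ}
    (hf : ∀ X Y, |f X Y| < 2 ^ b) (a : ℕ) : |setTable f a| < 2 ^ b := by
  unfold setTable
  split_ifs
  · exact hf _ _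
  · simp

section sizes
variable {n b : ℕ} {t₀ t₁ : ℕ → ℤ}

lemma sumSq_le (h0 : ∀ a, |t₀ a| ≤ 2 ^ b) (h1 : ∀ a, |t₁ a| ≤ 2 ^ b) :
    sumSq t₀ t₁ (2 ^ n * 2 ^ n) ≤ 2 ^ (2 * n + 2 * b + 2) := by
  have hsq : ∀ x : ℤ, |x| ≤ 2 ^ b → x * x ≤ 2 ^ (2 * b) := fun x hx => by
    rw [← abs_mul_abs_self, two_mul, pow_add]
    exact mul_le_mul hx hx (abs_nonneg _) (by positivity)
  have hs := Finset.sum_le_card_nsmul (Finset.range (2 ^ n * 2 ^ n))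
    (fun a => t₀ a * t₀ a + t₁ a * t₁ a) (2 ^ (2 * b) + 2 ^ (2 * b))
    fun a _ => add_le_add (hsq _ (h0 a)) (hsq _ (h1 a))
  rw [Finset.card_range, nsmul_eq_mul] at hs
  have e : (((2 ^ n * 2 ^ n : ℕ) : ℤ)) * (2 ^ (2 * b) + 2 ^ (2 * b)) = 2 ^ (2 * n + 2 * b + 1) := by
    push_cast; rw [pow_succ, pow_add, two_mul n, pow_add]; ring
  rw [e] at hs
  have h1 : (1 : ℤ) ≤ 2 ^ (2 * n + 2 * b + 1) := one_le_pow₀ (by norm_num)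
  unfold sumSq
  rw [pow_succ]
  linarith

lemma abs_le_sumSq_left {m a : ℕ} (ha : a < m) : |t₀ a| ≤ sumSq t₀ t₁ m := by
  have h1 := Finset.single_le_sum (f := fun a => t₀ a * t₀ a + t₁ a * t₁ a)
    (fun a _ => add_nonneg (mul_self_nonneg _) (mul_self_nonneg _)) (Finset.mem_range.2 ha)
  have h2 := abs_mul_abs_self (t₀ a)
  have h3 := mul_self_nonneg (t₁ a)
  have h4 := mul_self_nonneg (|t₀ a| - 1)
  unfold sumSq
  nlinarith [abs_nonneg (t₀ a)]

lemma sumSq_comm (m : ℕ) : sumSq t₀ t₁ m = sumSq t₁ t₀ m := by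
  unfold sumSq
  congr 1
  exact Finset.sum_congr rfl fun a _ => add_comm _ _

lemma abs_le_sumSq_right {m a : ℕ} (ha : a < m) : |t₁ a| ≤ sumSq t₀ t₁ m := by
  rw [sumSq_comm]; exact abs_le_sumSq_left ha

lemma le_sumSq_setTable {f : Finset (Fin n) → Finset (Fin n) → ℤ} {W : ℤ}
    (h : ∀ a < 2 ^ n * 2 ^ n, |setTable f a| ≤ W) (X Y : Finset (Fin n)) : |f X Y| ≤ W := by
  obtain ⟨i, hi, -⟩ := exists_ix X
  obtain ⟨j, hj, -⟩ := exists_ix Y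
  have h1 : i.code * 2 ^ n + j.code < 2 ^ n * 2 ^ n := by
    have := j.code_lt
    calc i.code * 2 ^ n + j.code < (i.code + 1) * 2 ^ n := by rw [add_mul]; omega
      _ ≤ 2 ^ n * 2 ^ n := Nat.mul_le_mul_right _ i.code_lt
  have := h _ h1
  rwa [setTable_code, lft, hi, hj, res_map, res_map] at this

variable {w : ℤ} {q : ℕ}

lemma abs_pre_le {x y : ℤ} (hq : n + b + 1 = q) (hw : 1 ≤ w) (hwq : w ≤ 2 ^ (6 * q))
    (hx : |x| ≤ 2 ^ b) (hy : |y| ≤ 1 + w) : |x * y| ≤ 2 ^ (7 * q) := by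
  rw [abs_mul]
  calc |x| * |y| ≤ 2 ^ b * (2 ^ (6 * q) + 2 ^ (6 * q)) :=
        mul_le_mul hx (by omega) (abs_nonneg _) (by positivity)
    _ = 2 ^ (b + 6 * q + 1) := by rw [pow_succ, pow_add]; ring
    _ ≤ 2 ^ (7 * q) := pow_le_pow_right₀ (by norm_num) (by omega)

lemma abs_preL_le (hq : n + b + 1 = q) (hw : 1 ≤ w) (hwq : w ≤ 2 ^ (6 * q))
    (h0 : ∀ a, |t₀ a| ≤ 2 ^ b) (r c : ℕ) : |preL n w t₀ r c| ≤ 2 ^ (7 * q) := by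
  refine abs_pre_le hq hw hwq (h0 _) ((abs_add_le _ _).trans ?_)
  rw [abs_mul, abs_mul, abs_par, abs_par, abs_one, abs_of_pos (by omega : 0 < w)]
  omega

lemma abs_preR_le (hq : n + b + 1 = q) (hw : 1 ≤ w) (hwq : w ≤ 2 ^ (6 * q))
    (h0 : ∀ a, |t₀ a| ≤ 2 ^ b) (r c : ℕ) : |preR n w t₀ r c| ≤ 2 ^ (7 * q) := by
  refine abs_pre_le hq hw hwq (h0 _) ?_
  split_ifs
  · rw [abs_of_pos (by omega : 0 < w)]; omega
  · rw [abs_one]; omega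

/-- Each of at most n rounds multiplies the bound by 2 w² ≤ 2^(12q+1). This is where the exponent
becomes quadratic in q. -/
lemma abs_fiter_le_two_pow (hq : n + b + 1 = q) (hw : 1 ≤ w) (hwq : w ≤ 2 ^ (6 * q))
    {T : ℕ → ℕ → ℤ} (hT : ∀ r c, |T r c| ≤ 2 ^ (7 * q)) {i : ℕ} (hi : i ≤ n) (r c : ℕ) :
    |fiter w T i r c| ≤ 2 ^ (20 * q ^ 2) := by
  refine (abs_fiter_le hw hT i r c).trans ?_
  have h1 : 2 * (w * w) ≤ 2 ^ (12 * q + 1) := by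
    have := mul_le_mul hwq hwq (by omega) (by positivity)
    rw [← pow_add] at this
    rw [pow_succ, show 12 * q = 6 * q + 6 * q by ring]
    linarith
  calc (2 * (w * w)) ^ i * 2 ^ (7 * q) ≤ (2 ^ (12 * q + 1)) ^ i * 2 ^ (7 * q) := by gcongr
    _ = 2 ^ ((12 * q + 1) * i + 7 * q) := by rw [← pow_mul, ← pow_add]
    _ ≤ 2 ^ (20 * q ^ 2) := by
      apply pow_le_pow_right₀ (by norm_num)
      have h2 : i ≤ q := by omega
      have h3 : 1 ≤ q := by omega
      have h4 : (12 * q + 1) * i ≤ 13 * q * q := Nat.mul_le_mul (by omega) h2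
      nlinarith

lemma abs_prodTab_le (hq : n + b + 1 = q) {A B : ℕ → ℕ → ℤ}
    (hA : ∀ r c, |A r c| ≤ 2 ^ (20 * q ^ 2)) (hB : ∀ r c, |B r c| ≤ 2 ^ (20 * q ^ 2)) (r c : ℕ) :
    |prodTab (2 ^ n) A B r c| ≤ 2 ^ (41 * q ^ 2) := by
  unfold prodTab
  split_ifs
  · refine (Finset.abs_sum_le_sum_abs _ _).trans ((Finset.sum_le_card_nsmul _ _
      (2 ^ (20 * q ^ 2) * 2 ^ (20 * q ^ 2)) fun k _ => ?_).trans ?_)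
    · rw [abs_mul]
      exact mul_le_mul (hA _ _) (hB _ _) (abs_nonneg _) (by positivity)
    · rw [Finset.card_range, nsmul_eq_mul]
      push_cast
      rw [← pow_add, ← pow_add]
      apply pow_le_pow_right₀ (by norm_num)
      have : n ≤ q := by omega
      nlinarith
  · rw [abs_zero]; positivity

lemma abs_iiter_le_two_pow (hq : n + b + 1 = q) {T : ℕ → ℕ → ℤ}
    (hT : ∀ r c, |T r c| ≤ 2 ^ (41 * q ^ 2)) {i : ℕ} (hi : i ≤ n) (r c : ℕ) :
    |iiter w n T i r c| ≤ 2 ^ (42 * q ^ 2) := by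
  refine (abs_iiter_le hT i r c).trans ?_
  rw [← pow_add]
  apply pow_le_pow_right₀ (by norm_num)
  have : i ≤ q := by omega
  have : 1 ≤ q := by omega
  nlinarith

end sizes

/-! ### The main reduction -/

lemma matTable_eq_flat {N : ℕ} (hN : 0 < N) (T : ℕ → ℕ → ℤ) :
    matTable (Matrix.of fun i j : Fin N => T i j) = flat N T := by
  ext a
  have : (a / N < N ∧ a % N < N) ↔ a < N * N := by
    rw [Nat.div_lt_iff_lt_mul hN]
    exact ⟨fun h => h.1, fun h => ⟨h, Nat.mod_lt _ hN⟩⟩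
  unfold matTable flat
  simp only [this]
  split_ifs <;> rfl

lemma exists_nscProg_time {P : Prog} {C : ℕ} {τ : ℝ}
    (hP : ∀ (N b : ℕ) (A B : Matrix (Fin N) (Fin N) ℤ), 1 ≤ N →
      (∀ i j, |A i j| < 2 ^ b) → (∀ i j, |B i j| < 2 ^ b) →
      ∃ (s : State) (t : ℕ), Exec P (inputState N (matTable A) (matTable B)) s t ∧
        (t : ℝ) ≤ C * (N : ℝ) ^ τ * ((Nat.log 2 N + b + 1 : ℕ) : ℝ) ^ C ∧
        ∀ i j : Fin N, s.mem 2 (i * N + j) = (A * B) i j)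
    (n b : ℕ) (f g : Finset (Fin n) → Finset (Fin n) → ℤ)
    (hf : ∀ X Y, |f X Y| < 2 ^ b) (hg : ∀ X Y, |g X Y| < 2 ^ b) :
    ∃ (s : State) (t tP : ℕ), Exec (nscProg P) (inputState n (setTable f) (setTable g)) s t ∧
      t ≤ (prepCost + postCost) * ((n + 1) * (2 ^ n * 2 ^ n * (43 * (n + b + 1) ^ 2 + 1) ^ 2)) +
        (43 * (n + b + 1) ^ 2 + 1) + tP ∧
      (tP : ℝ) ≤ C * (2 : ℝ) ^ (τ * n) * ((n + (20 * (n + b + 1) ^ 2 + 1) + 1 : ℕ) : ℝ) ^ C ∧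
      ∀ X Y : Finset (Fin n), s.mem 2 (setCode X * 2 ^ n + setCode Y) = nsc2 f g X Y := by
  obtain ⟨q, hq⟩ : ∃ q, n + b + 1 = q := ⟨_, rfl⟩
  -- Exceeds all exponents that occur outside the subroutine: 6q for the parameters, 20q² forward,
  -- 41q² for the product, 42q² backward.
  set S := 43 * q ^ 2 with hS
  have hq1 : 1 ≤ q := by omega
  have hqq : q ≤ q ^ 2 := Nat.le_self_pow (by norm_num) q
  set N := 2 ^ n with hN
  have hN1 : 1 ≤ N := Nat.one_le_two_pow
  set t₀ := setTable f with ht₀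
  set t₁ := setTable g with ht₁
  have hb0 : ∀ a, |t₀ a| ≤ 2 ^ b := fun a => (abs_setTable_lt hf a).le
  have hb1 : ∀ a, |t₁ a| ≤ 2 ^ b := fun a => (abs_setTable_lt hg a).le
  obtain ⟨W, hW⟩ : ∃ W, W = sumSq t₀ t₁ (N * N) := ⟨_, rfl⟩
  obtain ⟨H, hH⟩ : ∃ H, H = ((N * N : ℕ) : ℤ) * (W * W) := ⟨_, rfl⟩
  obtain ⟨w, hw⟩ : ∃ w, w = H + H + 1 := ⟨_, rfl⟩
  have hW1 : 1 ≤ W := hW ▸ one_le_sumSq _ _ _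
  have hWle : W ≤ 2 ^ (2 * n + 2 * b + 2) := hW ▸ sumSq_le hb0 hb1
  have hH0 : 0 ≤ H := by rw [hH]; positivity
  have hHle : H ≤ 2 ^ (6 * n + 4 * b + 4) := by
    have h1 : ((N * N : ℕ) : ℤ) = 2 ^ (2 * n) := by rw [hN]; push_cast; rw [two_mul, pow_add]
    rw [hH, h1]
    calc (2 : ℤ) ^ (2 * n) * (W * W)
        ≤ 2 ^ (2 * n) * (2 ^ (2 * n + 2 * b + 2) * 2 ^ (2 * n + 2 * b + 2)) := by gcongr
      _ = 2 ^ (6 * n + 4 * b + 4) := by rw [← pow_add, ← pow_add]; congr 1; ring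
  have hw1 : 1 ≤ w := by omega
  have hwle : w ≤ 2 ^ (6 * q) := by
    have h1 : (1 : ℤ) ≤ 2 ^ (6 * n + 4 * b + 4) := one_le_pow₀ (by norm_num)
    calc w ≤ 2 ^ (6 * n + 4 * b + 4) * 2 ^ 2 := by omega
      _ = 2 ^ (6 * n + 4 * b + 4 + 2) := by rw [← pow_add]
      _ ≤ 2 ^ (6 * q) := pow_le_pow_right₀ (by norm_num) (by omega)
  have F : Fits n W w H (S + 1) := by
    refine ⟨?_, ?_, ?_, ?_⟩
    · refine bitLen_le_of_abs_le (e := 2 * n) ?_ (by omega)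
      rw [Nat.abs_cast]; push_cast; rw [two_mul, pow_add]
    · exact bitLen_le_of_abs_le (e := 2 * n + 2 * b + 2) (by rwa [abs_of_pos (by omega)]) (by omega)
    · exact bitLen_le_of_abs_le (e := 6 * q) (by rwa [abs_of_pos (by omega)]) (by omega)
    · exact bitLen_le_of_abs_le (e := 6 * n + 4 * b + 4) (by rwa [abs_of_nonneg hH0]) (by omega)
  set TL := fiter w (preL n w t₀) with hTL
  set TR := fiter w (preR n w t₁) with hTR
  have bL : ∀ i ≤ n, ∀ r c, |TL i r c| ≤ 2 ^ (20 * q ^ 2) := fun i hi r c =>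
    abs_fiter_le_two_pow hq hw1 hwle (abs_preL_le hq hw1 hwle hb0) hi r c
  have bR : ∀ i ≤ n, ∀ r c, |TR i r c| ≤ 2 ^ (20 * q ^ 2) := fun i hi r c =>
    abs_fiter_le_two_pow hq hw1 hwle (abs_preR_le hq hw1 hwle hb1) hi r c
  set T := prodTab N (TL n) (TR n) with hT
  have bT : ∀ r c, |T r c| ≤ 2 ^ (41 * q ^ 2) := abs_prodTab_le hq (bL n le_rfl) (bR n le_rfl)
  have bI : ∀ i ≤ n, ∀ r c, |iiter w n T i r c| ≤ 2 ^ (42 * q ^ 2) := fun i hi r c =>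
    abs_iiter_le_two_pow hq bT hi r c
  have bE : ∀ r c, |extract H w (iiter w n T n r c)| ≤ 2 ^ (6 * q) := fun r c => by
    have h1 := Int.emod_nonneg ((iiter w n T n r c + H) / w + H) (by omega : w ≠ 0)
    have h2 := Int.emod_lt_of_pos ((iiter w n T n r c + H) / w + H) (by omega : 0 < w)
    unfold extract
    rw [abs_le]; omega
  have h20 : 20 * q ^ 2 < S := by omega
  have h42 : 42 * q ^ 2 < S := by omega
  -- the first part
  set h₀ := view (inputState n t₀ t₁) with hh₀
  have hview : h₀ = ⟨vars n 0 0 0 0 0 0 0 0, fun _ => 0,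
      fun k a => if k = 0 then t₀ a else if k = 1 then t₁ a else 0⟩ := by
    rw [hh₀, view_inputState]
    ext x
    · rcases x with _ | _ | _ | _ | _ | _ | _ | _ | _ | x <;> rfl
    · rfl
    · rfl
  set M₀ : ℕ → ℕ → ℤ := fun k a => if k = 0 then t₀ a else if k = 1 then t₁ a else 0 with hM₀
  have r1 := runs_prep (A := fun _ => 0) (M := M₀) hW hH hw F
    (fun a => bitLen_le_of_abs_le (hb0 a) (by omega)) (fun a => bitLen_le_of_abs_le (hb1 a) (by omega))
    rfl rfl rfl (fun i hi a => bitLen_le_of_abs_le (abs_flat_le (bL i hi) a) h20)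
    (fun i hi a => bitLen_le_of_abs_le (abs_flat_le (bR i hi) a) h20)
  rw [← hview] at r1
  set M₁ := Function.update (Function.update (Function.update M₀ 3 fun c => if c < 2 ^ n then par c else 0)
    4 (flat (2 ^ n) (fiter w (preL n w (M₀ 0)) n))) 5 (flat (2 ^ n) (fiter w (preR n w (M₀ 1)) n)) with hM₁
  -- the matrix multiplication
  obtain ⟨s, tP, he, ht, hs⟩ := hP N (20 * q ^ 2 + 1) (Matrix.of fun i j => TL n i j)
    (Matrix.of fun i j => TR n i j) hN1
    (fun i j => (bL n le_rfl i j).trans_lt (pow_lt_pow_right₀ (by norm_num) (Nat.lt_succ_self _)))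
    (fun i j => (bR n le_rfl i j).trans_lt (pow_lt_pow_right₀ (by norm_num) (Nat.lt_succ_self _)))
  rw [matTable_eq_flat hN1, matTable_eq_flat hN1] at he
  have r2 := runs_copy_size (v := varsAt n W w H (2 ^ n * 2 ^ n) (2 ^ n) n) (A := fun _ => 0) (M := M₁)
    (F.nat (le_two_pow_mul_self n))
  have hreg : Function.update (fun _ => (0 : ℤ)) 0 (varsAt n W w H (2 ^ n * 2 ^ n) (2 ^ n) n 1) =
      (inputState N (flat N (TL n)) (flat N (TR n))).reg := by
    ext x; rcases x with _ | x <;> rfl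
  rw [hreg] at r2
  have r3 := runs_subroutine he (V := varsAt n W w H (2 ^ n * 2 ^ n) (2 ^ n) n) (M := M₁) (by
    intro k
    rcases k with _ | _ | k
    · rfl
    · rfl
    · rw [hM₁, Function.update_of_ne (by omega), Function.update_of_ne (by omega),
        Function.update_of_ne (by omega)]
      rfl)
  set M₂ : ℕ → ℕ → ℤ := fun k => if k < 4 then M₁ k else s.mem (k - 4) with hM₂
  have hprod : ∀ i < N * N, M₂ 6 i = flat N T i := by
    intro i hi
    have h1 : i / N < N := Nat.div_lt_of_lt_mul hi
    have h2 : i % N < N := Nat.mod_lt _ hN1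
    have h3 := hs ⟨i / N, h1⟩ ⟨i % N, h2⟩
    simp only [Nat.div_add_mod'] at h3
    rw [flat, if_pos hi, hT, prodTab, if_pos ⟨h1, h2⟩]
    change s.mem 2 i = _
    rw [h3, Matrix.mul_apply]
    exact Fin.sum_univ_eq_sum_range (fun k => TL n (i / N) k * TR n k (i % N)) N
  -- the last part
  obtain ⟨h', r4, hres⟩ := runs_post (A := s.reg) (M := M₂) F (T := T) rfl rfl hprod
    (fun i hi a => bitLen_le_of_abs_le (abs_flat_le (bI i hi) a) h42)
    (fun a => bitLen_le_of_abs_le (abs_flat_le bE a) (by omega))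
    (pw := 2 ^ n) (j := n) (le_two_pow_mul_self n) (Nat.lt_two_pow_self.le.trans (le_two_pow_mul_self n))
  obtain ⟨s', t, e, hle, hv⟩ := (r1.seq (r2.seq (r3.seq r4))) (inputState n t₀ t₁) rfl
  refine ⟨s', t, tP, e, hle.trans (le_of_eq ?_), ?_, ?_⟩
  · rw [hq]; ring
  · have hlog : Nat.log 2 N = n := Nat.log_pow (by norm_num) n
    have e1 : ((N : ℕ) : ℝ) ^ τ = (2 : ℝ) ^ (τ * n) := by
      rw [hN, mul_comm, Real.rpow_mul (by norm_num), Real.rpow_natCast]; push_cast; rfl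
    rw [hlog, e1] at ht
    rw [hq]; exact ht
  · intro X Y
    obtain ⟨i, -, hi⟩ := exists_ix X
    obtain ⟨j, -, hj⟩ := exists_ix Y
    have hi' := i.code_lt
    have hj' := j.code_lt
    rw [hi] at hi'
    rw [hj] at hj'
    have hmem : s'.mem = h'.mem := congrArg View.mem hv
    have d1 : (setCode X * N + setCode Y) / N = setCode X := by
      rw [mul_comm, Nat.mul_add_div hN1, Nat.div_eq_of_lt hj', add_zero]
    have d2 : (setCode X * N + setCode Y) % N = setCode Y := by
      rw [mul_comm, Nat.mul_add_mod, Nat.mod_eq_of_lt hj']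
    have d3 : setCode X * N + setCode Y < N * N := by
      calc setCode X * N + setCode Y < (setCode X + 1) * N := by rw [add_mul]; omega
        _ ≤ N * N := Nat.mul_le_mul_right _ hi'
    rw [hmem, hres, flat, if_pos d3, d1, d2]
    refine extract_eq_nsc2 (W := W) (le_sumSq_setTable fun a ha => ?_) (le_sumSq_setTable fun a ha => ?_)
      (by rw [hH, hN]; push_cast; ring) (by omega) X Y
    · rw [hW]; exact abs_le_sumSq_left ha
    · rw [hW]; exact abs_le_sumSq_right ha

/-- The exponent is not lost in the reduction: the overhead is 4^n times a polynomial, and 4^n ≤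
2^(τn) because τ ≥ 2. -/
theorem nsc2InTime_of_matMulInTime {τ : ℝ} (h : MatMulInTime τ) : NSC2InTime τ := by
  have hτ := two_le_of_matMulInTime h
  obtain ⟨P, C, hP⟩ := h
  obtain ⟨K, hK⟩ : ∃ K, K = prepCost + postCost := ⟨_, rfl⟩
  -- One number must serve as factor and as exponent, hence the sum. 1936 = 44² comes from (43q² +
  -- 1)² ≤ (44q²)², and 22^C from the logarithmic factor (22q²)^C. The exponent 2C + 5 covers q^(2C)
  -- and (n + 1) q⁴ ≤ q⁵.
  refine ⟨nscProg P, K * 1936 + 44 + C * 22 ^ C + (2 * C + 5), fun n b f g hf hg => ?_⟩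
  obtain ⟨s, t, tP, e, ht, htP, hs⟩ := exists_nscProg_time hP n b f g hf hg
  refine ⟨s, t, e, ?_, hs⟩
  obtain ⟨q, hq⟩ : ∃ q, n + b + 1 = q := ⟨_, rfl⟩
  rw [hq, ← hK] at ht
  rw [hq] at htP ⊢
  have hq1 : 1 ≤ q := by omega
  have hqq : q ≤ q ^ 2 := Nat.le_self_pow (by norm_num) q
  set E := 2 * C + 5 with hE
  set R : ℝ := (2 : ℝ) ^ (τ * n) with hR
  have hR4 : ((2 ^ n * 2 ^ n : ℕ) : ℝ) ≤ R := by
    have : ((2 ^ n * 2 ^ n : ℕ) : ℝ) = (2 : ℝ) ^ ((2 : ℝ) * n) := by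
      rw [Real.rpow_mul (by norm_num), Real.rpow_natCast]
      push_cast
      rw [← mul_pow]; norm_num
    rw [this]
    exact Real.rpow_le_rpow_of_exponent_le (by norm_num) (by gcongr)
  have hR1 : 1 ≤ R := by
    refine le_trans ?_ hR4
    exact_mod_cast Nat.mul_pos (by positivity : 0 < 2 ^ n) (by positivity : 0 < 2 ^ n)
  have hq1' : (1 : ℝ) ≤ q := by exact_mod_cast hq1
  have p1 : ((K * ((n + 1) * (2 ^ n * 2 ^ n * (43 * q ^ 2 + 1) ^ 2)) : ℕ) : ℝ) ≤
      (K * 1936) * R * (q : ℝ) ^ E := by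
    have h1 : (n + 1) * (2 ^ n * 2 ^ n * (43 * q ^ 2 + 1) ^ 2) ≤ 1936 * (2 ^ n * 2 ^ n) * q ^ E := by
      calc (n + 1) * (2 ^ n * 2 ^ n * (43 * q ^ 2 + 1) ^ 2)
          ≤ q * (2 ^ n * 2 ^ n * (44 * q ^ 2) ^ 2) := by gcongr <;> omega
        _ = 1936 * (2 ^ n * 2 ^ n) * q ^ 5 := by ring
        _ ≤ 1936 * (2 ^ n * 2 ^ n) * q ^ E := by gcongr; omega
    calc ((K * ((n + 1) * (2 ^ n * 2 ^ n * (43 * q ^ 2 + 1) ^ 2)) : ℕ) : ℝ)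
        ≤ ((K * (1936 * (2 ^ n * 2 ^ n) * q ^ E) : ℕ) : ℝ) := by exact_mod_cast Nat.mul_le_mul_left _ h1
      _ = (K * 1936) * ((2 ^ n * 2 ^ n : ℕ) : ℝ) * (q : ℝ) ^ E := by push_cast; ring
      _ ≤ (K * 1936) * R * (q : ℝ) ^ E := by gcongr
  have p2 : ((43 * q ^ 2 + 1 : ℕ) : ℝ) ≤ 44 * R * (q : ℝ) ^ E := by
    have h1 : 43 * q ^ 2 + 1 ≤ 44 * q ^ E := by
      calc 43 * q ^ 2 + 1 ≤ 44 * q ^ 2 := by omega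
        _ ≤ 44 * q ^ E := by gcongr; omega
    calc ((43 * q ^ 2 + 1 : ℕ) : ℝ) ≤ ((44 * q ^ E : ℕ) : ℝ) := by exact_mod_cast h1
      _ = 44 * 1 * (q : ℝ) ^ E := by push_cast; ring
      _ ≤ 44 * R * (q : ℝ) ^ E := by gcongr
  have p3 : (tP : ℝ) ≤ (C * 22 ^ C) * R * (q : ℝ) ^ E := by
    have h1 : n + (20 * q ^ 2 + 1) + 1 ≤ 22 * q ^ 2 := by omega
    calc (tP : ℝ) ≤ C * R * ((n + (20 * q ^ 2 + 1) + 1 : ℕ) : ℝ) ^ C := htP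
      _ ≤ C * R * ((22 * q ^ 2 : ℕ) : ℝ) ^ C := by
        gcongr
      _ = (C * 22 ^ C) * R * (q : ℝ) ^ (2 * C) := by push_cast; rw [mul_pow, pow_mul]; ring
      _ ≤ (C * 22 ^ C) * R * (q : ℝ) ^ E := by
        gcongr
        omega
  have h2 : (q : ℝ) ^ E ≤ (q : ℝ) ^ (K * 1936 + 44 + C * 22 ^ C + E) :=
    pow_le_pow_right₀ hq1' (by omega)
  calc (t : ℝ) ≤ ((K * ((n + 1) * (2 ^ n * 2 ^ n * (43 * q ^ 2 + 1) ^ 2)) : ℕ) : ℝ) +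
        ((43 * q ^ 2 + 1 : ℕ) : ℝ) + tP := by exact_mod_cast ht
    _ ≤ (K * 1936) * R * (q : ℝ) ^ E + 44 * R * (q : ℝ) ^ E + (C * 22 ^ C) * R * (q : ℝ) ^ E :=
      add_le_add (add_le_add p1 p2) p3
    _ = (K * 1936 + 44 + C * 22 ^ C) * R * (q : ℝ) ^ E := by ring
    _ ≤ (K * 1936 + 44 + C * 22 ^ C + E : ℕ) * R * (q : ℝ) ^ (K * 1936 + 44 + C * 22 ^ C + E) := by
      gcongr
      push_cast
      have : (0 : ℝ) ≤ (E : ℝ) := by positivity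
      linarith

lemma NSC2InTime.mono {τ τ' : ℝ} (h : NSC2InTime τ) (hτ : τ ≤ τ') : NSC2InTime τ' := by
  obtain ⟨P, C, hP⟩ := h
  refine ⟨P, C, fun n b f g hf hg => ?_⟩
  obtain ⟨s, t, e, ht, hs⟩ := hP n b f g hf hg
  refine ⟨s, t, e, ht.trans ?_, hs⟩
  gcongr
  norm_num

end NSC

theorem mainTheorem6 :
    (∀ ε : ℝ, 0 < ε → NSC.NSC2InTime (NSC.matMulExponent + ε)) ∧
    (NSC.MatMulInTime NSC.matMulExponent → NSC.NSC2InTime NSC.matMulExponent) := by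
  refine ⟨fun ε hε => ?_, NSC.nsc2InTime_of_matMulInTime⟩
  -- The infimum itself need not be admissible, but some admissible exponent lies below it plus ε,
  -- and larger exponents are weaker claims.
  obtain ⟨τ, hτ, hlt⟩ := exists_lt_of_csInf_lt (s := {τ : ℝ | NSC.MatMulInTime τ})
    ⟨3, NSC.matMulInTime_three⟩ (show NSC.matMulExponent < NSC.matMulExponent + ε by linarith)
  exact (NSC.nsc2InTime_of_matMulInTime hτ).mono hlt.le
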